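/- Let $(M,\omega)$ and $(N,h)$ be Kähler manifolds (without boundary, not necessarily compact), $n=\dim_{\mathbb C}M\ge 2$, with $\omega=\frac{\sqrt{-1}}2 g_{\alpha\bar\beta}\,dz^\alpha\wedge d\bar z^\beta$, so that $\omega(u,v)=g(Ju,v)$ and $\omega^n/n!$ is the Riemannian volume form. Let $f:M\to N$ be a smooth harmonic map. Put $E'=f^{-1}T^{(1,0)}N$ with the Hermitian metric $\langle\cdot,\cdot\rangle$ obtained by extending $h$ sesquilinearly, $h_{i\bar j}=\langle\frac{\partial}{\partial w^i},\frac{\partial}{\partial w^j}\rangle$ in local holomorphic coordinates $(w^i)$ of $N$, and with the connection induced by the Levi-Civita connection of $N$, and let $\partial_{E'}$, $\bar\partial_{E'}$ be the $(1,0)$ and $(0,1)$ parts of the induced exterior covariant derivative on $E'$-valued forms. Write $f^i=w^i\circ f$, $\partial f=\partial f^i\otimes\frac{\partial}{\partial f^i}$ and $\bar\partial f=\bar\partial f^i\otimes\frac{\partial}{\partial f^i}$, where $\frac{\partial}{\partial f^i}=\frac{\partial}{\partial w^i}\circ f$. For $E'$-valued forms $\psi=\psi^i\otimes\frac{\partial}{\partial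 f^i}$, $\xi=\xi^j\otimes\frac{\partial}{\partial f^j}$ let $\{\psi,\xi\}=h_{i\bar j}\,\psi^i\wedge\overline{\xi^j}$, and for an $E'$-valued $(1,1)$-form $\phi=\phi_{\alpha\bar\beta}\,dz^\alpha\wedge d\bar z^\beta$ let $|\phi|^2=g^{\alpha\bar\delta}g^{\gamma\bar\beta}\langle\phi_{\alpha\bar\beta},\phi_{\delta\bar\gamma}\rangle$. Let $$R_{i\bar jk\bar l}=-\frac{\partial^2h_{i\bar j}}{\partial w^k\partial\bar w^l}+h^{p\bar q}\frac{\partial h_{k\bar q}}{\partial w^i}\frac{\partial h_{p\bar l}}{\partial\bar w^j}.$$ Then there is a unique function $Q:M\to\mathbb R$ with $$Q\,\frac{\omega^n}{n!}=-R_{i\bar jk\bar l}\;\bar\partial f^i\wedge\partial\bar f^j\wedge\partial f^k\wedge\bar\partial\bar f^l\wedge\frac{\omega^{n-2}}{(n-2)!},$$ and $$d\{\bar\partial_{E'}\partial f,\ \bar\partial f-\partial f\}\wedge\frac{\omega^{n-2}}{(n-2)!}=\left(8\,|\partial_{E'}\bar\partial f|^2+2Q\right)\frac{\omega^n}{n!}.$$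 Moreover the left-hand side is the exterior derivative of the globally defined form $\{\bar\partial_{E'}\partial f,\bar\partial f-\partial f\}\wedge\frac{\omega^{n-2}}{(n-2)!}$, so the right-hand side is exact. -/

import Mathlib

open scoped Manifold ContDiff Topology Nat

noncomputable section

namespace KaehlerBochner

/-! ## Exterior algebra on a real normed space -/

section Wedge

variable {V G₁ G₂ G₃ : Type*}
  [NormedAddCommGroup V] [NormedSpace ℝ V] [NormedAddCommGroup G₁] [NormedSpace ℝ G₁]
  [NormedAddCommGroup G₂] [NormedSpace ℝ G₂] [NormedAddCommGroup G₃] [NormedSpace ℝ G₃]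
  {p q : ℕ}

/-- The multilinear map `v ↦ B (α (v₀, …, v_{p-1})) (β (v_p, …, v_{p+q-1}))`. -/
def tensorPairing (B : G₁ →L[ℝ] G₂ →L[ℝ] G₃) (α : V [⋀^Fin p]→L[ℝ] G₁)
    (β : V [⋀^Fin q]→L[ℝ] G₂) :
    ContinuousMultilinearMap ℝ (fun _ : Fin (p + q) => V) G₃ :=
  ContinuousMultilinearMap.domDomCongr finSumFinEquiv
    (ContinuousMultilinearMap.uncurrySum
      (((ContinuousLinearMap.compContinuousMultilinearMapL ℝ (fun _ : Fin q => V) G₂ G₃).flip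
          β.toContinuousMultilinearMap ∘L B).compContinuousMultilinearMap
        α.toContinuousMultilinearMap))

/-- The wedge product of vector-valued alternating forms with respect to a bilinear pairing `B` of
the values, normalised by `(α ∧ β)(u, v) = B (α u) (β v) - B (α v) (β u)` on 1-forms. -/
def wedge (B : G₁ →L[ℝ] G₂ →L[ℝ] G₃) (α : V [⋀^Fin p]→L[ℝ] G₁)
    (β : V [⋀^Fin q]→L[ℝ] G₂) : V [⋀^Fin (p + q)]→L[ℝ] G₃ :=
  ((p ! : ℝ) * (q ! : ℝ))⁻¹ •
    ContinuousMultilinearMap.alternatization (tensorPairing B α β)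

theorem wedge_apply (B : G₁ →L[ℝ] G₂ →L[ℝ] G₃) (α : V [⋀^Fin p]→L[ℝ] G₁)
    (β : V [⋀^Fin q]→L[ℝ] G₂) (v : Fin (p + q) → V) :
    wedge B α β v = ((p ! : ℝ) * (q ! : ℝ))⁻¹ •
      ∑ σ : Equiv.Perm (Fin (p + q)), Equiv.Perm.sign σ •
        B (α fun i => v (σ (Fin.castAdd q i))) (β fun j => v (σ (Fin.natAdd p j))) := by
  rw [wedge, ContinuousAlternatingMap.smul_apply,
    ContinuousMultilinearMap.alternatization_apply_apply]
  rfl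

/-- The wedge product of complex-valued forms. -/
def cwedge (α : V [⋀^Fin p]→L[ℝ] ℂ) (β : V [⋀^Fin q]→L[ℝ] ℂ) :
    V [⋀^Fin (p + q)]→L[ℝ] ℂ :=
  wedge (ContinuousLinearMap.mul ℝ ℂ) α β

/-- The powers `α ^ k` of a complex-valued 2-form, for the wedge product. -/
def wedgePow (α : V [⋀^Fin 2]→L[ℝ] ℂ) : (k : ℕ) → V [⋀^Fin (2 * k)]→L[ℝ] ℂ
  | 0 => (ContinuousAlternatingMap.constOfIsEmpty ℝ V (Fin 0) (1 : ℂ) :)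
  | k + 1 => cwedge (wedgePow α k) α

/-- `α ^ k / k!`. -/
def dividedPow (α : V [⋀^Fin 2]→L[ℝ] ℂ) (k : ℕ) : V [⋀^Fin (2 * k)]→L[ℝ] ℂ :=
  ((k ! : ℝ))⁻¹ • wedgePow α k

/-- A `p`-form regarded as a `q`-form when `p = q`. -/
def castDeg (h : p = q) (α : V [⋀^Fin p]→L[ℝ] G₁) : V [⋀^Fin q]→L[ℝ] G₁ := h ▸ α

theorem castDeg_apply (h : p = q) (α : V [⋀^Fin p]→L[ℝ] G₁) (v : Fin q → V) :
    castDeg h α v = α (v ∘ Fin.cast h) := by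
  subst h
  rfl

/-- A linear map as an alternating form of degree one. -/
def oneForm (L : V →L[ℝ] G₁) : V [⋀^Fin 1]→L[ℝ] G₁ :=
  ContinuousAlternatingMap.ofSubsingleton ℝ V G₁ 0 L

end Wedge

/-! ## Linear algebra on a complex vector space -/

section Linear

variable {V : Type*} [NormedAddCommGroup V] [NormedSpace ℂ V]

variable (V) in
/-- Multiplication by `√-1` as a real-linear map. -/
def mulI : V →L[ℝ] V := Complex.I • ContinuousLinearMap.id ℝ V

theorem mulI_apply (v : V) : mulI V v = Complex.I • v := rfl

variable {G : Type*} [AddCommGroup G] [TopologicalSpace G] [IsTopologicalAddGroup G]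
  [Module ℝ G] [Module ℂ G] [ContinuousConstSMul ℝ G] [ContinuousConstSMul ℂ G]
  [SMulCommClass ℝ ℂ G]

/-- The (1,0)-part `(L - √-1 L ∘ J) / 2` of a real-linear map to a complex vector space. -/
def holPart (L : V →L[ℝ] G) : V →L[ℝ] G :=
  (2 : ℝ)⁻¹ • (L - Complex.I • (L ∘L mulI V))

/-- The (0,1)-part `(L + √-1 L ∘ J) / 2` of a real-linear map to a complex vector space. -/
def antiPart (L : V →L[ℝ] G) : V →L[ℝ] G :=
  (2 : ℝ)⁻¹ • (L + Complex.I • (L ∘L mulI V))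

/-- The Hermitian extension of a `J`-invariant inner product `h`, restricted to vectors of type
(1,0): `⟨u', v'⟩ = (h(u, v) + √-1 h(u, J v)) / 2` for `u' = (u - √-1 J u) / 2` and
`v' = (v - √-1 J v) / 2`. It is complex linear in `u` and conjugate linear in `v`. -/
def herm (h : V →L[ℝ] V →L[ℝ] ℝ) : V →L[ℝ] V →L[ℝ] ℂ :=
  (2 : ℝ)⁻¹ •
    (ContinuousLinearMap.compL ℝ V ℝ ℂ Complex.ofRealCLM ∘L h +
      Complex.I • ((ContinuousLinearMap.compL ℝ V ℝ ℂ Complex.ofRealCLM ∘L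
        ((ContinuousLinearMap.compL ℝ V V ℝ).flip (mulI V) ∘L h))))

theorem herm_apply (h : V →L[ℝ] V →L[ℝ] ℝ) (u v : V) :
    herm h u v = (2 : ℝ)⁻¹ • ((h u v : ℂ) + Complex.I * (h u (Complex.I • v) : ℂ)) := rfl

end Linear

/-! ## Christoffel symbols and curvature in a chart -/

section Local

variable {V : Type*} [NormedAddCommGroup V] [NormedSpace ℝ V]

variable [FiniteDimensional ℝ V] in
/-- The Gram matrix of a bilinear form in the fixed real basis `Module.finBasis ℝ V`. -/
def gram (B : V →L[ℝ] V →L[ℝ] ℝ) :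
    Matrix (Fin (Module.finrank ℝ V)) (Fin (Module.finrank ℝ V)) ℝ :=
  fun a b => B (Module.finBasis ℝ V a) (Module.finBasis ℝ V b)

/-- For a metric `G` on (an open part of) `V`, the Christoffel symbols of the first kind:
`(D_u G(v, w) + D_v G(u, w) - D_w G(u, v)) / 2` as a bilinear form in `(u, v)`. -/
def christoffelFirst (G : V → V →L[ℝ] V →L[ℝ] ℝ) (z w : V) : V →L[ℝ] V →L[ℝ] ℝ :=
  let A : V →L[ℝ] V →L[ℝ] ℝ :=
    ContinuousLinearMap.compL ℝ V (V →L[ℝ] ℝ) ℝ (ContinuousLinearMap.apply ℝ ℝ w) ∘L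
      fderiv ℝ G z
  (2 : ℝ)⁻¹ • (A + A.flip - fderiv ℝ G z w)

theorem christoffelFirst_apply (G : V → V →L[ℝ] V →L[ℝ] ℝ) (z w u v : V) :
    christoffelFirst G z w u v =
      2⁻¹ * (fderiv ℝ G z u v w + fderiv ℝ G z v u w - fderiv ℝ G z w u v) := rfl

variable [FiniteDimensional ℝ V]

/-- The Christoffel symbols `Γ(u, v) = ∇_u v` (for constant `u`, `v`) of the Levi-Civita connection
of the metric `G`, i.e. `Γᵃ = ∑_b Gᵃᵇ Γ_b` with `Γ_b` of the first kind. -/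
def christoffel (G : V → V →L[ℝ] V →L[ℝ] ℝ) (z : V) : V →L[ℝ] V →L[ℝ] V :=
  ∑ a, ∑ b, (gram (G z))⁻¹ a b •
    (ContinuousLinearMap.compL ℝ V ℝ V
      (ContinuousLinearMap.toSpanSingleton ℝ (Module.finBasis ℝ V a)) ∘L
        christoffelFirst G z (Module.finBasis ℝ V b))

theorem christoffel_apply (G : V → V →L[ℝ] V →L[ℝ] ℝ) (z u v : V) :
    christoffel G z u v = ∑ a, ∑ b, (gram (G z))⁻¹ a b •
      (christoffelFirst G z (Module.finBasis ℝ V b) u v • Module.finBasis ℝ V a) := by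
  simp [christoffel]

/-- The action `u ↦ (L u) ∘ α` of an endomorphism-valued 1-form on a vector-valued form. -/
def endAct {W : Type*} [NormedAddCommGroup W] [NormedSpace ℝ W] {k : ℕ}
    (L : V →L[ℝ] W →L[ℝ] W) (α : V [⋀^Fin k]→L[ℝ] W) : V →L[ℝ] V [⋀^Fin k]→L[ℝ] W :=
  LinearMap.toContinuousLinearMap
    { toFun := fun u => (L u).compContinuousAlternatingMap α
      map_add' := fun u v => by ext; simp
      map_smul' := fun c u => by ext; simp }

end Local

section LocalComplex

variable {V : Type*} [NormedAddCommGroup V] [NormedSpace ℂ V] {m : ℕ}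

/-- `∂u/∂wᵏ`, for the linear coordinates `w` of the basis `b`. -/
def dHol (b : Module.Basis (Fin m) ℂ V) (k : Fin m) (u : V → ℂ) (z : V) : ℂ :=
  2⁻¹ * (fderiv ℝ u z (b k) - Complex.I * fderiv ℝ u z (Complex.I • b k))

/-- `∂u/∂w̄ᵏ`, for the linear coordinates `w` of the basis `b`. -/
def dAnti (b : Module.Basis (Fin m) ℂ V) (k : Fin m) (u : V → ℂ) (z : V) : ℂ :=
  2⁻¹ * (fderiv ℝ u z (b k) + Complex.I * fderiv ℝ u z (Complex.I • b k))

/-- The coefficients `h_{i j̄} = ⟨∂/∂wⁱ, ∂/∂wʲ⟩` of a metric given in a holomorphic chart. -/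
def hermMatrix (b : Module.Basis (Fin m) ℂ V) (G : V → V →L[ℝ] V →L[ℝ] ℝ) (z : V) :
    Matrix (Fin m) (Fin m) ℂ :=
  fun i j => herm (G z) (b i) (b j)

/-- The curvature coefficients of a Kähler metric in holomorphic coordinates,
`R_{i j̄ k l̄} = - ∂²h_{i j̄}/∂wᵏ∂w̄ˡ + h^{p q̄} (∂h_{k q̄}/∂wⁱ) (∂h_{p l̄}/∂w̄ʲ)`,
where `∑_q h^{p q̄} h_{r q̄} = δ_{p r}`. -/
def curvCoeff (b : Module.Basis (Fin m) ℂ V) (G : V → V →L[ℝ] V →L[ℝ] ℝ) (z : V)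
    (i j k l : Fin m) : ℂ :=
  - dHol b k (dAnti b l fun w => hermMatrix b G w i j) z +
    ∑ p, ∑ q, (hermMatrix b G z)⁻¹ q p *
      dHol b i (fun w => hermMatrix b G w k q) z * dAnti b j (fun w => hermMatrix b G w p l) z

end LocalComplex

/-! ## Complex manifolds

A complex manifold is a manifold modelled on a finite-dimensional complex vector space `E` with
holomorphic transition maps. The tangent space `TangentSpace 𝓘(ℝ, E) x` is by definition the model
space `E`, identified through the derivative at `x` of the chart `chartAt E x`; its complex
structure `J` is therefore the multiplication by `√-1` of `E`. -/

section Manifold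

variable {E : Type*} [NormedAddCommGroup E] [NormedSpace ℂ E]
  {M : Type*} [TopologicalSpace M] [ChartedSpace E M]

/-- A complex manifold is a smooth manifold. -/
instance realManifold [IsManifold 𝓘(ℂ, E) ∞ M] : IsManifold 𝓘(ℝ, E) ∞ M := by
  refine isManifold_of_contDiffOn 𝓘(ℝ, E) ∞ M fun e e' he he' => ?_
  have h := StructureGroupoid.compatible (contDiffGroupoid ∞ 𝓘(ℂ, E)) he he'
  rw [contDiffGroupoid, mem_groupoid_of_pregroupoid] at h
  exact h.1.restrict_scalars ℝ

/-- The derivative at `z` of the inverse of the chart centred at `x₀`, as a map to the tangent space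
of `M`. -/
def chartSymmDeriv (x₀ : M) (z : E) : E →L[ℝ] E :=
  mfderiv 𝓘(ℝ, E) 𝓘(ℝ, E) (chartAt E x₀).symm z

/-- The derivative at `x` of the chart centred at `x₀`, as a map from the tangent space of `M`. -/
def chartDeriv (x₀ x : M) : E →L[ℝ] E :=
  mfderiv 𝓘(ℝ, E) 𝓘(ℝ, E) (chartAt E x₀) x

/-- A complex-valued `k`-form on `M` written in the chart centred at `x₀`. -/
def localForm {k : ℕ} (α : M → E [⋀^Fin k]→L[ℝ] ℂ) (x₀ : M) (z : E) : E [⋀^Fin k]→L[ℝ] ℂ :=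
  (α ((chartAt E x₀).symm z)).compContinuousLinearMap (chartSymmDeriv x₀ z)

/-- The exterior derivative of a complex-valued `k`-form on `M`. -/
def extD {k : ℕ} (α : M → E [⋀^Fin k]→L[ℝ] ℂ) (x : M) : E [⋀^Fin (k + 1)]→L[ℝ] ℂ :=
  extDeriv (localForm α x) (chartAt E x x)

/-- A bilinear form on the tangent bundle of `M` written in the chart centred at `x₀`. -/
def localMetric (B : M → E →L[ℝ] E →L[ℝ] ℝ) (x₀ : M) (z : E) : E →L[ℝ] E →L[ℝ] ℝ :=
  (B ((chartAt E x₀).symm z)).bilinearComp (chartSymmDeriv x₀ z) (chartSymmDeriv x₀ z)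

end Manifold

section Kaehler

variable {E : Type*} [NormedAddCommGroup E] [NormedSpace ℂ E]
  {M : Type*} [TopologicalSpace M] [ChartedSpace E M] [IsManifold 𝓘(ℂ, E) ∞ M]

/-- The complex-valued 2-form `ω(u, v) = (B(J u, v) - B(J v, u)) / 2`, which is `B(J u, v)` when
`B` is symmetric and `J`-invariant. -/
def fundamentalForm (B : E →L[ℝ] E →L[ℝ] ℝ) : E [⋀^Fin 2]→L[ℝ] ℂ :=
  (2 : ℝ)⁻¹ • wedge (p := 1) (q := 1)
    (ContinuousLinearMap.compL ℝ E ℝ ℂ Complex.ofRealCLM ∘L (B ∘L mulI E))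
    (oneForm (ContinuousLinearMap.id ℝ E)) (oneForm (ContinuousLinearMap.id ℝ E))

variable (E M) in
/-- A Kähler metric on a complex manifold: a smooth Riemannian metric `g` which is invariant under
the complex structure `J` and whose Kähler form `ω(u, v) = g(J u, v)` is closed. -/
structure KaehlerMetric extends
    Bundle.ContMDiffRiemannianMetric 𝓘(ℝ, E) ∞ E (fun x : M => TangentSpace 𝓘(ℝ, E) x) where
  inner_J : ∀ (x : M) (u v : E), (inner x : E →L[ℝ] E →L[ℝ] ℝ) (Complex.I • u) (Complex.I • v) =
    (inner x : E →L[ℝ] E →L[ℝ] ℝ) u v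
  closed : ∀ x : M, extD (fun y : M => fundamentalForm (inner y : E →L[ℝ] E →L[ℝ] ℝ)) x = 0

/-- The inner product on the tangent space at `x`. -/
def KaehlerMetric.metric (g : KaehlerMetric E M) (x : M) : E →L[ℝ] E →L[ℝ] ℝ := g.inner x

/-- The Kähler form. -/
def KaehlerMetric.form (g : KaehlerMetric E M) (x : M) : E [⋀^Fin 2]→L[ℝ] ℂ :=
  fundamentalForm (g.metric x)

theorem KaehlerMetric.form_apply (g : KaehlerMetric E M) (x : M) (u v : E) :
    g.form x ![u, v] = g.metric x (Complex.I • u) v := by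
  have h1 : g.metric x (Complex.I • v) u = - g.metric x (Complex.I • u) v := by
    have h2 := g.inner_J x (Complex.I • v) u
    have h3 : g.metric x (Complex.I • Complex.I • v) (Complex.I • u) =
      g.metric x (Complex.I • v) u := h2
    have h4 : g.metric x (Complex.I • u) v = g.metric x v (Complex.I • u) := g.symm x _ _
    rw [← h3, h4, smul_smul, Complex.I_mul_I, neg_one_smul, map_neg,
      neg_apply]
  have h5 : (Finset.univ : Finset (Equiv.Perm (Fin 2))) = {1, Equiv.swap 0 1} := by decide
  have h6 : (1 : Equiv.Perm (Fin 2)) ≠ Equiv.swap 0 1 := by decide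
  rw [KaehlerMetric.form, fundamentalForm, ContinuousAlternatingMap.smul_apply, wedge_apply]
  erw [h5, Finset.sum_pair h6]
  have e0 : (Fin.castAdd 1 (0 : Fin 1) : Fin (1 + 1)) = (0 : Fin 2) := rfl
  simp [oneForm, mulI_apply, e0, h1]
  ring

end Kaehler

/-! ## Maps between Kähler manifolds

For `f : M → N`, the bundle `E' = f⁻¹ T^{(1,0)} N` is identified with `f⁻¹ T N`, with the complex
structure `J`, by the isomorphism `v ↦ (v - √-1 J v) / 2` from `T N` to `T^{(1,0)} N`. An `E'`-valued
`k`-form is then a family of alternating maps `T_x M × ⋯ × T_x M → T_{f x} N`, and the `E'`-part of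
`df` is `df : T_x M → T_{f x} N` itself. -/

section Maps

variable {E : Type*} [NormedAddCommGroup E] [NormedSpace ℂ E] [FiniteDimensional ℂ E]
  {F : Type*} [NormedAddCommGroup F] [NormedSpace ℂ F] [FiniteDimensional ℂ F]
  {M : Type*} [TopologicalSpace M] [ChartedSpace E M] [IsManifold 𝓘(ℂ, E) ∞ M]
  {N : Type*} [TopologicalSpace N] [ChartedSpace F N] [IsManifold 𝓘(ℂ, F) ∞ N]
  {k p q : ℕ}

/-- The differential of `f` at `x`, a real-linear map from `T_x M` to `T_{f x} N`. -/
def mapDeriv (f : M → N) (x : M) : E →L[ℝ] F := mfderiv 𝓘(ℝ, E) 𝓘(ℝ, F) f x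

/-- The map `f` written in the charts centred at `x₀` and `f x₀`. -/
def localMap (f : M → N) (x₀ : M) (z : E) : F :=
  chartAt F (f x₀) (f ((chartAt E x₀).symm z))

/-- The second fundamental form `∇df` of `f` at `x`, for the Levi-Civita connections of `g`
and `h`: `∇df(u, v) = D²f(u, v) - Df(Γ(u, v)) + Γ(Df u, Df v)`. -/
def hessian (g : KaehlerMetric E M) (h : KaehlerMetric F N) (f : M → N) (x : M) (u v : E) : F :=
  fderiv ℝ (fderiv ℝ (localMap f x)) (chartAt E x x) u v
    - mapDeriv f x (christoffel (localMetric g.metric x) (chartAt E x x) u v)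
    + christoffel (localMetric h.metric (f x)) (chartAt F (f x) (f x)) (mapDeriv f x u) (mapDeriv f x v)

/-- The tension field `τ(f) = - d_∇^* df = tr_g ∇df`. -/
def tension (g : KaehlerMetric E M) (h : KaehlerMetric F N) (f : M → N) (x : M) : F :=
  ∑ a, ∑ b, (gram (g.metric x))⁻¹ a b •
    hessian g h f x (Module.finBasis ℝ E a) (Module.finBasis ℝ E b)

/-- A smooth map is harmonic if its tension field vanishes. -/
def IsHarmonicMap (g : KaehlerMetric E M) (h : KaehlerMetric F N) (f : M → N) : Prop :=
  ContMDiff 𝓘(ℝ, E) 𝓘(ℝ, F) ∞ f ∧ ∀ x, tension g h f x = 0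

/-- An `E'`-valued form written in the charts centred at `x₀` and `f x₀`. -/
def localSection (f : M → N) (α : M → E [⋀^Fin k]→L[ℝ] F) (x₀ : M) (z : E) :
    E [⋀^Fin k]→L[ℝ] F :=
  (chartDeriv (f x₀) (f ((chartAt E x₀).symm z))).compContinuousAlternatingMap
    ((α ((chartAt E x₀).symm z)).compContinuousLinearMap (chartSymmDeriv x₀ z))

/-- The covariant derivative `u ↦ D_u α + Γ(df u, α)` at `x` of the coefficients of an `E'`-valued
form, in the charts centred at `x` and `f x`, for the pullback of the Levi-Civita connection. -/
def covDeriv (h : KaehlerMetric F N) (f : M → N) (α : M → E [⋀^Fin k]→L[ℝ] F) (x : M) :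
    E →L[ℝ] E [⋀^Fin k]→L[ℝ] F :=
  fderiv ℝ (localSection f α x) (chartAt E x x) +
    endAct (christoffel (localMetric h.metric (f x)) (chartAt F (f x) (f x)) ∘L mapDeriv f x) (α x)

/-- The operator `∂_{E'}`: the part of `d_∇` (the alternation of the covariant derivative) in which
one differentiates in the directions of type (1,0). -/
def delE (h : KaehlerMetric F N) (f : M → N) (α : M → E [⋀^Fin k]→L[ℝ] F) (x : M) :
    E [⋀^Fin (k + 1)]→L[ℝ] F :=
  ContinuousAlternatingMap.alternatizeUncurryFin (holPart (covDeriv h f α x))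

/-- The operator `∂̄_{E'}`: the part of `d_∇` (the alternation of the covariant derivative) in which
one differentiates in the directions of type (0,1). -/
def delbarE (h : KaehlerMetric F N) (f : M → N) (α : M → E [⋀^Fin k]→L[ℝ] F) (x : M) :
    E [⋀^Fin (k + 1)]→L[ℝ] F :=
  ContinuousAlternatingMap.alternatizeUncurryFin (antiPart (covDeriv h f α x))

/-- `∂f`, the part of type (1,0) of the `E'`-valued 1-form `df`. -/
def del (f : M → N) (x : M) : E [⋀^Fin 1]→L[ℝ] F := oneForm (holPart (mapDeriv f x))

/-- `∂̄f`, the part of type (0,1) of the `E'`-valued 1-form `df`. -/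
def delbar (f : M → N) (x : M) : E [⋀^Fin 1]→L[ℝ] F := oneForm (antiPart (mapDeriv f x))

/-- The bracket `{ψ, ξ} = ⟨sⁱ, sʲ⟩ ψ_i ∧ ξ̄_j` of `E'`-valued forms `ψ = ψ_i sⁱ`, `ξ = ξ_j sʲ`. -/
def bracket (h : KaehlerMetric F N) (f : M → N) (ψ : M → E [⋀^Fin p]→L[ℝ] F)
    (ξ : M → E [⋀^Fin q]→L[ℝ] F) (x : M) : E [⋀^Fin (p + q)]→L[ℝ] ℂ :=
  wedge (herm (h.metric (f x))) (ψ x) (ξ x)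

variable {n m : ℕ}

/-- The coefficients `g_{α β̄}` of the metric of `M` at `x` for the basis `b` of the tangent space,
normalised by `ω = (√-1/2) g_{α β̄} dz^α ∧ dz̄^β`. -/
def metricCoeff (b : Module.Basis (Fin n) ℂ E) (B : E →L[ℝ] E →L[ℝ] ℝ) :
    Matrix (Fin n) (Fin n) ℂ :=
  fun α β => 2 * herm B (b α) (b β)

/-- The coefficient `η_{α β̄} = η(∂/∂z^α, ∂/∂z̄^β)` of a form `η = η_{α β̄} dz^α ∧ dz̄^β` of
type (1,1), where `∂/∂z^α = (b_α - √-1 J b_α) / 2` and `η` is extended complex bilinearly. -/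
def formCoeff (b : Module.Basis (Fin n) ℂ E) (η : E [⋀^Fin 2]→L[ℝ] F) (α β : Fin n) : F :=
  (4 : ℝ)⁻¹ • (η ![b α, b β] + η ![Complex.I • b α, Complex.I • b β]
    + Complex.I • (η ![b α, Complex.I • b β] - η ![Complex.I • b α, b β]))

/-- The squared norm `|η|² = g^{α δ̄} g^{γ β̄} ⟨η_{α β̄}, η_{δ γ̄}⟩` at `x` of an `E'`-valued form
`η = η_{α β̄} dz^α ∧ dz̄^β` of type (1,1). It is `∑ ⟨η_{α β̄}, η_{α β̄}⟩` when `g_{α β̄} = δ_{α β}`. -/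
def normSq (g : KaehlerMetric E M) (h : KaehlerMetric F N) (f : M → N)
    (b : Module.Basis (Fin n) ℂ E) (η : M → E [⋀^Fin 2]→L[ℝ] F) (x : M) : ℝ :=
  (∑ α, ∑ β, ∑ γ, ∑ δ, (metricCoeff b (g.metric x))⁻¹ δ α * (metricCoeff b (g.metric x))⁻¹ β γ *
    herm (h.metric (f x)) (formCoeff b (η x) α β) (formCoeff b (η x) δ γ)).re

/-- The component `ψⁱ` of an `E'`-valued form `ψ = ψⁱ ∂/∂wⁱ`. -/
def coordForm (b : Module.Basis (Fin m) ℂ F) (i : Fin m) (ψ : E [⋀^Fin k]→L[ℝ] F) :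
    E [⋀^Fin k]→L[ℝ] ℂ :=
  (LinearMap.toContinuousLinearMap
    ((b.coord i).restrictScalars ℝ)).compContinuousAlternatingMap ψ

/-- The complex conjugate of a complex-valued form. -/
def conjForm (α : E [⋀^Fin k]→L[ℝ] ℂ) : E [⋀^Fin k]→L[ℝ] ℂ :=
  (Complex.conjCLE : ℂ →L[ℝ] ℂ).compContinuousAlternatingMap α

/-- The 4-form `R_{i j̄ k l̄} ∂̄fⁱ ∧ ∂f̄ʲ ∧ ∂fᵏ ∧ ∂̄f̄ˡ` on `M`, in the holomorphic coordinates `w` of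
`N` given by the chart centred at `f x` and the basis `b`. Here `∂f̄ʲ` and `∂̄f̄ˡ` are the conjugates
of `∂̄fʲ` and `∂fˡ`. -/
def curvatureForm (h : KaehlerMetric F N) (f : M → N) (b : Module.Basis (Fin m) ℂ F) (x : M) :
    E [⋀^Fin (1 + 1 + 1 + 1)]→L[ℝ] ℂ :=
  ∑ i, ∑ j, ∑ k, ∑ l,
    curvCoeff b (localMetric h.metric (f x)) (chartAt F (f x) (f x)) i j k l •
      cwedge (cwedge (cwedge (coordForm b i (delbar f x)) (conjForm (coordForm b j (delbar f x))))
        (coordForm b k (del f x))) (conjForm (coordForm b l (del f x)))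

theorem degree_eq (hn : 2 ≤ n) : 2 * n = 1 + 1 + 1 + 1 + 2 * (n - 2) := by omega

theorem degree_eq' (hn : 2 ≤ n) : 2 * n = 1 + 1 + 1 + 2 * (n - 2) + 1 := by omega

/-- `Q : M → ℝ` is the function with
`Q ωⁿ/n! = - R_{i j̄ k l̄} ∂̄fⁱ ∧ ∂f̄ʲ ∧ ∂fᵏ ∧ ∂̄f̄ˡ ∧ ωⁿ⁻²/(n-2)!`. -/
def IsCurvatureTerm (g : KaehlerMetric E M) (h : KaehlerMetric F N) (f : M → N)
    (b : Module.Basis (Fin m) ℂ F) (hn : 2 ≤ n) (Q : M → ℝ) : Prop :=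
  ∀ x, castDeg (degree_eq hn) (Q x • dividedPow (g.form x) n) =
    - cwedge (curvatureForm h f b x) (dividedPow (g.form x) (n - 2))

end Maps

end KaehlerBochner

end

open KaehlerBochner

/-! Write σ = ∂̄_{E'}∂f, ξ = ∂̄f - ∂f and d_∇ for the covariant exterior derivative on E'-valued
forms.

Second derivatives and Christoffel symbols are symmetric, so ∂_{E'}∂f = 0 and d_∇ df = 0. Hence σ =
d_∇∂f, and ξ = df - 2∂f satisfies d_∇ξ = -2σ. As the Hermitian metric is parallel, d{σ, ξ} =
{d_∇²∂f, ξ} - 2{σ, σ} (`extDeriv_bracket`).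

The curvature term: d_∇²∂f = R ∧ ∂f (`localCurl_cyclic`), and the first Bianchi identity R ∧ df = 0
allows R ∧ ∂f to be replaced by -R ∧ ∂̄f in the pairing with ∂f. The Kähler symmetries of R (in its
two unbarred and in its two barred arguments) then turn {R ∧ ∂f, ξ}, on vectors u, √-1 u, v, √-1 v,
into -2 times the curvature 4-form (`sum_herm_curvEnd`).

The norm term: for a unitary basis e, the value of α ∧ ωⁿ⁻²/(n-2)! on e₀, √-1 e₀, e₁, … is half the
sum over a, b of α(e_a, √-1 e_a, e_b, √-1 e_b), while ωⁿ/n! has value 1 (`cwedge_dividedPow_pairs`).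
Let A(u, v) (`mixedHess`) be the derivative of ∂f(v) along the (0,1)-part of u; it is conjugate
linear in u, complex linear in v, and σ(u, v) = A(u, v) - A(v, u). Then -2{σ, σ} contributes 8 ∑
|A(e_a, e_b)|² - 8 |∑ A(e_a, e_a)|². Since M is Kähler, 4 ∑ A(e_a, e_a) is the tension field
(`trace_hessian`), so harmonicity kills the second sum. The first is |∂_{E'}∂̄f|², because ∂_{E'}∂̄f
= -σ.

The second identity of the theorem follows from the first by the Leibniz rule and dω = 0.

The operators at a point are defined in the charts centred at that point, whereas differentiating
the bracket at x needs it in one chart near x. The passage is `localSection_delbarE_del`, which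
rests on the naturality of `localCurl` (d_∇∂f in coordinates) under holomorphic changes of
coordinates. -/

namespace KaehlerBochner

/-! ### Alternating sums over permutations. -/

section AltSum

variable {V G : Type*} [AddCommGroup G] {k p q r : ℕ}

/-- The alternating sum of a function of `k` vectors over all permutations of its arguments. -/
def altSum (T : (Fin k → V) → G) (v : Fin k → V) : G :=
  ∑ σ : Equiv.Perm (Fin k), Equiv.Perm.sign σ • T (v ∘ σ)

theorem altSum_comp_perm (T : (Fin k → V) → G) (π : Equiv.Perm (Fin k)) (v : Fin k → V) :
    altSum (fun w => T (w ∘ π)) v = Equiv.Perm.sign π • altSum T v := by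
  rw [altSum, altSum, Finset.smul_sum]
  refine Fintype.sum_equiv (Equiv.mulRight π) _ _ fun σ => ?_
  simp only [Equiv.coe_mulRight, smul_smul, Equiv.Perm.sign_mul]
  rw [mul_comm (Equiv.Perm.sign σ), ← mul_assoc, Int.units_mul_self, one_mul]
  rfl

/-- The permutation of the first `p` of `p + q` indices. -/
def permLeft (q : ℕ) (τ : Equiv.Perm (Fin p)) : Equiv.Perm (Fin (p + q)) :=
  finSumFinEquiv.permCongr (Equiv.Perm.sumCongr τ 1)

/-- The permutation of the last `q` of `p + q` indices. -/
def permRight (p : ℕ) (τ : Equiv.Perm (Fin q)) : Equiv.Perm (Fin (p + q)) :=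
  finSumFinEquiv.permCongr (Equiv.Perm.sumCongr 1 τ)

theorem sign_permLeft (τ : Equiv.Perm (Fin p)) :
    Equiv.Perm.sign (permLeft q τ) = Equiv.Perm.sign τ := by
  simp [permLeft, Equiv.Perm.sign_permCongr, Equiv.Perm.sign_sumCongr]

theorem sign_permRight (τ : Equiv.Perm (Fin q)) :
    Equiv.Perm.sign (permRight p τ) = Equiv.Perm.sign τ := by
  simp [permRight, Equiv.Perm.sign_permCongr, Equiv.Perm.sign_sumCongr]

theorem permLeft_castAdd (τ : Equiv.Perm (Fin p)) (i : Fin p) :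
    permLeft q τ (Fin.castAdd q i) = Fin.castAdd q (τ i) := by
  simp [permLeft, Equiv.permCongr_apply]

theorem permLeft_natAdd (τ : Equiv.Perm (Fin p)) (i : Fin q) :
    permLeft q τ (Fin.natAdd p i) = Fin.natAdd p i := by
  simp [permLeft, Equiv.permCongr_apply]

theorem permRight_castAdd (τ : Equiv.Perm (Fin q)) (i : Fin p) :
    permRight p τ (Fin.castAdd q i) = Fin.castAdd q i := by
  simp [permRight, Equiv.permCongr_apply]

theorem permRight_natAdd (τ : Equiv.Perm (Fin q)) (i : Fin q) :
    permRight p τ (Fin.natAdd p i) = Fin.natAdd p (τ i) := by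
  simp [permRight, Equiv.permCongr_apply]

theorem altSum_sum {ι : Type*} (s : Finset ι) (T : ι → (Fin k → V) → G) (v : Fin k → V) :
    altSum (fun w => ∑ i ∈ s, T i w) v = ∑ i ∈ s, altSum (T i) v := by
  simp only [altSum, Finset.smul_sum]
  exact Finset.sum_comm

theorem altSum_units_smul (c : ℤˣ) (T : (Fin k → V) → G) (v : Fin k → V) :
    altSum (fun w => c • T w) v = c • altSum T v := by
  simp only [altSum, Finset.smul_sum]
  exact Finset.sum_congr rfl fun σ _ => smul_comm _ _ _

/-- A permutation of the first block extends by `permLeft` to all the indices with the same sign, so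
every term of the inner sum reproduces the outer one. This and `altSum_altSum_right` flatten nested
wedge products. -/
theorem altSum_altSum_left (S : (Fin p → V) → (Fin q → V) → G) (v : Fin (p + q) → V) :
    altSum (fun w => altSum (fun u => S u (w ∘ Fin.natAdd p)) (w ∘ Fin.castAdd q)) v =
      p ! • altSum (fun w => S (w ∘ Fin.castAdd q) (w ∘ Fin.natAdd p)) v := by
  change altSum (fun w => ∑ τ : Equiv.Perm (Fin p), Equiv.Perm.sign τ •
    S ((w ∘ Fin.castAdd q) ∘ τ) (w ∘ Fin.natAdd p)) v = _
  rw [altSum_sum]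
  have h : ∀ τ : Equiv.Perm (Fin p), altSum (fun w : Fin (p + q) → V => Equiv.Perm.sign τ •
      S ((w ∘ Fin.castAdd q) ∘ τ) (w ∘ Fin.natAdd p)) v =
      altSum (fun w => S (w ∘ Fin.castAdd q) (w ∘ Fin.natAdd p)) v := fun τ => by
    rw [altSum_units_smul]
    have := altSum_comp_perm (fun w => S (w ∘ Fin.castAdd q) (w ∘ Fin.natAdd p)) (permLeft q τ) v
    rw [sign_permLeft] at this
    have e : (fun w : Fin (p + q) → V => S ((w ∘ Fin.castAdd q) ∘ τ) (w ∘ Fin.natAdd p)) =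
        fun w => S ((w ∘ permLeft q τ) ∘ Fin.castAdd q) ((w ∘ permLeft q τ) ∘ Fin.natAdd p) := by
      funext w
      congr 1 <;> funext i <;> simp [permLeft_castAdd, permLeft_natAdd]
    rw [e, this, smul_smul, Int.units_mul_self, one_smul]
  rw [Finset.sum_congr rfl fun τ _ => h τ]
  simp [Fintype.card_perm]

theorem altSum_altSum_right (S : (Fin p → V) → (Fin q → V) → G) (v : Fin (p + q) → V) :
    altSum (fun w => altSum (fun u => S (w ∘ Fin.castAdd q) u) (w ∘ Fin.natAdd p)) v =
      q ! • altSum (fun w => S (w ∘ Fin.castAdd q) (w ∘ Fin.natAdd p)) v := by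
  change altSum (fun w => ∑ τ : Equiv.Perm (Fin q), Equiv.Perm.sign τ •
    S (w ∘ Fin.castAdd q) ((w ∘ Fin.natAdd p) ∘ τ)) v = _
  rw [altSum_sum]
  have h : ∀ τ : Equiv.Perm (Fin q), altSum (fun w : Fin (p + q) → V => Equiv.Perm.sign τ •
      S (w ∘ Fin.castAdd q) ((w ∘ Fin.natAdd p) ∘ τ)) v =
      altSum (fun w => S (w ∘ Fin.castAdd q) (w ∘ Fin.natAdd p)) v := fun τ => by
    rw [altSum_units_smul]
    have := altSum_comp_perm (fun w => S (w ∘ Fin.castAdd q) (w ∘ Fin.natAdd p)) (permRight p τ) v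
    rw [sign_permRight] at this
    have e : (fun w : Fin (p + q) → V => S (w ∘ Fin.castAdd q) ((w ∘ Fin.natAdd p) ∘ τ)) =
        fun w => S ((w ∘ permRight p τ) ∘ Fin.castAdd q) ((w ∘ permRight p τ) ∘ Fin.natAdd p) := by
      funext w
      congr 1 <;> funext i <;> simp [permRight_castAdd, permRight_natAdd]
    rw [e, this, smul_smul, Int.units_mul_self, one_smul]
  rw [Finset.sum_congr rfl fun τ _ => h τ]
  simp [Fintype.card_perm]

/-- Every permutation of `Fin (k + 1)` is a permutation of the indices other than the first,
followed by a cycle. -/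
theorem sum_perm_succ (f : Equiv.Perm (Fin (k + 1)) → G) :
    ∑ σ, f σ = ∑ i : Fin (k + 1), ∑ τ : Equiv.Perm (Fin k),
      f (i.cycleRange.symm * Equiv.Perm.decomposeFin.symm (0, τ)) := by
  rw [← Fintype.sum_prod_type' (f := fun (i : Fin (k + 1)) (τ : Equiv.Perm (Fin k)) =>
    f (i.cycleRange.symm * Equiv.Perm.decomposeFin.symm (0, τ)))]
  symm
  refine Function.Bijective.sum_comp (e := fun x : Fin (k + 1) × Equiv.Perm (Fin k) =>
    (x.1.cycleRange.symm * Equiv.Perm.decomposeFin.symm (0, x.2))) ?_ f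
  rw [Fintype.bijective_iff_injective_and_card]
  constructor
  · rintro ⟨i, τ⟩ ⟨j, ρ⟩ h
    -- `decomposeFin.symm (0, τ)` fixes `0`, so the product sends `0` to `i`: the cycle is recovered
    -- from the value at `0`. Counting then gives bijectivity.
    have h0 := congrArg (fun σ : Equiv.Perm (Fin (k + 1)) => σ 0) h
    simp only [Equiv.Perm.mul_apply, Equiv.Perm.decomposeFin_symm_apply_zero,
      Fin.cycleRange_symm_zero] at h0
    subst h0
    have h1 := Equiv.Perm.decomposeFin.symm.injective (mul_left_cancel h)
    simpa using h1
  · simp [Fintype.card_perm, Nat.factorial_succ]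

/-- Laplace expansion along the first argument: the cycle bringing `v i` to the front has sign `(-1)
^ i`. -/
theorem altSum_succ (S : V → (Fin k → V) → G) (v : Fin (k + 1) → V) :
    altSum (fun w : Fin (k + 1) → V => S (w 0) (w ∘ Fin.succ)) v =
      ∑ i : Fin (k + 1), (-1 : ℤ) ^ (i : ℕ) • altSum (S (v i)) (v ∘ i.succAbove) := by
  rw [altSum, sum_perm_succ]
  refine Finset.sum_congr rfl fun i _ => ?_
  rw [altSum, Finset.smul_sum]
  refine Finset.sum_congr rfl fun τ _ => ?_
  have h1 : Equiv.Perm.sign (i.cycleRange.symm * Equiv.Perm.decomposeFin.symm (0, τ)) =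
      (-1) ^ (i : ℕ) * Equiv.Perm.sign τ := by
    simp [Equiv.Perm.sign_mul]
  have h2 : (v ∘ (i.cycleRange.symm * Equiv.Perm.decomposeFin.symm (0, τ) :
      Equiv.Perm (Fin (k + 1)))) ∘ Fin.succ = (v ∘ i.succAbove) ∘ τ := by
    funext j
    simp [Equiv.Perm.decomposeFin_symm_apply_succ]
  rw [h1, h2, mul_smul]
  simp [Units.smul_def]

end AltSum

/-! ### Associativity and Leibniz rule for the wedge product. -/

section Wedge

set_option linter.unusedSectionVars false

variable {V G₁ G₂ G₃ : Type*}
  [NormedAddCommGroup V] [NormedSpace ℝ V] [NormedAddCommGroup G₁] [NormedSpace ℝ G₁]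
  [NormedAddCommGroup G₂] [NormedSpace ℝ G₂] [NormedAddCommGroup G₃] [NormedSpace ℝ G₃]
  {p q r k : ℕ}

theorem altSum_alternating (α : V [⋀^Fin k]→L[ℝ] G₁) (v : Fin k → V) :
    altSum (⇑α) v = k ! • α v := by
  have h : ∀ σ : Equiv.Perm (Fin k), Equiv.Perm.sign σ • α (v ∘ σ) = α v := fun σ => by
    have := α.toAlternatingMap.map_perm v σ
    simp only [ContinuousAlternatingMap.coe_toAlternatingMap] at this
    rw [this, smul_smul, Int.units_mul_self, one_smul]
  rw [altSum, Finset.sum_congr rfl fun σ _ => h σ]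
  simp [Fintype.card_perm]

theorem wedge_apply' (B : G₁ →L[ℝ] G₂ →L[ℝ] G₃) (α : V [⋀^Fin p]→L[ℝ] G₁)
    (β : V [⋀^Fin q]→L[ℝ] G₂) (v : Fin (p + q) → V) :
    wedge B α β v = ((p ! : ℝ) * (q ! : ℝ))⁻¹ •
      altSum (fun w => B (α (w ∘ Fin.castAdd q)) (β (w ∘ Fin.natAdd p))) v :=
  wedge_apply B α β v

theorem altSum_const_smul {G : Type*} [AddCommGroup G] [Module ℝ G] (c : ℝ)
    (T : (Fin k → V) → G) (v : Fin k → V) :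
    altSum (fun w => c • T w) v = c • altSum T v := by
  simp only [altSum, Finset.smul_sum]
  exact Finset.sum_congr rfl fun σ _ => smul_comm _ _ _

theorem map_altSum {G H : Type*} [AddCommGroup G] [AddCommGroup H] (L : G →+ H)
    (T : (Fin k → V) → G) (v : Fin k → V) :
    L (altSum T v) = altSum (fun w => L (T w)) v := by
  simp only [altSum, map_sum]
  refine Finset.sum_congr rfl fun σ _ => ?_
  rw [Units.smul_def, Units.smul_def, map_zsmul]

theorem cwedge_apply' (α : V [⋀^Fin p]→L[ℝ] ℂ) (β : V [⋀^Fin q]→L[ℝ] ℂ) (v : Fin (p + q) → V) :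
    cwedge α β v = ((p ! : ℝ) * (q ! : ℝ))⁻¹ •
      altSum (fun w => α (w ∘ Fin.castAdd q) * β (w ∘ Fin.natAdd p)) v :=
  wedge_apply _ α β v

/-- The wedge product of three forms, bracketed to the left, as an alternating sum. -/
theorem cwedge_cwedge_left (α : V [⋀^Fin p]→L[ℝ] ℂ) (β : V [⋀^Fin q]→L[ℝ] ℂ)
    (γ : V [⋀^Fin r]→L[ℝ] ℂ) (v : Fin (p + q + r) → V) :
    cwedge (cwedge α β) γ v = ((p ! : ℝ) * (q ! : ℝ) * (r ! : ℝ))⁻¹ •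
      altSum (fun w => α ((w ∘ Fin.castAdd r) ∘ Fin.castAdd q) *
        β ((w ∘ Fin.castAdd r) ∘ Fin.natAdd p) * γ (w ∘ Fin.natAdd (p + q))) v := by
  have h := altSum_altSum_left (fun (u : Fin (p + q) → V) (t : Fin r → V) =>
    α (u ∘ Fin.castAdd q) * β (u ∘ Fin.natAdd p) * γ t) v
  have h' : ∀ w : Fin (p + q + r) → V,
      cwedge α β (w ∘ Fin.castAdd r) * γ (w ∘ Fin.natAdd (p + q)) =
      ((p ! : ℝ) * (q ! : ℝ))⁻¹ • altSum (fun u : Fin (p + q) → V =>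
        α (u ∘ Fin.castAdd q) * β (u ∘ Fin.natAdd p) * γ (w ∘ Fin.natAdd (p + q)))
          (w ∘ Fin.castAdd r) := fun w => by
    rw [cwedge_apply', smul_mul_assoc]
    congr 1
    exact map_altSum (AddMonoidHom.mulRight (γ (w ∘ Fin.natAdd (p + q)))) _ _
  rw [cwedge_apply', funext h', altSum_const_smul, h, ← Nat.cast_smul_eq_nsmul ℝ, smul_smul,
    smul_smul]
  congr 1
  have : ((p + q)! : ℝ) ≠ 0 := by positivity
  field_simp

/-- The wedge product of three forms, bracketed to the right, as an alternating sum. -/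
theorem cwedge_cwedge_right (α : V [⋀^Fin p]→L[ℝ] ℂ) (β : V [⋀^Fin q]→L[ℝ] ℂ)
    (γ : V [⋀^Fin r]→L[ℝ] ℂ) (v : Fin (p + (q + r)) → V) :
    cwedge α (cwedge β γ) v = ((p ! : ℝ) * (q ! : ℝ) * (r ! : ℝ))⁻¹ •
      altSum (fun w => α (w ∘ Fin.castAdd (q + r)) *
        (β ((w ∘ Fin.natAdd p) ∘ Fin.castAdd r) * γ ((w ∘ Fin.natAdd p) ∘ Fin.natAdd q))) v := by
  have h := altSum_altSum_right (fun (t : Fin p → V) (u : Fin (q + r) → V) =>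
    α t * (β (u ∘ Fin.castAdd r) * γ (u ∘ Fin.natAdd q))) v
  have h' : ∀ w : Fin (p + (q + r)) → V,
      α (w ∘ Fin.castAdd (q + r)) * cwedge β γ (w ∘ Fin.natAdd p) =
      ((q ! : ℝ) * (r ! : ℝ))⁻¹ • altSum (fun u : Fin (q + r) → V =>
        α (w ∘ Fin.castAdd (q + r)) * (β (u ∘ Fin.castAdd r) * γ (u ∘ Fin.natAdd q)))
          (w ∘ Fin.natAdd p) := fun w => by
    rw [cwedge_apply', mul_smul_comm]
    congr 1
    exact map_altSum (AddMonoidHom.mulLeft (α (w ∘ Fin.castAdd (q + r)))) _ _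
  rw [cwedge_apply', funext h', altSum_const_smul, h, ← Nat.cast_smul_eq_nsmul ℝ, smul_smul,
    smul_smul]
  congr 1
  have : ((q + r)! : ℝ) ≠ 0 := by positivity
  field_simp

theorem altSum_altSum {G : Type*} [AddCommGroup G] (T : (Fin k → V) → G) (v : Fin k → V) :
    altSum (altSum T) v = k ! • altSum T v := by
  have h := altSum_sum Finset.univ (fun (τ : Equiv.Perm (Fin k)) (w : Fin k → V) =>
    Equiv.Perm.sign τ • T (w ∘ τ)) v
  refine h.trans ?_
  have h' : ∀ τ : Equiv.Perm (Fin k), altSum (fun w : Fin k → V =>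
      Equiv.Perm.sign τ • T (w ∘ τ)) v = altSum T v := fun τ => by
    rw [altSum_units_smul, altSum_comp_perm, smul_smul, Int.units_mul_self, one_smul]
  rw [Finset.sum_congr rfl fun τ _ => h' τ]
  simp [Fintype.card_perm]

theorem altSum_succ_altSum {G : Type*} [AddCommGroup G] (S : V → (Fin k → V) → G)
    (v : Fin (k + 1) → V) :
    altSum (fun w : Fin (k + 1) → V => altSum (S (w 0)) (w ∘ Fin.succ)) v =
      k ! • altSum (fun w : Fin (k + 1) → V => S (w 0) (w ∘ Fin.succ)) v := by
  rw [altSum_succ (fun u s => altSum (S u) s), altSum_succ, Finset.smul_sum]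
  refine Finset.sum_congr rfl fun i _ => ?_
  rw [smul_comm]
  congr 1
  exact altSum_altSum _ _

theorem altSum_cast (h : p = q) (T : (Fin q → V) → G₁) (v : Fin p → V) :
    altSum T (v ∘ Fin.cast h.symm) = altSum (fun w => T (w ∘ Fin.cast h.symm)) v := by
  subst h
  rfl

/-- The wedge product is associative. -/
theorem cwedge_assoc (α : V [⋀^Fin p]→L[ℝ] ℂ) (β : V [⋀^Fin q]→L[ℝ] ℂ)
    (γ : V [⋀^Fin r]→L[ℝ] ℂ) :
    castDeg (add_assoc p q r) (cwedge (cwedge α β) γ) = cwedge α (cwedge β γ) := by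
  ext v
  rw [castDeg_apply, cwedge_cwedge_left, cwedge_cwedge_right,
    altSum_cast (add_assoc p q r).symm]
  congr 2
  funext w
  rw [mul_assoc]
  refine congrArg₂ _ rfl (congrArg₂ _ rfl (congrArg γ ?_))
  funext i
  exact congrArg w (Fin.ext (add_assoc p q i))

/-- Since `L (w 0)` is already alternating, the full alternating sum counts each term of the
exterior derivative `k !` times. In this form exterior derivatives and wedge products are both
alternating sums and can be compared. -/
theorem alternatizeUncurryFin_eq_altSum (L : V →L[ℝ] V [⋀^Fin k]→L[ℝ] G₁) (v : Fin (k + 1) → V) :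
    ContinuousAlternatingMap.alternatizeUncurryFin L v =
      ((k ! : ℝ))⁻¹ • altSum (fun w : Fin (k + 1) → V => L (w 0) (w ∘ Fin.succ)) v := by
  have h := altSum_succ (fun u t => L u t) v
  rw [h, ContinuousAlternatingMap.alternatizeUncurryFin_apply, Finset.smul_sum]
  refine Finset.sum_congr rfl fun i _ => ?_
  rw [altSum_alternating, ← Nat.cast_smul_eq_nsmul ℝ, smul_comm (_ : ℝ)⁻¹, smul_smul,
    inv_mul_cancel₀ (by positivity), one_smul]
  rfl

theorem add_one_add (p q : ℕ) : p + 1 + q = p + q + 1 := by omega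

/-- The part of the Leibniz rule in which the left factor is differentiated. -/
theorem alternatizeUncurryFin_cwedge_left (L : V →L[ℝ] V [⋀^Fin p]→L[ℝ] ℂ)
    (β : V [⋀^Fin q]→L[ℝ] ℂ) (M : V →L[ℝ] V [⋀^Fin (p + q)]→L[ℝ] ℂ)
    (hM : ∀ u, M u = cwedge (L u) β) :
    ContinuousAlternatingMap.alternatizeUncurryFin M = castDeg (add_one_add p q)
      (cwedge (ContinuousAlternatingMap.alternatizeUncurryFin L) β) := by
  ext v
  rw [castDeg_apply, alternatizeUncurryFin_eq_altSum, cwedge_apply']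
  -- The alternation inside the derivative of the left factor costs `(p + 1)!` here, and the one
  -- inside the wedge product costs `(p + q)!` in `h4`; the normalising factors absorb both.
  have h1 := altSum_altSum_left (fun (t : Fin (p + 1) → V) (u : Fin q → V) =>
    L (t 0) (t ∘ Fin.succ) * β u) (v ∘ Fin.cast (add_one_add p q))
  have h2 : ∀ w : Fin (p + 1 + q) → V,
      ContinuousAlternatingMap.alternatizeUncurryFin L (w ∘ Fin.castAdd q) *
        β (w ∘ Fin.natAdd (p + 1)) =
      ((p ! : ℝ))⁻¹ • altSum (fun t : Fin (p + 1) → V => L (t 0) (t ∘ Fin.succ) *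
        β (w ∘ Fin.natAdd (p + 1))) (w ∘ Fin.castAdd q) := fun w => by
    rw [alternatizeUncurryFin_eq_altSum, smul_mul_assoc]
    congr 1
    exact map_altSum (AddMonoidHom.mulRight (β (w ∘ Fin.natAdd (p + 1)))) _ _
  have h3 : ∀ w : Fin (p + q + 1) → V, M (w 0) (w ∘ Fin.succ) =
      ((p ! : ℝ) * (q ! : ℝ))⁻¹ • altSum (fun t => L (w 0) (t ∘ Fin.castAdd q) *
        β (t ∘ Fin.natAdd p)) (w ∘ Fin.succ) := fun w => by
    rw [hM, cwedge_apply']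
  have h4 := altSum_succ_altSum (fun (u : V) (t : Fin (p + q) → V) =>
    L u (t ∘ Fin.castAdd q) * β (t ∘ Fin.natAdd p)) v
  rw [funext h2, funext h3, altSum_const_smul, altSum_const_smul, h1, h4,
    altSum_cast (add_one_add p q).symm, ← Nat.cast_smul_eq_nsmul ℝ, ← Nat.cast_smul_eq_nsmul ℝ,
    smul_smul, smul_smul, smul_smul, smul_smul]
  congr 1
  · have : ((p + q)! : ℝ) ≠ 0 := by positivity
    have : ((p + 1)! : ℝ) ≠ 0 := by positivity
    field_simp
  · congr 1
    funext w
    refine congrArg₂ _ ?_ (congrArg β ?_)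
    · congr 1
    · funext i
      refine congrArg w (Fin.ext ?_)
      simp only [Fin.val_cast, Fin.val_natAdd, Fin.val_succ]
      omega

/-- The part of the Leibniz rule in which the right factor is differentiated vanishes if the
derivative of the right factor does. -/
theorem alternatizeUncurryFin_cwedge_right (L : V →L[ℝ] V [⋀^Fin q]→L[ℝ] ℂ)
    (α : V [⋀^Fin p]→L[ℝ] ℂ) (M : V →L[ℝ] V [⋀^Fin (p + q)]→L[ℝ] ℂ)
    (hM : ∀ u, M u = cwedge α (L u))
    (hL : ContinuousAlternatingMap.alternatizeUncurryFin L = 0) :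
    ContinuousAlternatingMap.alternatizeUncurryFin M = 0 := by
  ext v
  have h3 : ∀ w : Fin (p + q + 1) → V, M (w 0) (w ∘ Fin.succ) =
      ((p ! : ℝ) * (q ! : ℝ))⁻¹ • altSum (fun t => α (t ∘ Fin.castAdd q) *
        L (w 0) (t ∘ Fin.natAdd p)) (w ∘ Fin.succ) := fun w => by
    rw [hM, cwedge_apply']
  have h4 := altSum_succ_altSum (fun (u : V) (t : Fin (p + q) → V) =>
    α (t ∘ Fin.castAdd q) * L u (t ∘ Fin.natAdd p)) v
  have h5 := altSum_altSum_right (p := p) (q := q + 1) (fun t (u : Fin (q + 1) → V) =>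
    α t * L (u 0) (u ∘ Fin.succ)) v
  -- The hypothesis on `L` enters here: alternating over the last `q + 1` arguments alone already
  -- gives zero.
  have h6 : ∀ (c : ℂ) (u : Fin (q + 1) → V),
      altSum (fun t : Fin (q + 1) → V => c * L (t 0) (t ∘ Fin.succ)) u = 0 := fun c u => by
    have h := alternatizeUncurryFin_eq_altSum L u
    rw [hL, show (0 : V [⋀^Fin (q + 1)]→L[ℝ] ℂ) u = 0 from rfl, eq_comm, smul_eq_zero] at h
    have h' := h.resolve_left (by positivity)
    have := map_altSum (AddMonoidHom.mulLeft c) (fun t : Fin (q + 1) → V => L (t 0) (t ∘ Fin.succ)) u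
    rw [h', map_zero] at this
    exact this.symm
  simp only [h6] at h5
  have h7 : altSum (fun w : Fin (p + (q + 1)) → V => α (w ∘ Fin.castAdd (q + 1)) *
      L ((w ∘ Fin.natAdd p) 0) ((w ∘ Fin.natAdd p) ∘ Fin.succ)) v = 0 := by
    have h8 : (0 : ℂ) = altSum (fun _ : Fin (p + (q + 1)) → V => (0 : ℂ)) v := by simp [altSum]
    rw [← h8, eq_comm, ← Nat.cast_smul_eq_nsmul ℝ, smul_eq_zero] at h5
    exact h5.resolve_left (by positivity)
  -- The cycle ending at position `p` reconciles two orders of the arguments: the differentiating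
  -- vector in front, or just behind the `p` arguments of `α`. Its sign is immaterial because the
  -- sum vanishes.
  let i₀ : Fin (p + q + 1) := ⟨p, by omega⟩
  let T : (Fin (p + q + 1) → V) → ℂ := fun w : Fin (p + (q + 1)) → V =>
    α (w ∘ Fin.castAdd (q + 1)) * L ((w ∘ Fin.natAdd p) 0) ((w ∘ Fin.natAdd p) ∘ Fin.succ)
  have h9 : (fun w : Fin (p + q + 1) → V => α ((w ∘ Fin.succ) ∘ Fin.castAdd q) *
      L (w 0) ((w ∘ Fin.succ) ∘ Fin.natAdd p)) = fun w => T (w ∘ i₀.cycleRange) := by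
    funext w
    have e1 : i₀.cycleRange (Fin.natAdd p (0 : Fin (q + 1))) = 0 := by
      have : (Fin.natAdd p (0 : Fin (q + 1))) = i₀ := Fin.ext (by simp [i₀])
      rw [this, Fin.cycleRange_self]
    refine congrArg₂ _ (congrArg α ?_) ?_
    · funext j
      refine congrArg w ?_
      rw [Fin.cycleRange_of_lt (by rw [Fin.lt_def]; exact j.2)]
      refine Fin.ext ?_
      rw [Fin.val_add_one_of_lt (Fin.lt_def.2 (show (j : ℕ) < p + q by omega))]
      rfl
    · have e2 : ((w ∘ Fin.succ) ∘ Fin.natAdd p : Fin q → V) =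
          ((w ∘ i₀.cycleRange) ∘ Fin.natAdd p) ∘ Fin.succ := by
        funext j
        refine congrArg w ?_
        rw [Fin.cycleRange_of_gt (by
          rw [Fin.lt_def]; simp only [i₀, Fin.val_natAdd, Fin.val_succ]; omega)]
        rfl
      rw [← e2]
      refine congrArg (fun u => L (w u) _) ?_
      exact e1.symm
  rw [alternatizeUncurryFin_eq_altSum, funext h3, altSum_const_smul, h4, h9,
    altSum_comp_perm T i₀.cycleRange v, show altSum T v = 0 from h7, smul_zero,
    smul_zero, smul_zero, smul_zero]
  rfl

end Wedge

/-! ### Wedge products with powers of a 2-form, evaluated on a unitary frame. -/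

section Frame

variable {V : Type*} [NormedAddCommGroup V] [NormedSpace ℂ V] {p q k : ℕ}

theorem half_lt (i : Fin (2 * k)) : (i : ℕ) / 2 < k := by omega

/-- The list `e₀, √-1 e₀, e₁, √-1 e₁, …`. -/
def pairs (e : Fin k → V) (i : Fin (2 * k)) : V :=
  if (i : ℕ) % 2 = 0 then e ⟨i / 2, half_lt i⟩ else Complex.I • e ⟨i / 2, half_lt i⟩

theorem pairs_congr {k' : ℕ} (e : Fin k → V) (e' : Fin k' → V) (i : Fin (2 * k)) (i' : Fin (2 * k'))
    (hi : (i : ℕ) % 2 = i' % 2) (he : e ⟨i / 2, half_lt i⟩ = e' ⟨i' / 2, half_lt i'⟩) :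
    pairs e i = pairs e' i' := by
  rw [pairs, pairs, hi, he]

/-- The list `e` is unitary for the 2-form `η`. -/
structure IsUnitaryFrame (η : V [⋀^Fin 2]→L[ℝ] ℂ) (e : Fin k → V) : Prop where
  left : ∀ s t, η ![e s, e t] = 0
  mixed : ∀ s t, η ![e s, Complex.I • e t] = if s = t then 1 else 0
  mixed' : ∀ s t, η ![Complex.I • e s, e t] = if s = t then -1 else 0
  right : ∀ s t, η ![Complex.I • e s, Complex.I • e t] = 0

theorem IsUnitaryFrame.comp {η : V [⋀^Fin 2]→L[ℝ] ℂ} {e : Fin k → V} (h : IsUnitaryFrame η e)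
    {j : ℕ} (ι : Fin j → Fin k) (hι : Function.Injective ι) : IsUnitaryFrame η (e ∘ ι) where
  left s t := h.left _ _
  mixed s t := by simp [h.mixed, hι.eq_iff]
  mixed' s t := by simp [h.mixed', hι.eq_iff]
  right s t := h.right _ _

theorem IsUnitaryFrame.apply_pairs_of_ne {η : V [⋀^Fin 2]→L[ℝ] ℂ} {e : Fin k → V}
    (h : IsUnitaryFrame η e) (i j : Fin (2 * k)) (hij : (i : ℕ) / 2 ≠ j / 2) :
    η ![pairs e i, pairs e j] = 0 := by
  have hne : (⟨i / 2, half_lt i⟩ : Fin k) ≠ ⟨j / 2, half_lt j⟩ := fun h => hij (Fin.ext_iff.1 h)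
  unfold pairs
  split_ifs <;> simp [h.left, h.right, h.mixed, h.mixed', hne]

theorem rotate_zero (m : ℕ) : (finRotate (m + 1))⁻¹ 0 = Fin.last m := by
  rw [Equiv.Perm.inv_eq_iff_eq, finRotate_last]

theorem rotate_succ (m : ℕ) (i : Fin m) : (finRotate (m + 1))⁻¹ i.succ = i.castSucc := by
  rw [Equiv.Perm.inv_eq_iff_eq, finRotate_apply, Fin.coeSucc_eq_succ]

/-- The wedge product with a 2-form, expanded along the arguments of the 2-form. -/
theorem cwedge_two_apply (β : V [⋀^Fin p]→L[ℝ] ℂ) (η : V [⋀^Fin 2]→L[ℝ] ℂ) (v : Fin (p + 2) → V) :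
    cwedge β η v = (2 : ℝ)⁻¹ • ∑ i : Fin (p + 2), (-1 : ℤ) ^ (i : ℕ) • ∑ j : Fin (p + 1),
      (-1 : ℤ) ^ (j : ℕ) • (η ![v i, v (i.succAbove j)] *
        β ((v ∘ i.succAbove) ∘ j.succAbove)) := by
  let T : (Fin (p + 2) → V) → ℂ := fun w =>
    η ![w 0, (w ∘ Fin.succ) 0] * β ((w ∘ Fin.succ) ∘ Fin.succ)
  -- Two rotations bring the two arguments of `η` to the front. A square is even, so no sign
  -- appears.
  let π : Equiv.Perm (Fin (p + 2)) := (finRotate (p + 2))⁻¹ * (finRotate (p + 2))⁻¹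
  have hπ : Equiv.Perm.sign π = 1 := by
    rw [Equiv.Perm.sign_mul, Int.units_mul_self]
  have h1 : (fun w : Fin (p + 2) → V => β (w ∘ Fin.castAdd 2) * η (w ∘ Fin.natAdd p)) =
      fun w => T (w ∘ π) := by
    funext w
    rw [mul_comm]
    refine congrArg₂ _ (congrArg η ?_) (congrArg β ?_)
    · funext j
      fin_cases j
      · refine congrArg w ?_
        simp only [π, Equiv.Perm.mul_apply, rotate_zero]
        rw [← Fin.succ_last, rotate_succ]
        exact Fin.ext rfl
      · refine congrArg w ?_
        change _ = π (Fin.succ 0)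
        simp only [π, Equiv.Perm.mul_apply, rotate_succ, Fin.castSucc_zero, rotate_zero]
        exact Fin.ext rfl
    · funext j
      refine congrArg w ?_
      change _ = π (Fin.succ (Fin.succ j))
      simp only [π, Equiv.Perm.mul_apply, rotate_succ, ← Fin.succ_castSucc]
      exact Fin.ext rfl
  have h2 := altSum_succ (fun (u : V) (t : Fin (p + 1) → V) => η ![u, t 0] * β (t ∘ Fin.succ)) v
  have h3 : ∀ (u : V) (t : Fin (p + 1) → V),
      altSum (fun t : Fin (p + 1) → V => η ![u, t 0] * β (t ∘ Fin.succ)) t =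
      ∑ j : Fin (p + 1), (-1 : ℤ) ^ (j : ℕ) • ((p ! : ℝ) • (η ![u, t j] * β (t ∘ j.succAbove))) := by
    intro u t
    rw [altSum_succ (fun (u' : V) (s : Fin p → V) => η ![u, u'] * β s)]
    refine Finset.sum_congr rfl fun j _ => ?_
    congr 1
    have := altSum_alternating (η ![u, t j] • β) (t ∘ j.succAbove)
    rw [Nat.cast_smul_eq_nsmul]
    exact this
  have h4 : altSum T v = ∑ i : Fin (p + 2), (-1 : ℤ) ^ (i : ℕ) • ∑ j : Fin (p + 1),
      (-1 : ℤ) ^ (j : ℕ) • ((p ! : ℝ) • (η ![v i, v (i.succAbove j)] *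
        β ((v ∘ i.succAbove) ∘ j.succAbove))) := by
    refine h2.trans (Finset.sum_congr rfl fun i _ => ?_)
    rw [h3]
    rfl
  rw [cwedge_apply', h1, altSum_comp_perm, hπ, one_smul, h4]
  simp only [Finset.smul_sum]
  refine Finset.sum_congr rfl fun i _ => Finset.sum_congr rfl fun j _ => ?_
  have : ((p)! : ℂ) ≠ 0 := by exact_mod_cast p.factorial_ne_zero
  simp only [zsmul_eq_mul, Complex.real_smul, Nat.factorial_two]
  push_cast
  field_simp

theorem sum_half {G : Type*} [AddCommMonoid G] (f : Fin k → G) :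
    ∑ i : Fin (2 * k), f ⟨i / 2, half_lt i⟩ = 2 • ∑ s, f s := by
  rw [← (finProdFinEquiv.trans (finCongr (mul_comm k 2))).sum_comp, Fintype.sum_prod_type,
    Finset.smul_sum]
  refine Finset.sum_congr rfl fun s _ => ?_
  rw [Fin.sum_univ_two, two_smul]
  congr 2 <;> refine Fin.ext ?_ <;> simp <;> omega

/-- The value on a unitary frame of the wedge product with the fundamental form. -/
theorem IsUnitaryFrame.cwedge_pairs {η : V [⋀^Fin 2]→L[ℝ] ℂ} {e : Fin (k + 1) → V}
    (h : IsUnitaryFrame η e) (β : V [⋀^Fin (2 * k)]→L[ℝ] ℂ) :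
    cwedge β η (pairs e) = ∑ s : Fin (k + 1), β (pairs (e ∘ s.succAbove)) := by
  rw [cwedge_two_apply]
  have key : ∀ i : Fin (2 * (k + 1)), (-1 : ℤ) ^ (i : ℕ) • ∑ j : Fin (2 * k + 1),
      (-1 : ℤ) ^ (j : ℕ) • (η ![pairs e i, pairs e (Fin.succAbove (n := 2 * k + 1) i j)] *
        β ((pairs e ∘ Fin.succAbove (n := 2 * k + 1) i) ∘ j.succAbove)) =
      β (pairs (e ∘ (⟨i / 2, half_lt i⟩ : Fin (k + 1)).succAbove)) := by
    intro i
    have hi := i.2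
    -- The only partner of `2s` on which `η` does not vanish is `2s + 1`, and conversely. Once `i`
    -- is deleted from the list, the partner stands at position `2s = 2 * (i / 2)` in both cases.
    let j₀ : Fin (2 * k + 1) := ⟨2 * (i / 2), by omega⟩
    rw [Finset.sum_eq_single j₀]
    · have h2 : (pairs e ∘ Fin.succAbove (n := 2 * k + 1) i) ∘ j₀.succAbove =
          pairs (e ∘ (⟨i / 2, half_lt i⟩ : Fin (k + 1)).succAbove) := by
        funext l
        refine pairs_congr e (e ∘ (⟨i / 2, half_lt i⟩ : Fin (k + 1)).succAbove)
          (Fin.succAbove (n := 2 * k + 1) i (j₀.succAbove l)) l ?_ (congrArg e (Fin.ext ?_))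
        · simp only [Fin.succAbove, Fin.lt_def, Fin.val_castSucc, j₀]
          split_ifs <;> simp only [Fin.val_castSucc, Fin.val_succ] at * <;> omega
        · simp only [Fin.succAbove, Fin.lt_def, Fin.val_castSucc, j₀]
          split_ifs <;> simp only [Fin.val_castSucc, Fin.val_succ] at * <;> omega
      rw [h2]
      have h3 : (Fin.succAbove (n := 2 * k + 1) i j₀ : ℕ) =
          if (i : ℕ) % 2 = 0 then (i : ℕ) + 1 else (i : ℕ) - 1 := by
        simp only [Fin.succAbove, Fin.lt_def, Fin.val_castSucc, j₀]
        split_ifs <;> simp only [Fin.val_castSucc, Fin.val_succ] at * <;> omega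
      have h4 : (j₀ : ℕ) = 2 * (i / 2) := rfl
      -- For odd `i` the sign `(-1) ^ i` is compensated by `η ![√-1 e, e] = -1`, so both parities
      -- contribute equally.
      rcases Nat.mod_two_eq_zero_or_one i with h0 | h0
      · rw [if_pos h0] at h3
        have e1 : pairs e i = e ⟨i / 2, half_lt i⟩ := if_pos h0
        have e2 : pairs e (Fin.succAbove (n := 2 * k + 1) i j₀) =
            Complex.I • e ⟨i / 2, half_lt i⟩ := by
          rw [pairs, if_neg (by omega)]
          congr 2
          exact Fin.ext (by simp only [h3]; omega)
        rw [e1, e2, h.mixed, if_pos rfl, one_mul, h4, pow_mul, (Nat.even_iff.2 h0).neg_one_pow]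
        simp
      · rw [if_neg (by omega)] at h3
        have e1 : pairs e i = Complex.I • e ⟨i / 2, half_lt i⟩ := if_neg (by omega)
        have e2 : pairs e (Fin.succAbove (n := 2 * k + 1) i j₀) = e ⟨i / 2, half_lt i⟩ := by
          rw [pairs, if_pos (by omega)]
          congr 1
          exact Fin.ext (by simp only [h3]; omega)
        rw [e1, e2, h.mixed', if_pos rfl, h4, pow_mul, (Nat.odd_iff.2 h0).neg_one_pow]
        simp
    · intro j _ hj
      rw [h.apply_pairs_of_ne, zero_mul, smul_zero]
      intro h5
      apply hj
      refine Fin.ext ?_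
      change (j : ℕ) = 2 * (i / 2)
      revert h5
      simp only [Fin.succAbove, Fin.lt_def, Fin.val_castSucc]
      split_ifs <;> simp only [Fin.val_castSucc, Fin.val_succ] at * <;> omega
    · simp
  -- Each complex line is met twice, at `2s` and `2s + 1`; this cancels the one half in
  -- `cwedge_two_apply`.
  have h5 := sum_half (fun s : Fin (k + 1) => β (pairs (e ∘ s.succAbove)))
  rw [← Finset.sum_congr rfl fun i _ => key i] at h5
  refine (congrArg _ h5).trans ?_
  rw [← Nat.cast_smul_eq_nsmul ℝ, smul_smul]
  norm_num

theorem IsUnitaryFrame.wedgePow_pairs {η : V [⋀^Fin 2]→L[ℝ] ℂ} :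
    ∀ {k : ℕ} {e : Fin k → V}, IsUnitaryFrame η e → wedgePow η k (pairs e) = k !
  | 0, e, _ => by simp [wedgePow]
  | k + 1, e, h => by
    refine (h.cwedge_pairs (wedgePow η k)).trans ?_
    rw [Finset.sum_congr rfl fun s _ =>
      (h.comp s.succAbove Fin.succAbove_right_injective).wedgePow_pairs]
    simp [Nat.factorial_succ]

theorem IsUnitaryFrame.dividedPow_pairs {η : V [⋀^Fin 2]→L[ℝ] ℂ} {e : Fin k → V}
    (h : IsUnitaryFrame η e) : dividedPow η k (pairs e) = 1 := by
  rw [dividedPow, ContinuousAlternatingMap.smul_apply, h.wedgePow_pairs]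
  have : (k ! : ℂ) ≠ 0 := by exact_mod_cast k.factorial_ne_zero
  simp [this]

/-- `α ∧ η ^ k` for a 4-form `α`, as a form of degree `2 (k + 2)`. -/
noncomputable def wedgeIter (α : V [⋀^Fin 4]→L[ℝ] ℂ) (η : V [⋀^Fin 2]→L[ℝ] ℂ) :
    (k : ℕ) → V [⋀^Fin (2 * (k + 2))]→L[ℝ] ℂ
  | 0 => α
  | k + 1 => cwedge (wedgeIter α η k) η

theorem cwedge_castDeg {r : ℕ} (h : p = q) (α : V [⋀^Fin p]→L[ℝ] ℂ) (β : V [⋀^Fin r]→L[ℝ] ℂ) :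
    cwedge (castDeg h α) β = castDeg (congrArg (· + r) h) (cwedge α β) := by
  subst h
  rfl

theorem castDeg_castDeg {r : ℕ} (h : p = q) (h' : q = r) (α : V [⋀^Fin p]→L[ℝ] ℂ) :
    castDeg h' (castDeg h α) = castDeg (h.trans h') α := by
  subst h h'
  rfl

theorem cwedge_wedgePow_zero (α : V [⋀^Fin p]→L[ℝ] ℂ) (η : V [⋀^Fin 2]→L[ℝ] ℂ) :
    cwedge α (wedgePow η 0) = (α :) := by
  ext v
  have h := altSum_alternating α v
  rw [cwedge_apply']
  simp only [wedgePow, mul_zero, Nat.factorial_zero]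
  have h' : (fun w : Fin (p + 0) → V => α (w ∘ Fin.castAdd 0) *
      (ContinuousAlternatingMap.constOfIsEmpty ℝ V (Fin 0) (1 : ℂ) :) (w ∘ Fin.natAdd p)) = ⇑α := by
    funext w
    exact mul_one _
  refine (congrArg (fun T : (Fin p → V) → ℂ =>
    ((p ! : ℝ) * ((0 : ℕ) ! : ℝ))⁻¹ • altSum T v) h').trans ?_
  simp only [h]
  rw [← Nat.cast_smul_eq_nsmul ℝ, smul_smul]
  have : ((p)! : ℝ) ≠ 0 := by positivity
  rw [Nat.factorial_zero, Nat.cast_one, mul_one, inv_mul_cancel₀ this, one_smul]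

theorem four_add (k : ℕ) : 4 + 2 * k = 2 * (k + 2) := by omega

/-- The degrees in `wedgeIter` agree definitionally at each step, which keeps casts out of the
induction of `wedgeIter_pairs`. Associativity relates it to the actual product with `η ^ k`. -/
theorem wedgeIter_eq (α : V [⋀^Fin 4]→L[ℝ] ℂ) (η : V [⋀^Fin 2]→L[ℝ] ℂ) :
    ∀ k, wedgeIter α η k = castDeg (four_add k) (cwedge α (wedgePow η k))
  | 0 => (cwedge_wedgePow_zero α η).symm
  | k + 1 => by
    have h := cwedge_assoc α (wedgePow η k) η
    have h' : cwedge α (wedgePow η (k + 1)) = cwedge α (cwedge (wedgePow η k) η) := rfl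
    rw [h', ← h]
    change cwedge (wedgeIter α η k) η = _
    rw [wedgeIter_eq α η k, cwedge_castDeg]
    exact (castDeg_castDeg _ _ _).symm

/-- An ordered pair of distinct indices survives the deletion of `s` for `N - 1` of the `N + 1`
values of `s`, and the diagonal contributes nothing. -/
theorem sum_sum_succAbove {N : ℕ} (c : Fin (N + 1) → Fin (N + 1) → ℂ) (hc : ∀ i, c i i = 0) :
    ∑ s : Fin (N + 1), ∑ i, ∑ j, c (s.succAbove i) (s.succAbove j) =
      ((N : ℂ) - 1) * ∑ i, ∑ j, c i j := by
  have h : ∀ s : Fin (N + 1), ∑ i, ∑ j, c (s.succAbove i) (s.succAbove j) =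
      ∑ i, ∑ j, c i j - ∑ j, c s j - ∑ i, c i s := fun s => by
    have h1 := fun i => Fin.sum_univ_succAbove (fun j => c i j) s
    have h2 := Fin.sum_univ_succAbove (fun i => ∑ j, c i j) s
    have h3 := Fin.sum_univ_succAbove (fun i => c i s) s
    rw [h2, h3, hc, Finset.sum_congr rfl fun i _ => h1 (s.succAbove i), Finset.sum_add_distrib]
    ring
  rw [Finset.sum_congr rfl fun s _ => h s, Finset.sum_sub_distrib, Finset.sum_sub_distrib,
    Finset.sum_comm (f := fun s i => c i s)]
  simp
  ring

/-- Each further factor `η` uses up one complex line. A pair of lines survives `k + 1` of the `k +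
3` possible deletions, which builds the factorial; the one half is there because the double sum
meets each unordered pair of lines twice. -/
theorem IsUnitaryFrame.wedgeIter_pairs (α : V [⋀^Fin 4]→L[ℝ] ℂ) {η : V [⋀^Fin 2]→L[ℝ] ℂ} :
    ∀ {k : ℕ} {e : Fin (k + 2) → V}, IsUnitaryFrame η e → wedgeIter α η k (pairs e) =
      (k ! : ℂ) / 2 * ∑ a, ∑ b, α ![e a, Complex.I • e a, e b, Complex.I • e b]
  | 0, e, _ => by
    have h1 : pairs e = ![e 0, Complex.I • e 0, e 1, Complex.I • e 1] := by
      funext i; fin_cases i <;> simp [pairs]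
    have h0 : ∀ a, α ![e a, Complex.I • e a, e a, Complex.I • e a] = 0 := fun a =>
      α.map_eq_zero_of_eq _ (i := 0) (j := 2) rfl (by decide)
    have h2 : α ![e 1, Complex.I • e 1, e 0, Complex.I • e 0] =
        α ![e 0, Complex.I • e 0, e 1, Complex.I • e 1] := by
      have := α.toAlternatingMap.map_perm ![e 0, Complex.I • e 0, e 1, Complex.I • e 1]
        (Equiv.swap 0 2 * Equiv.swap 1 3)
      have hs : Equiv.Perm.sign (Equiv.swap (0 : Fin 4) 2 * Equiv.swap 1 3) = 1 := by decide
      rw [hs, one_smul] at this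
      rw [ContinuousAlternatingMap.coe_toAlternatingMap] at this
      rw [← this]
      congr 1
      funext i; fin_cases i <;> rfl
    change α (pairs e) = ((0 !) : ℂ) / 2 * ∑ a : Fin 2, ∑ b : Fin 2,
      α ![e a, Complex.I • e a, e b, Complex.I • e b]
    rw [h1]
    simp only [Fin.sum_univ_two, h0, h2, zero_add, add_zero, Nat.factorial_zero]
    push_cast
    ring
  | k + 1, e, h => by
    refine (h.cwedge_pairs (wedgeIter α η k)).trans ?_
    rw [Finset.sum_congr rfl fun s _ =>
      (h.comp s.succAbove Fin.succAbove_right_injective).wedgeIter_pairs α, ← Finset.mul_sum]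
    have := sum_sum_succAbove (fun a b => α ![e a, Complex.I • e a, e b, Complex.I • e b])
      (fun a => α.map_eq_zero_of_eq _ (i := 0) (j := 2) rfl (by decide))
    simp only [Function.comp_apply]
    rw [this, Nat.factorial_succ]
    push_cast
    ring_nf

theorem IsUnitaryFrame.cwedge_dividedPow_pairs {n : ℕ} (hn : 2 ≤ n) (α : V [⋀^Fin (1 + 1 + 1 + 1)]→L[ℝ] ℂ)
    {η : V [⋀^Fin 2]→L[ℝ] ℂ} {e : Fin n → V} (h : IsUnitaryFrame η e) :
    cwedge α (dividedPow η (n - 2)) (pairs e ∘ Fin.cast (degree_eq hn).symm) =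
      2⁻¹ * ∑ a, ∑ b, α ![e a, Complex.I • e a, e b, Complex.I • e b] := by
  obtain ⟨k, rfl⟩ : ∃ k, n = k + 2 := ⟨n - 2, by omega⟩
  have h1 := h.wedgeIter_pairs α
  rw [wedgeIter_eq, castDeg_apply] at h1
  have h2 : cwedge α (dividedPow η k) = ((k ! : ℝ))⁻¹ • cwedge α (wedgePow η k) := by
    ext v
    have h3 : (fun w => α (w ∘ Fin.castAdd (2 * k)) *
        dividedPow η k (w ∘ Fin.natAdd (1 + 1 + 1 + 1))) = fun w => ((k ! : ℝ))⁻¹ •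
        (α (w ∘ Fin.castAdd (2 * k)) * wedgePow η k (w ∘ Fin.natAdd (1 + 1 + 1 + 1))) := by
      funext w
      rw [dividedPow, ContinuousAlternatingMap.smul_apply, mul_smul_comm]
    rw [ContinuousAlternatingMap.smul_apply, cwedge_apply', cwedge_apply', h3,
      altSum_const_smul, smul_comm]
  change cwedge α (dividedPow η k) (pairs e ∘ Fin.cast _) = _
  rw [h2, ContinuousAlternatingMap.smul_apply]
  refine (congrArg _ h1).trans ?_
  have : (k ! : ℂ) ≠ 0 := by exact_mod_cast k.factorial_ne_zero
  rw [Complex.real_smul]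
  push_cast
  field_simp

end Frame

/-! ### Smoothness of families of forms and of Christoffel symbols. -/

section Calculus

set_option linter.unusedSectionVars false

variable {V W X : Type*} [NormedAddCommGroup V] [NormedSpace ℝ V] [FiniteDimensional ℝ V]
  [NormedAddCommGroup W] [NormedSpace ℝ W] [FiniteDimensional ℝ W]
  [NormedAddCommGroup X] [NormedSpace ℝ X] {k : ℕ}

/-- It makes all linear maps out of spaces of forms continuous, so that evaluations and wedge
products can be differentiated without norm estimates. -/
instance finiteDimensional_alternating : FiniteDimensional ℝ (V [⋀^Fin k]→L[ℝ] W) :=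
  Module.Finite.of_injective
    ({ toFun := fun α => α.toContinuousMultilinearMap.toMultilinearMap
       map_add' := fun _ _ => rfl
       map_smul' := fun _ _ => rfl } :
      (V [⋀^Fin k]→L[ℝ] W) →ₗ[ℝ] MultilinearMap ℝ (fun _ : Fin k => V) W)
    (fun α β h => by
      ext v
      exact congrArg (fun m : MultilinearMap ℝ (fun _ : Fin k => V) W => m v) h)

/-- `Φ` has a linear left inverse, continuous by finite dimensionality. Smoothness may therefore be
tested on values at basis vectors. -/
theorem contDiffAt_of_injective {Y Z : Type*} [NormedAddCommGroup Y] [NormedSpace ℝ Y]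
    [FiniteDimensional ℝ Y] [NormedAddCommGroup Z] [NormedSpace ℝ Z] [FiniteDimensional ℝ Z]
    (Φ : Y →ₗ[ℝ] Z) (hΦ : Function.Injective Φ) {n : WithTop ℕ∞} {f : X → Y} {x : X}
    (h : ContDiffAt ℝ n (fun z => Φ (f z)) x) : ContDiffAt ℝ n f x := by
  obtain ⟨Ψ, hΨ⟩ := Φ.exists_leftInverse_of_injective (LinearMap.ker_eq_bot.2 hΦ)
  have e : f = fun z => LinearMap.toContinuousLinearMap Ψ (Φ (f z)) := by
    funext z
    exact (LinearMap.congr_fun hΨ (f z)).symm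
  rw [e]
  exact (ContinuousLinearMap.contDiff _).contDiffAt.comp x h

/-- A family of alternating maps is smooth if its values are. -/
theorem contDiffAt_alternating {n : WithTop ℕ∞} {f : X → V [⋀^Fin k]→L[ℝ] W} {x : X}
    (h : ∀ v, ContDiffAt ℝ n (fun z => f z v) x) : ContDiffAt ℝ n f x := by
  let b := Module.finBasis ℝ V
  refine contDiffAt_of_injective (Z := (Fin k → Fin (Module.finrank ℝ V)) → W)
    { toFun := fun α i => α fun j => b (i j)
      map_add' := fun _ _ => rfl
      map_smul' := fun _ _ => rfl } (fun α β hαβ => ?_) (contDiffAt_pi.2 fun i => h _)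
  apply ContinuousAlternatingMap.toAlternatingMap_injective
  apply AlternatingMap.coe_multilinearMap_injective
  exact Module.Basis.ext_multilinear (fun _ => b) fun i => congrFun hαβ i

theorem contDiffAt_bilin {n : WithTop ℕ∞} {f : X → V →L[ℝ] V →L[ℝ] W} {x : X}
    (h : ∀ u v, ContDiffAt ℝ n (fun z => f z u v) x) : ContDiffAt ℝ n f x := by
  let b := Module.finBasis ℝ V
  let d := Module.finrank ℝ V
  refine contDiffAt_of_injective (Z := Fin d → Fin d → W)
    { toFun := fun B i j => B (b i) (b j)
      map_add' := fun _ _ => rfl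
      map_smul' := fun _ _ => rfl } (fun B B' hB => ?_)
      (contDiffAt_pi.2 fun i => contDiffAt_pi.2 fun j => h _ _)
  apply ContinuousLinearMap.coe_injective
  refine b.ext fun i => ContinuousLinearMap.coe_injective (b.ext fun j => ?_)
  exact congrFun (congrFun hB i) j

theorem contDiffAt_bilin_apply {n : WithTop ℕ∞} {f : X → V →L[ℝ] V →L[ℝ] W} {x : X}
    (h : ContDiffAt ℝ n f x) {u v : X → V} (hu : ContDiffAt ℝ n u x) (hv : ContDiffAt ℝ n v x) :
    ContDiffAt ℝ n (fun z => f z (u z) (v z)) x :=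
  (h.clm_apply hu).clm_apply hv

theorem fderiv_bilin_apply {f : X → V →L[ℝ] V →L[ℝ] W} {x : X}
    (h : DifferentiableAt ℝ f x) (a : X) (u v : V) :
    fderiv ℝ (fun z => f z u v) x a = fderiv ℝ f x a u v := by
  have h1 := (h.hasFDerivAt.clm_apply (hasFDerivAt_const u x)).clm_apply (hasFDerivAt_const v x)
  rw [h1.fderiv]
  simp

theorem fderiv_alternating_apply {f : X → V [⋀^Fin k]→L[ℝ] W} {x : X}
    (h : DifferentiableAt ℝ f x) (a : X) (v : Fin k → V) :
    fderiv ℝ (fun z => f z v) x a = fderiv ℝ f x a v := by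
  let Φ : (V [⋀^Fin k]→L[ℝ] W) →ₗ[ℝ] W :=
    { toFun := fun α => α v
      map_add' := fun _ _ => rfl
      map_smul' := fun _ _ => rfl }
  have := ((LinearMap.toContinuousLinearMap Φ).hasFDerivAt.comp x h.hasFDerivAt).fderiv
  exact (congrArg (fun L : X →L[ℝ] W => L a) this)

/-- A nonzero vector in the kernel of the Gram matrix would be the coordinate vector of a nonzero
vector of length zero. -/
theorem gram_isUnit {B : V →L[ℝ] V →L[ℝ] ℝ} (hB : ∀ u, u ≠ 0 → 0 < B u u) :
    IsUnit (gram B).det := by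
  rw [isUnit_iff_ne_zero]
  intro h0
  obtain ⟨x, hx, hx0⟩ := Matrix.exists_vecMul_eq_zero_iff.2 h0
  let b := Module.finBasis ℝ V
  have h1 : ∀ c, B (∑ a, x a • b a) (b c) = 0 := fun c => by
    have := congrFun hx0 c
    simpa [Matrix.vecMul, dotProduct, gram, b] using this
  have h2 : B (∑ a, x a • b a) (∑ a, x a • b a) = 0 := by
    conv_lhs => rw [map_sum (B (∑ a, x a • b a))]
    simp only [map_smul, h1, smul_zero, Finset.sum_const_zero]
  have h3 : ∑ a, x a • b a = 0 := by
    by_contra h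
    exact (hB _ h).ne' h2
  exact hx (funext fun a => (Fintype.linearIndependent_iff.1 b.linearIndependent x h3) a)

set_option maxSynthPendingDepth 3 in
theorem contDiffAt_christoffel {G : V → V →L[ℝ] V →L[ℝ] ℝ} {w : V} (hd : ContDiffAt ℝ ∞ G w)
    (hp : ∀ u, u ≠ 0 → 0 < G w u u) : ContDiffAt ℝ ∞ (christoffel G) w := by
  have hD : ContDiffAt ℝ ∞ (fderiv ℝ G) w := hd.fderiv_right (by simp)
  have hgram : ∀ a b, ContDiffAt ℝ ∞ (fun z => gram (G z) a b) w := fun a b =>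
    contDiffAt_bilin_apply hd contDiffAt_const contDiffAt_const
  have hdet : ∀ (r : ℕ) (M : V → Matrix (Fin r) (Fin r) ℝ),
      (∀ a b, ContDiffAt ℝ ∞ (fun z => M z a b) w) → ContDiffAt ℝ ∞ (fun z => (M z).det) w :=
    fun r M hM => by
      simp only [Matrix.det_apply, Units.smul_def, zsmul_eq_mul]
      refine ContDiffAt.sum fun σ _ => contDiffAt_const.mul ?_
      exact contDiffAt_prod fun i _ => hM _ _
  -- Entries of the inverse are cofactors divided by the determinant, and both are determinants of
  -- matrices with smooth entries.
  have hinv : ∀ a b, ContDiffAt ℝ ∞ (fun z => (gram (G z))⁻¹ a b) w := fun a b => by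
    simp only [Matrix.inv_def, Matrix.smul_apply, smul_eq_mul, Ring.inverse_eq_inv']
    refine ((hdet _ _ hgram).inv (gram_isUnit (hp)).ne_zero).mul ?_
    simp only [Matrix.adjugate_apply]
    refine hdet _ _ fun c d => ?_
    by_cases h : c = b
    · subst h
      simp only [Matrix.updateRow_self]
      exact contDiffAt_const
    · simp only [Matrix.updateRow_ne h]
      exact hgram c d
  refine contDiffAt_bilin fun u v => ?_
  simp only [christoffel_apply, christoffelFirst_apply]
  refine ContDiffAt.sum fun a _ => ContDiffAt.sum fun b _ => (hinv a b).smul ?_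
  refine ContDiffAt.smul (𝕜' := ℝ) (contDiffAt_const.mul ?_) contDiffAt_const
  have h3 : ∀ x y z : V, ContDiffAt ℝ ∞ (fun p => fderiv ℝ G p x y z) w := fun x y z =>
    ((hD.clm_apply contDiffAt_const).clm_apply contDiffAt_const).clm_apply contDiffAt_const
  exact ((h3 _ _ _).add (h3 _ _ _)).sub (h3 _ _ _)

end Calculus

/-! ### Kähler metrics on an open set: Levi-Civita connection and Hermitian metric. -/

section LocalKaehler

set_option linter.unusedSectionVars false

variable {V : Type*} [NormedAddCommGroup V] [NormedSpace ℂ V] [FiniteDimensional ℂ V]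

theorem fundamentalForm_apply (B : V →L[ℝ] V →L[ℝ] ℝ) (u v : V) :
    fundamentalForm B ![u, v] = ((2⁻¹ * (B (Complex.I • u) v - B (Complex.I • v) u) : ℝ) : ℂ) := by
  have h5 : (Finset.univ : Finset (Equiv.Perm (Fin 2))) = {1, Equiv.swap 0 1} := by decide
  have h6 : (1 : Equiv.Perm (Fin 2)) ≠ Equiv.swap 0 1 := by decide
  rw [fundamentalForm, ContinuousAlternatingMap.smul_apply, wedge_apply]
  erw [h5, Finset.sum_pair h6]
  have e0 : (Fin.castAdd 1 (0 : Fin 1) : Fin (1 + 1)) = (0 : Fin 2) := rfl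
  simp [oneForm, mulI_apply, e0]
  ring

/-- A Kähler metric on an open subset of a complex vector space. -/
structure IsLocalKaehler (G : V → V →L[ℝ] V →L[ℝ] ℝ) (U : Set V) : Prop where
  isOpen : IsOpen U
  smooth : ContDiffOn ℝ ∞ G U
  symm : ∀ w ∈ U, ∀ u v, G w u v = G w v u
  inv : ∀ w ∈ U, ∀ u v, G w (Complex.I • u) (Complex.I • v) = G w u v
  pos : ∀ w ∈ U, ∀ u, u ≠ 0 → 0 < G w u u
  closed : ∀ w ∈ U, extDeriv (fun z => fundamentalForm (G z)) w = 0

variable {G : V → V →L[ℝ] V →L[ℝ] ℝ} {U : Set V} {w : V}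

/-- The Christoffel symbols of the second kind are determined by those of the first kind. -/
theorem metric_christoffel (hs : ∀ u v, G w u v = G w v u)
    (hp : ∀ u, u ≠ 0 → 0 < G w u u) (u v t : V) :
    G w (christoffel G w u v) t = christoffelFirst G w t u v := by
  let b := Module.finBasis ℝ V
  have hu := gram_isUnit hp
  have hlin : ∀ (r : ℝ) (t₁ t₂ : V), christoffelFirst G w (t₁ + r • t₂) u v =
      christoffelFirst G w t₁ u v + r * christoffelFirst G w t₂ u v := fun r t₁ t₂ => by
    simp [christoffelFirst_apply]
    ring
  let φ₁ : V →ₗ[ℝ] ℝ :=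
    { toFun := fun t => christoffelFirst G w t u v
      map_add' := fun t₁ t₂ => by simpa using hlin 1 t₁ t₂
      map_smul' := fun r t => by
        have h := hlin r 0 t
        have h0 : christoffelFirst G w 0 u v = 0 := by simp [christoffelFirst_apply]
        simpa [h0] using h }
  suffices h : (G w (christoffel G w u v)).toLinearMap = φ₁ from LinearMap.congr_fun h t
  refine b.ext fun c => ?_
  change G w (christoffel G w u v) (b c) = christoffelFirst G w (b c) u v
  rw [christoffel_apply]
  simp only [map_sum, map_smul, sum_apply, smul_apply,
    smul_eq_mul]
  rw [Finset.sum_comm]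
  have h1 : ∀ d, ∑ a, (gram (G w))⁻¹ a d * (christoffelFirst G w (b d) u v * G w (b a) (b c)) =
      (gram (G w) * (gram (G w))⁻¹) c d * christoffelFirst G w (b d) u v := fun d => by
    rw [Matrix.mul_apply, Finset.sum_mul]
    refine Finset.sum_congr rfl fun a _ => ?_
    rw [hs (b a) (b c)]
    change _ = G w (b c) (b a) * _ * _
    ring
  refine (Finset.sum_congr rfl fun d _ => h1 d).trans ?_
  rw [Matrix.mul_nonsing_inv _ hu]
  simp [Matrix.one_apply]

theorem metric_nondegenerate {B : V →L[ℝ] V →L[ℝ] ℝ} (hB : ∀ u, u ≠ 0 → 0 < B u u) {u v : V}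
    (h : ∀ t, B u t = B v t) : u = v := by
  by_contra hne
  have := hB (u - v) (sub_ne_zero.2 hne)
  rw [map_sub B, sub_apply, h, sub_self] at this
  exact lt_irrefl _ this

namespace IsLocalKaehler

variable (hG : IsLocalKaehler G U) (hw : w ∈ U)

include hG hw

theorem contDiffAt : ContDiffAt ℝ ∞ G w := hG.smooth.contDiffAt (hG.isOpen.mem_nhds hw)

theorem differentiableAt : DifferentiableAt ℝ G w := (hG.contDiffAt hw).differentiableAt (by simp)

theorem eventually {p : V → Prop} (h : ∀ z ∈ U, p z) : ∀ᶠ z in 𝓝 w, p z :=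
  Filter.eventually_of_mem (hG.isOpen.mem_nhds hw) h

theorem fderiv_symm (a u v : V) : fderiv ℝ G w a u v = fderiv ℝ G w a v u := by
  rw [← fderiv_bilin_apply (hG.differentiableAt hw), ← fderiv_bilin_apply (hG.differentiableAt hw)]
  have : (fun z => G z u v) =ᶠ[𝓝 w] fun z => G z v u :=
    hG.eventually hw fun z hz => hG.symm z hz u v
  rw [this.fderiv_eq]

theorem fderiv_inv (a u v : V) :
    fderiv ℝ G w a (Complex.I • u) (Complex.I • v) = fderiv ℝ G w a u v := by
  rw [← fderiv_bilin_apply (hG.differentiableAt hw), ← fderiv_bilin_apply (hG.differentiableAt hw)]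
  have : (fun z => G z (Complex.I • u) (Complex.I • v)) =ᶠ[𝓝 w] fun z => G z u v :=
    hG.eventually hw fun z hz => hG.inv z hz u v
  rw [this.fderiv_eq]

theorem fderiv_I_right (a u v : V) :
    fderiv ℝ G w a u (Complex.I • v) = - fderiv ℝ G w a (Complex.I • u) v := by
  have h := hG.fderiv_inv hw a (Complex.I • u) v
  rw [smul_smul, Complex.I_mul_I, neg_one_smul, map_neg, neg_apply] at h
  linarith

theorem metric_I_right (u v : V) : G w u (Complex.I • v) = - G w (Complex.I • u) v := by
  have h := hG.inv w hw (Complex.I • u) v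
  rw [smul_smul, Complex.I_mul_I, neg_one_smul, map_neg, neg_apply] at h
  linarith

/-- This is dω = 0 on the triple `u, v, t`, written with the derivatives of `G` through ω(u, v) =
G(√-1 u, v). -/
theorem fderiv_cyclic (u v t : V) : fderiv ℝ G w u (Complex.I • v) t +
    fderiv ℝ G w v (Complex.I • t) u + fderiv ℝ G w t (Complex.I • u) v = 0 := by
  have hd := hG.differentiableAt hw
  have e : ∀ u v : V, (fun z => fundamentalForm (G z) ![u, v]) =ᶠ[𝓝 w]
      fun z => ((G z (Complex.I • u) v : ℝ) : ℂ) := fun u v => by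
    refine hG.eventually hw fun z hz => ?_
    beta_reduce
    rw [fundamentalForm_apply]
    have h1 := hG.metric_I_right hz u v
    have h2 := hG.symm z hz (Complex.I • v) u
    rw [h2, h1]
    push_cast
    ring
  have hd' : ∀ u v : V, DifferentiableAt ℝ (fun z => G z u v) w := fun u v =>
    (hd.clm_apply (differentiableAt_const u)).clm_apply (differentiableAt_const v)
  have f : ∀ a u v : V, fderiv ℝ (fun z => fundamentalForm (G z) ![u, v]) w a =
      (fderiv ℝ G w a (Complex.I • u) v : ℝ) := fun a u v => by
    rw [(e u v).fderiv_eq, ← fderiv_bilin_apply hd]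
    have := (Complex.ofRealCLM.hasFDerivAt.comp w (hd' (Complex.I • u) v).hasFDerivAt).fderiv
    exact congrArg (fun L : V →L[ℝ] ℂ => L a) this
  have hdiff : DifferentiableAt ℝ (fun z => fundamentalForm (G z)) w := by
    refine (contDiffAt_alternating (n := 1) fun x => ?_).differentiableAt one_ne_zero
    have hx : x = ![x 0, x 1] := by ext i; fin_cases i <;> rfl
    rw [hx]
    refine ContDiffAt.congr_of_eventuallyEq ?_ (e _ _)
    refine Complex.ofRealCLM.contDiff.contDiffAt.comp w ?_
    exact contDiffAt_bilin_apply ((hG.contDiffAt hw).of_le (by simp)) contDiffAt_const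
      contDiffAt_const
  have h := congrArg (fun α : V [⋀^Fin 3]→L[ℝ] ℂ => α ![u, v, t]) (hG.closed w hw)
  simp only [extDeriv_apply hdiff] at h
  have r0 : Fin.removeNth 0 ![u, v, t] = ![v, t] := by ext i; fin_cases i <;> rfl
  have r1 : Fin.removeNth 1 ![u, v, t] = ![u, t] := by ext i; fin_cases i <;> rfl
  have r2 : Fin.removeNth 2 ![u, v, t] = ![u, v] := by ext i; fin_cases i <;> rfl
  have h' : fderiv ℝ (fun z => fundamentalForm (G z) ![v, t]) w u -
      fderiv ℝ (fun z => fundamentalForm (G z) ![u, t]) w v +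
      fderiv ℝ (fun z => fundamentalForm (G z) ![u, v]) w t = 0 := by
    rw [← r0, ← r1, ← r2]
    have hz : (0 : V [⋀^Fin 3]→L[ℝ] ℂ) ![u, v, t] = 0 := rfl
    refine Eq.trans ?_ (h.trans hz)
    rw [Fin.sum_univ_three]
    simp
    ring
  rw [f, f, f] at h'
  have h'' : fderiv ℝ G w u (Complex.I • v) t - fderiv ℝ G w v (Complex.I • u) t +
      fderiv ℝ G w t (Complex.I • u) v = 0 := by exact_mod_cast h'
  have h3 := hG.fderiv_I_right hw v u t
  have h4 := hG.fderiv_symm hw v (Complex.I • t) u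
  linarith

theorem metric_christoffel (u v t : V) :
    G w (christoffel G w u v) t = 2⁻¹ * (fderiv ℝ G w u v t + fderiv ℝ G w v u t
      - fderiv ℝ G w t u v) := by
  rw [KaehlerBochner.metric_christoffel (hG.symm w hw) (hG.pos w hw), christoffelFirst_apply]

theorem christoffel_symm (u v : V) : christoffel G w u v = christoffel G w v u := by
  refine metric_nondegenerate (hG.pos w hw) fun t => ?_
  rw [hG.metric_christoffel hw, hG.metric_christoffel hw, hG.fderiv_symm hw t u v]
  ring

/-- Adding the two Koszul formulas for `Γ(a, s)` and `Γ(a, t)` leaves only the derivative along `a`.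
-/
theorem fderiv_metric (a s t : V) :
    fderiv ℝ G w a s t = G w (christoffel G w a s) t + G w s (christoffel G w a t) := by
  rw [hG.symm w hw s, hG.metric_christoffel hw, hG.metric_christoffel hw, hG.fderiv_symm hw a t s,
    hG.fderiv_symm hw t a s, hG.fderiv_symm hw s a t]
  ring

/-- The Kähler condition enters here: closedness of ω makes the complex structure parallel, so `Γ`
is complex bilinear in a holomorphic chart. The Koszul formula is combined with dω = 0 on the
triples (√-1 u, v, √-1 t) and (u, v, t). -/
theorem christoffel_I_left (u v : V) :
    christoffel G w (Complex.I • u) v = Complex.I • christoffel G w u v := by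
  refine metric_nondegenerate (hG.pos w hw) fun t => ?_
  have h1 := hG.metric_I_right hw (christoffel G w u v) t
  have h2 := hG.metric_christoffel hw u v (Complex.I • t)
  rw [hG.metric_christoffel hw]
  have c1 := hG.fderiv_cyclic hw (Complex.I • u) v (Complex.I • t)
  have c2 := hG.fderiv_cyclic hw u v t
  simp only [smul_smul, Complex.I_mul_I, neg_one_smul, map_neg, neg_apply]
    at c1
  have i1 := hG.fderiv_I_right hw (Complex.I • u) (Complex.I • v) t
  have i2 := hG.fderiv_I_right hw u v t
  have i3 := hG.fderiv_I_right hw v u t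
  have i4 := hG.fderiv_I_right hw v t u
  have s1 := hG.fderiv_symm hw v t (Complex.I • u)
  have s2 := hG.fderiv_symm hw v (Complex.I • t) u
  have s3 := hG.fderiv_symm hw t u v
  simp only [smul_smul, Complex.I_mul_I, neg_one_smul, map_neg, neg_apply]
    at i1
  linarith

theorem christoffel_I_right (u v : V) :
    christoffel G w u (Complex.I • v) = Complex.I • christoffel G w u v := by
  rw [hG.christoffel_symm hw, hG.christoffel_I_left hw, hG.christoffel_symm hw]

theorem herm_I_left (u v : V) :
    herm (G w) (Complex.I • u) v = Complex.I * herm (G w) u v := by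
  rw [herm_apply, herm_apply, hG.inv w hw, hG.metric_I_right hw u v]
  simp only [Complex.real_smul]
  push_cast
  linear_combination (2⁻¹ : ℂ) * (G w (Complex.I • u) v : ℂ) * Complex.I_sq

theorem herm_conj (u v : V) : (starRingEnd ℂ) (herm (G w) u v) = herm (G w) v u := by
  rw [herm_apply, herm_apply, hG.metric_I_right hw u v, hG.symm w hw (Complex.I • u),
    hG.symm w hw u v]
  simp [Complex.real_smul, Complex.conj_ofReal, map_ofNat]

theorem herm_I_right (u v : V) :
    herm (G w) u (Complex.I • v) = - (Complex.I * herm (G w) u v) := by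
  rw [← hG.herm_conj hw, hG.herm_I_left hw, map_mul, hG.herm_conj hw]
  simp

theorem christoffel_contDiffAt : ContDiffAt ℝ ∞ (christoffel G) w :=
  contDiffAt_christoffel (hG.contDiffAt hw) (hG.pos w hw)

/-- Compatibility holds for the real parts `G(s, t)` and `G(s, √-1 t)` separately; as `Γ` commutes
with √-1, they recombine into the Hermitian pairing. -/
theorem hasFDerivAt_herm (s t a : V) : fderiv ℝ (fun z => herm (G z) s t) w a =
    herm (G w) (christoffel G w a s) t + herm (G w) s (christoffel G w a t) := by
  have hd := hG.differentiableAt hw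
  have hd' : ∀ u v : V, DifferentiableAt ℝ (fun z => G z u v) w := fun u v =>
    (hd.clm_apply (differentiableAt_const u)).clm_apply (differentiableAt_const v)
  have h1 : ∀ u v : V, HasFDerivAt (fun z => ((G z u v : ℝ) : ℂ))
      (Complex.ofRealCLM ∘L fderiv ℝ (fun z => G z u v) w) w := fun u v =>
    Complex.ofRealCLM.hasFDerivAt.comp w (hd' u v).hasFDerivAt
  have h2 : HasFDerivAt (fun z => herm (G z) s t) ((2 : ℝ)⁻¹ •
      ((Complex.ofRealCLM ∘L fderiv ℝ (fun z => G z s t) w) + Complex.I •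
      (Complex.ofRealCLM ∘L fderiv ℝ (fun z => G z s (Complex.I • t)) w))) w := by
    simp only [herm_apply]
    exact ((h1 s t).add ((h1 s (Complex.I • t)).const_mul Complex.I)).const_smul (2 : ℝ)⁻¹
  rw [h2.fderiv]
  simp only [smul_apply, add_apply,
    ContinuousLinearMap.comp_apply, fderiv_bilin_apply hd, hG.fderiv_metric hw, herm_apply,
    Complex.ofRealCLM_apply, hG.christoffel_I_right hw, smul_eq_mul, Complex.real_smul]
  push_cast
  ring

end IsLocalKaehler

end LocalKaehler

/-! ### The curvature of a Kähler metric, its symmetries and its coordinate formula. -/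

section Curvature

set_option linter.unusedSectionVars false

variable {V : Type*} [NormedAddCommGroup V] [NormedSpace ℂ V] [FiniteDimensional ℂ V]

/-- The second derivative of `⟨s, t⟩` for constant `s`, `t`. -/
noncomputable def hermHess (G : V → V →L[ℝ] V →L[ℝ] ℝ) (w s t a b : V) : ℂ :=
  fderiv ℝ (fderiv ℝ (fun z => herm (G z) s t)) w a b

/-- The curvature `⟨R(a, b̄) s, t⟩` of a Kähler metric, complex linear in `s`, `a` and conjugate
linear in `t`, `b`. -/
noncomputable def curv (G : V → V →L[ℝ] V →L[ℝ] ℝ) (w s t a b : V) : ℂ :=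
  -(4⁻¹ * (hermHess G w s t a b + hermHess G w s t (Complex.I • a) (Complex.I • b) +
      Complex.I * (hermHess G w s t a (Complex.I • b) - hermHess G w s t (Complex.I • a) b))) +
    herm (G w) (christoffel G w a s) (christoffel G w b t)

variable {G : V → V →L[ℝ] V →L[ℝ] ℝ} {U : Set V} {w : V}

namespace IsLocalKaehler

variable (hG : IsLocalKaehler G U) (hw : w ∈ U)

include hG hw

theorem herm_contDiffAt : ContDiffAt ℝ ∞ (fun z => herm (G z)) w := by
  refine contDiffAt_bilin fun u v => ?_
  simp only [herm_apply]
  have h : ∀ u v : V, ContDiffAt ℝ ∞ (fun z => ((G z u v : ℝ) : ℂ)) w := fun u v =>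
    Complex.ofRealCLM.contDiff.contDiffAt.comp w
      (contDiffAt_bilin_apply (hG.contDiffAt hw) contDiffAt_const contDiffAt_const)
  exact ContDiffAt.const_smul _ ((h u v).add (contDiffAt_const.mul (h _ _)))

theorem herm_apply_contDiffAt (s t : V) : ContDiffAt ℝ ∞ (fun z => herm (G z) s t) w :=
  contDiffAt_bilin_apply (hG.herm_contDiffAt hw) contDiffAt_const contDiffAt_const

theorem fderiv_herm_differentiableAt (s t : V) :
    DifferentiableAt ℝ (fderiv ℝ (fun z => herm (G z) s t)) w :=
  ((hG.herm_apply_contDiffAt hw s t).fderiv_right (m := 1) (by norm_cast)).differentiableAt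
    one_ne_zero

theorem hermHess_symm (s t a b : V) : hermHess G w s t a b = hermHess G w s t b a :=
  (hG.herm_apply_contDiffAt hw s t).isSymmSndFDerivAt
    (by simpa using WithTop.coe_le_coe.2 (le_top : (2 : ℕ∞) ≤ ⊤)) a b

theorem hermHess_eq_fderiv (s t a b : V) : hermHess G w s t a b =
    fderiv ℝ (fun z => fderiv ℝ (fun z => herm (G z) s t) z b) w a := by
  have h := ((hG.fderiv_herm_differentiableAt hw s t).hasFDerivAt.clm_apply
    (hasFDerivAt_const b w)).fderiv
  rw [h]
  simp [hermHess]

theorem hermHess_I_left (s t a b : V) :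
    hermHess G w (Complex.I • s) t a b = Complex.I * hermHess G w s t a b := by
  rw [hG.hermHess_eq_fderiv hw, hG.hermHess_eq_fderiv hw]
  have h : (fun z => fderiv ℝ (fun z => herm (G z) (Complex.I • s) t) z b) =ᶠ[𝓝 w]
      fun z => Complex.I * fderiv ℝ (fun z => herm (G z) s t) z b := by
    refine hG.eventually hw fun z hz => ?_
    simp only [hG.hasFDerivAt_herm hz, hG.christoffel_I_right hz, hG.herm_I_left hz]
    ring
  rw [h.fderiv_eq, fderiv_const_mul
    ((hG.fderiv_herm_differentiableAt hw s t).clm_apply (differentiableAt_const b))]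
  simp

theorem hermHess_conj (s t a b : V) :
    (starRingEnd ℂ) (hermHess G w s t a b) = hermHess G w t s a b := by
  rw [hG.hermHess_eq_fderiv hw, hG.hermHess_eq_fderiv hw]
  have h : (fun z => fderiv ℝ (fun z => herm (G z) t s) z b) =ᶠ[𝓝 w]
      fun z => Complex.conjCLE (fderiv ℝ (fun z => herm (G z) s t) z b) := by
    refine hG.eventually hw fun z hz => ?_
    simp only [hG.hasFDerivAt_herm hz, Complex.conjCLE_apply, map_add, hG.herm_conj hz]
    ring
  rw [h.fderiv_eq]
  have := ((Complex.conjCLE : ℂ →L[ℝ] ℂ).hasFDerivAt.comp w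
    ((hG.fderiv_herm_differentiableAt hw s t).clm_apply
      (differentiableAt_const b)).hasFDerivAt).fderiv
  exact (congrArg (fun L : V →L[ℝ] ℂ => L a) this).symm

theorem hermHess_add_left (s s' t a b : V) :
    hermHess G w (s + s') t a b = hermHess G w s t a b + hermHess G w s' t a b := by
  simp only [hG.hermHess_eq_fderiv hw]
  have h : (fun z => fderiv ℝ (fun z => herm (G z) (s + s') t) z b) =ᶠ[𝓝 w]
      fun z => fderiv ℝ (fun z => herm (G z) s t) z b + fderiv ℝ (fun z => herm (G z) s' t) z b := by
    refine hG.eventually hw fun z hz => ?_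
    beta_reduce
    rw [hG.hasFDerivAt_herm hz, hG.hasFDerivAt_herm hz, hG.hasFDerivAt_herm hz]
    simp only [map_add, add_apply]
    ring
  rw [h.fderiv_eq, fderiv_fun_add
    ((hG.fderiv_herm_differentiableAt hw s t).clm_apply (differentiableAt_const b))
    ((hG.fderiv_herm_differentiableAt hw s' t).clm_apply (differentiableAt_const b))]
  rfl

theorem hermHess_smul_left (r : ℝ) (s t a b : V) :
    hermHess G w (r • s) t a b = r * hermHess G w s t a b := by
  simp only [hG.hermHess_eq_fderiv hw]
  have h : (fun z => fderiv ℝ (fun z => herm (G z) (r • s) t) z b) =ᶠ[𝓝 w]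
      fun z => (r : ℂ) * fderiv ℝ (fun z => herm (G z) s t) z b := by
    refine hG.eventually hw fun z hz => ?_
    beta_reduce
    rw [hG.hasFDerivAt_herm hz, hG.hasFDerivAt_herm hz]
    simp only [map_smul, smul_apply, Complex.real_smul]
    ring
  rw [h.fderiv_eq, fderiv_const_mul
    ((hG.fderiv_herm_differentiableAt hw s t).clm_apply (differentiableAt_const b))]
  simp

/-- Conjugation exchanges the first argument with the second and the third with the fourth.
Linearity in the unbarred arguments thus yields conjugate linearity in the barred ones without new
computation. -/
theorem curv_conj (s t a b : V) :
    (starRingEnd ℂ) (curv G w s t a b) = curv G w t s b a := by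
  simp only [curv, map_add, map_neg, map_mul, map_sub, hG.hermHess_conj hw, hG.herm_conj hw,
    Complex.conj_I, map_inv₀, map_ofNat]
  rw [hG.hermHess_symm hw t s a b, hG.hermHess_symm hw t s (Complex.I • a) (Complex.I • b),
    hG.hermHess_symm hw t s a (Complex.I • b), hG.hermHess_symm hw t s (Complex.I • a) b]
  ring

theorem curv_add_one (s s' t a b : V) :
    curv G w (s + s') t a b = curv G w s t a b + curv G w s' t a b := by
  simp only [curv, hG.hermHess_add_left hw, map_add, add_apply]
  ring

theorem curv_smul_one (r : ℝ) (s t a b : V) :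
    curv G w (r • s) t a b = r * curv G w s t a b := by
  simp only [curv, hG.hermHess_smul_left hw, map_smul, smul_apply, Complex.real_smul]
  ring

theorem curv_I_one (s t a b : V) :
    curv G w (Complex.I • s) t a b = Complex.I * curv G w s t a b := by
  simp only [curv, hG.hermHess_I_left hw, hG.christoffel_I_right hw, hG.herm_I_left hw]
  ring

theorem curv_add_three (s t a a' b : V) :
    curv G w s t (a + a') b = curv G w s t a b + curv G w s t a' b := by
  simp only [curv, hermHess, map_add, add_apply, smul_add]
  ring

theorem curv_smul_three (r : ℝ) (s t a b : V) :
    curv G w s t (r • a) b = r * curv G w s t a b := by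
  simp only [curv, hermHess, map_smul, smul_apply, smul_comm Complex.I r, Complex.real_smul]
  ring

theorem curv_I_three (s t a b : V) :
    curv G w s t (Complex.I • a) b = Complex.I * curv G w s t a b := by
  simp only [curv, hG.christoffel_I_left hw, hG.herm_I_left hw]
  simp only [hermHess, smul_smul, Complex.I_mul_I, neg_one_smul, map_neg, neg_apply]
  linear_combination (4⁻¹ : ℂ) * (fderiv ℝ (fderiv ℝ (fun z => herm (G z) s t)) w a (Complex.I • b)
    - fderiv ℝ (fderiv ℝ (fun z => herm (G z) s t)) w (Complex.I • a) b) * Complex.I_sq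

theorem curv_add_two (s t t' a b : V) :
    curv G w s (t + t') a b = curv G w s t a b + curv G w s t' a b := by
  rw [← hG.curv_conj hw, hG.curv_add_one hw, map_add, hG.curv_conj hw, hG.curv_conj hw]

theorem curv_smul_two (r : ℝ) (s t a b : V) :
    curv G w s (r • t) a b = r * curv G w s t a b := by
  rw [← hG.curv_conj hw, hG.curv_smul_one hw, map_mul, hG.curv_conj hw, Complex.conj_ofReal]

theorem curv_I_two (s t a b : V) :
    curv G w s (Complex.I • t) a b = -(Complex.I * curv G w s t a b) := by
  rw [← hG.curv_conj hw, hG.curv_I_one hw, map_mul, hG.curv_conj hw, Complex.conj_I]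
  ring

theorem curv_add_four (s t a b b' : V) :
    curv G w s t a (b + b') = curv G w s t a b + curv G w s t a b' := by
  rw [← hG.curv_conj hw, hG.curv_add_three hw, map_add, hG.curv_conj hw, hG.curv_conj hw]

theorem curv_smul_four (r : ℝ) (s t a b : V) :
    curv G w s t a (r • b) = r * curv G w s t a b := by
  rw [← hG.curv_conj hw, hG.curv_smul_three hw, map_mul, hG.curv_conj hw, Complex.conj_ofReal]

theorem curv_I_four (s t a b : V) :
    curv G w s t a (Complex.I • b) = -(Complex.I * curv G w s t a b) := by
  rw [← hG.curv_conj hw, hG.curv_I_three hw, map_mul, hG.curv_conj hw, Complex.conj_I]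
  ring

theorem christoffel_differentiableAt : DifferentiableAt ℝ (christoffel G) w :=
  (hG.christoffel_contDiffAt hw).differentiableAt (by simp)

/-- Differentiation of `⟨Γ(b, s), t⟩ = ∂_b ⟨s, t⟩`. -/
theorem herm_fderiv_christoffel (s t a b : V) :
    herm (G w) (fderiv ℝ (christoffel G) w a b s + christoffel G w a (christoffel G w b s)) t =
      2⁻¹ * (hermHess G w s t a b - Complex.I * hermHess G w s t a (Complex.I • b)) -
        herm (G w) (christoffel G w b s) (christoffel G w a t) := by
  have hd := fun b => (hG.fderiv_herm_differentiableAt hw s t).clm_apply (differentiableAt_const b)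
  -- In the derivative of ⟨s, t⟩ along `b`, the term ⟨s, Γ(b, t)⟩ is conjugate linear in `b`, so it
  -- drops out of the (1,0)-part.
  have e : (fun z => herm (G z) (christoffel G z b s) t) =ᶠ[𝓝 w] fun z => 2⁻¹ *
      (fderiv ℝ (fun z => herm (G z) s t) z b -
        Complex.I * fderiv ℝ (fun z => herm (G z) s t) z (Complex.I • b)) := by
    refine hG.eventually hw fun z hz => ?_
    simp only [hG.hasFDerivAt_herm hz, hG.christoffel_I_left hz, hG.herm_I_left hz,
      hG.herm_I_right hz]
    linear_combination (2⁻¹ : ℂ) * (herm (G z) (christoffel G z b s) t -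
      herm (G z) s (christoffel G z b t)) * Complex.I_sq
  have h1 : fderiv ℝ (fun z => herm (G z) (christoffel G z b s) t) w a =
      2⁻¹ * (hermHess G w s t a b - Complex.I * hermHess G w s t a (Complex.I • b)) := by
    rw [e.fderiv_eq, fderiv_const_mul ((hd b).fun_sub ((hd _).const_mul _)), smul_apply, smul_eq_mul,
      fderiv_fun_sub (hd b) ((hd _).const_mul _), fderiv_const_mul (hd _), sub_apply, smul_apply,
      smul_eq_mul, ← hG.hermHess_eq_fderiv hw, ← hG.hermHess_eq_fderiv hw]
  have hH := ((hG.herm_contDiffAt hw).differentiableAt (by simp)).hasFDerivAt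
  have hΓ : HasFDerivAt (fun z => christoffel G z b s)
      (fderiv ℝ (fun z => christoffel G z b s) w) w :=
    (((hG.christoffel_differentiableAt hw).clm_apply (differentiableAt_const b)).clm_apply
      (differentiableAt_const s)).hasFDerivAt
  have h2 := ((hH.clm_apply hΓ).clm_apply (hasFDerivAt_const t w)).fderiv
  have h3 := hG.hasFDerivAt_herm hw (christoffel G w b s) t a
  rw [fderiv_bilin_apply hH.differentiableAt] at h3
  rw [h2] at h1
  simp only [add_apply, ContinuousLinearMap.comp_apply, ContinuousLinearMap.flip_apply,
    fderiv_bilin_apply (hG.christoffel_differentiableAt hw), h3, zero_apply, map_zero] at h1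
  rw [map_add, add_apply, ← h1]
  ring

/-- The curvature of the connection `d + Γ`. -/
theorem herm_curvature (s t a b : V) :
    herm (G w) (fderiv ℝ (christoffel G) w a b s + christoffel G w a (christoffel G w b s) -
      (fderiv ℝ (christoffel G) w b a s + christoffel G w b (christoffel G w a s))) t =
      curv G w s t a b - curv G w s t b a := by
  rw [map_sub, sub_apply, hG.herm_fderiv_christoffel hw, hG.herm_fderiv_christoffel hw, curv, curv,
    hG.hermHess_symm hw s t b a, hG.hermHess_symm hw s t (Complex.I • b) (Complex.I • a),
    hG.hermHess_symm hw s t (Complex.I • b) a, hG.hermHess_symm hw s t b (Complex.I • a)]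
  ring

theorem fderiv_christoffel_symm (a b s : V) :
    fderiv ℝ (christoffel G) w a b s = fderiv ℝ (christoffel G) w a s b := by
  have hd := hG.christoffel_differentiableAt hw
  rw [← fderiv_bilin_apply hd, ← fderiv_bilin_apply hd]
  have : (fun z => christoffel G z b s) =ᶠ[𝓝 w] fun z => christoffel G z s b :=
    hG.eventually hw fun z hz => hG.christoffel_symm hz b s
  rw [this.fderiv_eq]

/-- `⟨R(a, b̄) s, t⟩ = - ⟨(∂_b̄ Γ)(a, s), t⟩`. -/
theorem curv_eq_fderiv_christoffel (s t a b : V) :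
    curv G w s t a b = - (2⁻¹ * (herm (G w) (fderiv ℝ (christoffel G) w b a s) t +
      Complex.I * herm (G w) (fderiv ℝ (christoffel G) w (Complex.I • b) a s) t)) := by
  have h1 := hG.herm_fderiv_christoffel hw s t b a
  have h2 := hG.herm_fderiv_christoffel hw s t (Complex.I • b) a
  rw [map_add, add_apply] at h1 h2
  rw [hG.christoffel_I_left hw, hG.christoffel_I_left hw, hG.herm_I_left hw, hG.herm_I_right hw]
    at h2
  rw [curv, hG.hermHess_symm hw s t a b, hG.hermHess_symm hw s t (Complex.I • a) (Complex.I • b),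
    hG.hermHess_symm hw s t (Complex.I • a) b, hG.hermHess_symm hw s t a (Complex.I • b)]
  linear_combination (2⁻¹ : ℂ) * h1 + (2⁻¹ : ℂ) * Complex.I * h2 +
    (-(2⁻¹ : ℂ) * herm (G w) (christoffel G w b (christoffel G w a s)) t
     + (2⁻¹ : ℂ) * herm (G w) (christoffel G w a s) (christoffel G w b t)
     - (4⁻¹ : ℂ) * hermHess G w s t (Complex.I • b) (Complex.I • a)) * Complex.I_sq

/-- By `curv_eq_fderiv_christoffel` the curvature depends on `s` and `a` only through a derivative
of `Γ(a, s)`, and `Γ` is symmetric. -/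
theorem curv_symm (s t a b : V) : curv G w s t a b = curv G w a t s b := by
  rw [hG.curv_eq_fderiv_christoffel hw, hG.curv_eq_fderiv_christoffel hw,
    hG.fderiv_christoffel_symm hw b, hG.fderiv_christoffel_symm hw (Complex.I • b)]

theorem curv_symm' (s t a b : V) : curv G w s t a b = curv G w s b a t := by
  rw [← hG.curv_conj hw, hG.curv_symm hw, hG.curv_conj hw]

theorem herm_self_pos {u : V} (hu : u ≠ 0) : herm (G w) u u ≠ 0 := by
  have h := hG.pos w hw u hu
  have h1 := hG.metric_I_right hw u u
  have h2 := hG.symm w hw (Complex.I • u) u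
  have h3 : G w u (Complex.I • u) = 0 := by linarith
  rw [herm_apply, h3]
  simp [h.ne']

variable {m : ℕ} (b : Module.Basis (Fin m) ℂ V)

theorem herm_smul_left (c : ℂ) (u v : V) :
    herm (G w) (c • u) v = c * herm (G w) u v := by
  have h : c • u = c.re • u + c.im • Complex.I • u := by
    conv_lhs => rw [← Complex.re_add_im c]
    rw [add_smul, mul_smul, Complex.coe_smul, Complex.coe_smul]
  rw [h, map_add, add_apply, map_smul, map_smul, smul_apply, smul_apply, hG.herm_I_left hw,
    Complex.real_smul, Complex.real_smul]
  conv_rhs => rw [← Complex.re_add_im c]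
  ring

theorem hermMatrix_isUnit : IsUnit (hermMatrix b G w).det := by
  rw [isUnit_iff_ne_zero]
  intro h0
  obtain ⟨x, hx, hx0⟩ := Matrix.exists_vecMul_eq_zero_iff.2 h0
  have h1 : ∀ c, herm (G w) (∑ a, x a • b a) (b c) = 0 := fun c => by
    have := congrFun hx0 c
    rw [map_sum, sum_apply]
    simpa [Matrix.vecMul, dotProduct, hermMatrix, hG.herm_smul_left hw] using this
  have h2 : herm (G w) (∑ a, x a • b a) (∑ a, x a • b a) = 0 := by
    rw [← hG.herm_conj hw, map_sum (herm (G w)), sum_apply, map_sum]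
    refine Finset.sum_eq_zero fun a _ => ?_
    rw [hG.herm_smul_left hw, ← hG.herm_conj hw, h1]
    simp
  have h3 : ∑ a, x a • b a = 0 := by
    by_contra h
    exact hG.herm_self_pos hw h h2
  exact hx (funext fun a => (Fintype.linearIndependent_iff.1 b.linearIndependent x h3) a)

/-- For fixed `p`, the sum over `q` recovers the coordinate `b.repr x p`. This makes the quadratic
term of `curvCoeff` independent of the basis. -/
theorem sum_hermMatrix_inv (x y : V) :
    ∑ p, ∑ q, (hermMatrix b G w)⁻¹ q p * herm (G w) x (b q) * herm (G w) (b p) y =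
      herm (G w) x y := by
  have hx := b.sum_repr x
  have h1 : ∀ q, herm (G w) x (b q) = ∑ r, b.repr x r * hermMatrix b G w r q := fun q => by
    conv_lhs => rw [← hx]
    rw [map_sum, sum_apply]
    simp only [hG.herm_smul_left hw]
    rfl
  have h2 : ∀ p, ∑ q, (hermMatrix b G w)⁻¹ q p * herm (G w) x (b q) = b.repr x p := fun p => by
    simp only [h1, Finset.mul_sum]
    rw [Finset.sum_comm]
    have : ∀ r, ∑ q, (hermMatrix b G w)⁻¹ q p * (b.repr x r * hermMatrix b G w r q) =
        b.repr x r * (hermMatrix b G w * (hermMatrix b G w)⁻¹) r p := fun r => by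
      rw [Matrix.mul_apply, Finset.mul_sum]
      exact Finset.sum_congr rfl fun q _ => by ring
    simp only [this, Matrix.mul_nonsing_inv _ (hG.hermMatrix_isUnit hw b)]
    simp [Matrix.one_apply]
  simp only [← Finset.sum_mul, h2]
  conv_rhs => rw [← hx]
  rw [map_sum, sum_apply]
  simp only [hG.herm_smul_left hw]

/-- The first derivatives of the Hermitian matrix in `curvCoeff` are the pairings ⟨Γ(b i, b k), b q⟩
and ⟨b p, Γ(b j, b l)⟩, so contracting with the inverse matrix leaves a pairing of two Christoffel
symbols. -/
theorem curvCoeff_eq (i j k l : Fin m) :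
    curvCoeff b G w i j k l = curv G w (b i) (b j) (b k) (b l) := by
  have h1 : ∀ k q : Fin m, dHol b i (fun w => hermMatrix b G w k q) w =
      herm (G w) (christoffel G w (b i) (b k)) (b q) := fun k q => by
    simp only [dHol, hermMatrix, hG.hasFDerivAt_herm hw, hG.christoffel_I_left hw,
      hG.herm_I_left hw, hG.herm_I_right hw]
    linear_combination -(2⁻¹ : ℂ) * (herm (G w) (christoffel G w (b i) (b k)) (b q) -
      herm (G w) (b k) (christoffel G w (b i) (b q))) * Complex.I_sq
  have h2 : ∀ p l : Fin m, dAnti b j (fun w => hermMatrix b G w p l) w =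
      herm (G w) (b p) (christoffel G w (b j) (b l)) := fun p l => by
    simp only [dAnti, hermMatrix, hG.hasFDerivAt_herm hw, hG.christoffel_I_left hw,
      hG.herm_I_left hw, hG.herm_I_right hw]
    linear_combination (2⁻¹ : ℂ) * (herm (G w) (christoffel G w (b j) (b p)) (b l) -
      herm (G w) (b p) (christoffel G w (b j) (b l))) * Complex.I_sq
  have h3 : dHol b k (dAnti b l fun w => hermMatrix b G w i j) w =
      4⁻¹ * (hermHess G w (b i) (b j) (b k) (b l) +
        hermHess G w (b i) (b j) (Complex.I • b k) (Complex.I • b l) +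
        Complex.I * (hermHess G w (b i) (b j) (b k) (Complex.I • b l) -
          hermHess G w (b i) (b j) (Complex.I • b k) (b l))) := by
    have hd := fun a => (hG.fderiv_herm_differentiableAt hw (b i) (b j)).clm_apply
      (differentiableAt_const a)
    have h4 : ∀ a, fderiv ℝ (dAnti b l fun w => hermMatrix b G w i j) w a =
        2⁻¹ * (hermHess G w (b i) (b j) a (b l) +
          Complex.I * hermHess G w (b i) (b j) a (Complex.I • b l)) := fun a => by
      change fderiv ℝ (fun z => 2⁻¹ * (fderiv ℝ (fun z => herm (G z) (b i) (b j)) z (b l) +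
        Complex.I * fderiv ℝ (fun z => herm (G z) (b i) (b j)) z (Complex.I • b l))) w a = _
      rw [fderiv_const_mul ((hd _).fun_add ((hd _).const_mul _)), smul_apply, smul_eq_mul,
        fderiv_fun_add (hd _) ((hd _).const_mul _), fderiv_const_mul (hd _), add_apply, smul_apply,
        smul_eq_mul, ← hG.hermHess_eq_fderiv hw, ← hG.hermHess_eq_fderiv hw]
    rw [dHol, h4, h4]
    linear_combination -(4⁻¹ : ℂ) * hermHess G w (b i) (b j) (Complex.I • b k) (Complex.I • b l) *
      Complex.I_sq
  rw [curvCoeff, h3, curv]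
  simp only [h1, h2]
  rw [hG.sum_hermMatrix_inv hw b, hG.christoffel_symm hw (b k) (b i),
    hG.christoffel_symm hw (b l) (b j)]

end IsLocalKaehler

end Curvature

/-! ### Alternating sums in at most four arguments, written out. -/

section AltSumExplicit

variable {V G : Type*} [AddCommGroup G] {k : ℕ}

theorem altSum_cons (T : (Fin (k + 1) → V) → G) (v : Fin (k + 1) → V) :
    altSum T v = ∑ i : Fin (k + 1), (-1 : ℤ) ^ (i : ℕ) •
      altSum (fun t => T (Matrix.vecCons (v i) t)) (v ∘ i.succAbove) := by
  rw [← altSum_succ (fun u t => T (Matrix.vecCons u t))]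
  congr 1
  funext w
  congr 1
  exact (Fin.cons_self_tail w).symm

theorem altSum_zero (T : (Fin 0 → V) → G) (v : Fin 0 → V) : altSum T v = T ![] := by
  simp [altSum, Matrix.empty_eq]

theorem altSum_one (T : (Fin 1 → V) → G) (a : V) : altSum T ![a] = T ![a] := by
  rw [altSum_cons]
  simp [altSum_zero]

theorem altSum_two (T : (Fin 2 → V) → G) (a b : V) :
    altSum T ![a, b] = T ![a, b] - T ![b, a] := by
  rw [altSum_cons]
  have r0 : ![a, b] ∘ Fin.succAbove 0 = ![b] := by ext i; fin_cases i; rfl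
  have r1 : ![a, b] ∘ Fin.succAbove 1 = ![a] := by ext i; fin_cases i; rfl
  rw [Fin.sum_univ_two, r0, r1, altSum_one, altSum_one]
  simp
  abel

theorem altSum_three (T : (Fin 3 → V) → G) (a b c : V) :
    altSum T ![a, b, c] = T ![a, b, c] - T ![a, c, b] - (T ![b, a, c] - T ![b, c, a]) +
      (T ![c, a, b] - T ![c, b, a]) := by
  rw [altSum_cons]
  have r0 : ![a, b, c] ∘ Fin.succAbove 0 = ![b, c] := by ext i; fin_cases i <;> rfl
  have r1 : ![a, b, c] ∘ Fin.succAbove 1 = ![a, c] := by ext i; fin_cases i <;> rfl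
  have r2 : ![a, b, c] ∘ Fin.succAbove 2 = ![a, b] := by ext i; fin_cases i <;> rfl
  rw [Fin.sum_univ_three, r0, r1, r2, altSum_two, altSum_two, altSum_two]
  simp
  abel

theorem altSum_four (T : (Fin 4 → V) → G) (a b c d : V) :
    altSum T ![a, b, c, d] =
      altSum (fun t => T (Matrix.vecCons a t)) ![b, c, d] -
      altSum (fun t => T (Matrix.vecCons b t)) ![a, c, d] +
      altSum (fun t => T (Matrix.vecCons c t)) ![a, b, d] -
      altSum (fun t => T (Matrix.vecCons d t)) ![a, b, c] := by
  rw [altSum_cons]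
  have r0 : ![a, b, c, d] ∘ Fin.succAbove 0 = ![b, c, d] := by ext i; fin_cases i <;> rfl
  have r1 : ![a, b, c, d] ∘ Fin.succAbove 1 = ![a, c, d] := by ext i; fin_cases i <;> rfl
  have r2 : ![a, b, c, d] ∘ Fin.succAbove 2 = ![a, b, d] := by ext i; fin_cases i <;> rfl
  have r3 : ![a, b, c, d] ∘ Fin.succAbove 3 = ![a, b, c] := by ext i; fin_cases i <;> rfl
  rw [Fin.sum_univ_four, r0, r1, r2, r3]
  simp
  abel

end AltSumExplicit

/-! ### The wedge product of a 2-form and a 1-form, written out. -/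

section Bracket

variable {V G₁ G₂ G₃ : Type*}
  [NormedAddCommGroup V] [NormedSpace ℝ V] [NormedAddCommGroup G₁] [NormedSpace ℝ G₁]
  [NormedAddCommGroup G₂] [NormedSpace ℝ G₂] [NormedAddCommGroup G₃] [NormedSpace ℝ G₃]

theorem alternating_two_swap (α : V [⋀^Fin 2]→L[ℝ] G₁) (a b : V) : α ![b, a] = - α ![a, b] := by
  have h := α.toAlternatingMap.map_swap ![a, b] (i := 0) (j := 1) (by decide)
  have e : ![a, b] ∘ Equiv.swap (0 : Fin 2) 1 = ![b, a] := by ext i; fin_cases i <;> rfl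
  rw [e] at h
  exact h

theorem wedge_two_one (B : G₁ →L[ℝ] G₂ →L[ℝ] G₃) (α : V [⋀^Fin 2]→L[ℝ] G₁)
    (β : V [⋀^Fin 1]→L[ℝ] G₂) (a b c : V) :
    wedge B α β ![a, b, c] = B (α ![a, b]) (β ![c]) + B (α ![b, c]) (β ![a]) +
      B (α ![c, a]) (β ![b]) := by
  have h : ∀ x y z : V, B (α (![x, y, z] ∘ Fin.castAdd 1)) (β (![x, y, z] ∘ Fin.natAdd 2)) =
      B (α ![x, y]) (β ![z]) := fun x y z => by
    congr 2
    · congr 1; ext i; fin_cases i <;> rfl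
    · ext i; fin_cases i; rfl
  rw [wedge_apply']
  erw [altSum_three]
  rw [h, h, h, h, h, h, alternating_two_swap α a b, alternating_two_swap α c a,
    alternating_two_swap α b c]
  simp only [map_neg, neg_apply, Nat.factorial_two, Nat.factorial_one]
  norm_num
  rw [← sub_eq_zero]
  module

end Bracket

/-! ### The exterior derivative of the bracket in coordinates. -/

section Local

set_option linter.unusedSectionVars false
set_option maxSynthPendingDepth 3

variable {E F : Type*} [NormedAddCommGroup E] [NormedSpace ℂ E] [FiniteDimensional ℂ E]
  [NormedAddCommGroup F] [NormedSpace ℂ F] [FiniteDimensional ℂ F]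

theorem holPart_apply (L : E →L[ℝ] F) (v : E) :
    holPart L v = (2 : ℝ)⁻¹ • (L v - Complex.I • L (Complex.I • v)) := rfl

theorem antiPart_apply (L : E →L[ℝ] F) (v : E) :
    antiPart L v = (2 : ℝ)⁻¹ • (L v + Complex.I • L (Complex.I • v)) := rfl

theorem holPart_I (L : E →L[ℝ] F) (v : E) :
    holPart L (Complex.I • v) = Complex.I • holPart L v := by
  simp only [holPart_apply, smul_sub, smul_comm Complex.I (2 : ℝ)⁻¹, smul_smul, Complex.I_mul_I,
    neg_one_smul, map_neg, smul_neg]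
  abel

theorem antiPart_I (L : E →L[ℝ] F) (v : E) :
    antiPart L (Complex.I • v) = -(Complex.I • antiPart L v) := by
  simp only [antiPart_apply, smul_add, smul_comm Complex.I (2 : ℝ)⁻¹, smul_smul, Complex.I_mul_I,
    neg_one_smul, map_neg, smul_neg]
  abel

theorem holPart_add_antiPart (L : E →L[ℝ] F) (v : E) : holPart L v + antiPart L v = L v := by
  rw [holPart_apply, antiPart_apply]
  module

theorem antiPart_sub_holPart (L : E →L[ℝ] F) (v : E) :
    antiPart L v - holPart L v = L v - (2 : ℝ) • holPart L v := by
  rw [holPart_apply, antiPart_apply]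
  module

/-- The covariant exterior derivative of `∂f` in local coordinates. -/
noncomputable def localCurl (G : F → F →L[ℝ] F →L[ℝ] ℝ) (f : E → F) (z v w : E) : F :=
  fderiv ℝ (fun y => holPart (fderiv ℝ f y) w) z v -
    fderiv ℝ (fun y => holPart (fderiv ℝ f y) v) z w +
    (christoffel G (f z) (fderiv ℝ f z v) (holPart (fderiv ℝ f z) w) -
      christoffel G (f z) (fderiv ℝ f z w) (holPart (fderiv ℝ f z) v))

/-- The curvature endomorphism of the connection `d + Γ`. -/
noncomputable def curvEnd (G : F → F →L[ℝ] F →L[ℝ] ℝ) (w a b s : F) : F :=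
  fderiv ℝ (christoffel G) w a b s + christoffel G w a (christoffel G w b s) -
    (fderiv ℝ (christoffel G) w b a s + christoffel G w b (christoffel G w a s))

variable {G : F → F →L[ℝ] F →L[ℝ] ℝ} {U : Set F} {f : E → F} {z₀ : E}

theorem contDiffAt_fderiv_apply (hf : ContDiffAt ℝ ∞ f z₀) (v : E) :
    ContDiffAt ℝ ∞ (fun y => fderiv ℝ f y v) z₀ :=
  (hf.fderiv_right (by simp)).clm_apply contDiffAt_const

theorem contDiffAt_holPart (hf : ContDiffAt ℝ ∞ f z₀) (v : E) :
    ContDiffAt ℝ ∞ (fun y => holPart (fderiv ℝ f y) v) z₀ := by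
  simp only [holPart_apply]
  exact ((contDiffAt_fderiv_apply hf v).sub
    ((contDiffAt_fderiv_apply hf (Complex.I • v)).const_smul Complex.I)).const_smul (2 : ℝ)⁻¹

theorem fderiv_fderiv_symm (hf : ContDiffAt ℝ ∞ f z₀) (u v : E) :
    fderiv ℝ (fun y => fderiv ℝ f y v) z₀ u = fderiv ℝ (fun y => fderiv ℝ f y u) z₀ v := by
  have hd : DifferentiableAt ℝ (fderiv ℝ f) z₀ :=
    (hf.fderiv_right (m := ∞) (by simp)).differentiableAt (by simp)
  have h : ∀ v, fderiv ℝ (fun y => fderiv ℝ f y v) z₀ = (fderiv ℝ (fderiv ℝ f) z₀).flip v :=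
    fun v => by
      rw [(hd.hasFDerivAt.clm_apply (hasFDerivAt_const v z₀)).fderiv]
      ext u
      simp
  rw [h, h]
  exact hf.isSymmSndFDerivAt (by simpa using WithTop.coe_le_coe.2 (le_top : (2 : ℕ∞) ≤ ⊤)) u v

theorem contDiffAt_localCurl (hG : IsLocalKaehler G U) (hf : ContDiffAt ℝ ∞ f z₀) (hU : f z₀ ∈ U)
    (v w : E) : ContDiffAt ℝ ∞ (fun z => localCurl G f z v w) z₀ := by
  have hΓ : ContDiffAt ℝ ∞ (fun z => christoffel G (f z)) z₀ :=
    (hG.christoffel_contDiffAt hU).comp z₀ hf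
  refine ((contDiffAt_fderiv_apply (contDiffAt_holPart hf w) v).sub
    (contDiffAt_fderiv_apply (contDiffAt_holPart hf v) w)).add ?_
  exact (contDiffAt_bilin_apply hΓ (contDiffAt_fderiv_apply hf v) (contDiffAt_holPart hf w)).sub
    (contDiffAt_bilin_apply hΓ (contDiffAt_fderiv_apply hf w) (contDiffAt_holPart hf v))

/-- The metric is parallel. -/
theorem fderiv_herm_comp (hG : IsLocalKaehler G U) (hf : DifferentiableAt ℝ f z₀) (hU : f z₀ ∈ U)
    {s t : E → F} (hs : DifferentiableAt ℝ s z₀) (ht : DifferentiableAt ℝ t z₀) (u : E) :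
    fderiv ℝ (fun z => herm (G (f z)) (s z) (t z)) z₀ u =
      herm (G (f z₀)) (fderiv ℝ s z₀ u + christoffel G (f z₀) (fderiv ℝ f z₀ u) (s z₀)) (t z₀) +
      herm (G (f z₀)) (s z₀) (fderiv ℝ t z₀ u + christoffel G (f z₀) (fderiv ℝ f z₀ u) (t z₀)) := by
  have hH := (hG.herm_contDiffAt hU).differentiableAt (by simp)
  have h1 := ((hH.hasFDerivAt.comp z₀ hf.hasFDerivAt).clm_apply hs.hasFDerivAt).clm_apply
    ht.hasFDerivAt
  have h3 := hG.hasFDerivAt_herm hU (s z₀) (t z₀) (fderiv ℝ f z₀ u)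
  rw [fderiv_bilin_apply hH] at h3
  have h4 := congrArg (fun L : E →L[ℝ] ℂ => L u) h1.fderiv
  refine h4.trans ?_
  simp only [add_apply, ContinuousLinearMap.comp_apply, ContinuousLinearMap.flip_apply, map_add,
    Function.comp_apply, h3]
  ring

theorem fderiv_christoffel_comp (hG : IsLocalKaehler G U) (hf : DifferentiableAt ℝ f z₀)
    (hU : f z₀ ∈ U) {s t : E → F} (hs : DifferentiableAt ℝ s z₀) (ht : DifferentiableAt ℝ t z₀)
    (u : E) : fderiv ℝ (fun z => christoffel G (f z) (s z) (t z)) z₀ u =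
      fderiv ℝ (christoffel G) (f z₀) (fderiv ℝ f z₀ u) (s z₀) (t z₀) +
      christoffel G (f z₀) (fderiv ℝ s z₀ u) (t z₀) +
      christoffel G (f z₀) (s z₀) (fderiv ℝ t z₀ u) := by
  have hH := hG.christoffel_differentiableAt hU
  have h1 := ((hH.hasFDerivAt.comp z₀ hf.hasFDerivAt).clm_apply hs.hasFDerivAt).clm_apply
    ht.hasFDerivAt
  have h4 := congrArg (fun L : E →L[ℝ] F => L u) h1.fderiv
  refine h4.trans ?_
  simp only [add_apply, ContinuousLinearMap.comp_apply, ContinuousLinearMap.flip_apply,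
    Function.comp_apply]
  abel

/-- The second covariant exterior derivative of `∂f` is given by the curvature. -/
theorem localCurl_cyclic (hG : IsLocalKaehler G U) (hf : ContDiffAt ℝ ∞ f z₀) (hU : f z₀ ∈ U)
    (T : E → E → E → F) (hT : ∀ u v w, T u v w = fderiv ℝ (fun z => localCurl G f z v w) z₀ u +
      christoffel G (f z₀) (fderiv ℝ f z₀ u) (localCurl G f z₀ v w)) (u v w : E) :
    T u v w + T v w u + T w u v =
      curvEnd G (f z₀) (fderiv ℝ f z₀ u) (fderiv ℝ f z₀ v) (holPart (fderiv ℝ f z₀) w) +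
      curvEnd G (f z₀) (fderiv ℝ f z₀ v) (fderiv ℝ f z₀ w) (holPart (fderiv ℝ f z₀) u) +
      curvEnd G (f z₀) (fderiv ℝ f z₀ w) (fderiv ℝ f z₀ u) (holPart (fderiv ℝ f z₀) v) := by
  have hfd := hf.differentiableAt (n := ∞) (by simp)
  have hD : ∀ v, DifferentiableAt ℝ (fun y => fderiv ℝ f y v) z₀ := fun v =>
    (contDiffAt_fderiv_apply hf v).differentiableAt (by simp)
  have hP : ∀ v, DifferentiableAt ℝ (fun y => holPart (fderiv ℝ f y) v) z₀ := fun v =>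
    (contDiffAt_holPart hf v).differentiableAt (by simp)
  have hPP : ∀ v w, DifferentiableAt ℝ
      (fun z => fderiv ℝ (fun y => holPart (fderiv ℝ f y) w) z v) z₀ := fun v w =>
    (contDiffAt_fderiv_apply (contDiffAt_holPart hf w) v).differentiableAt (by simp)
  have hΓ : ∀ v w, DifferentiableAt ℝ (fun z => christoffel G (f z) (fderiv ℝ f z v)
      (holPart (fderiv ℝ f z) w)) z₀ := fun v w =>
    (contDiffAt_bilin_apply ((hG.christoffel_contDiffAt hU).comp z₀ hf)
      (contDiffAt_fderiv_apply hf v) (contDiffAt_holPart hf w)).differentiableAt (by simp)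
  have key : ∀ u v w, fderiv ℝ (fun z => localCurl G f z v w) z₀ u =
      fderiv ℝ (fun z => fderiv ℝ (fun y => holPart (fderiv ℝ f y) w) z v) z₀ u -
      fderiv ℝ (fun z => fderiv ℝ (fun y => holPart (fderiv ℝ f y) v) z w) z₀ u +
      ((fderiv ℝ (christoffel G) (f z₀) (fderiv ℝ f z₀ u) (fderiv ℝ f z₀ v)
          (holPart (fderiv ℝ f z₀) w) +
        christoffel G (f z₀) (fderiv ℝ (fun y => fderiv ℝ f y v) z₀ u)
          (holPart (fderiv ℝ f z₀) w) +
        christoffel G (f z₀) (fderiv ℝ f z₀ v)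
          (fderiv ℝ (fun y => holPart (fderiv ℝ f y) w) z₀ u)) -
       (fderiv ℝ (christoffel G) (f z₀) (fderiv ℝ f z₀ u) (fderiv ℝ f z₀ w)
          (holPart (fderiv ℝ f z₀) v) +
        christoffel G (f z₀) (fderiv ℝ (fun y => fderiv ℝ f y w) z₀ u)
          (holPart (fderiv ℝ f z₀) v) +
        christoffel G (f z₀) (fderiv ℝ f z₀ w)
          (fderiv ℝ (fun y => holPart (fderiv ℝ f y) v) z₀ u))) := fun u v w => by
    rw [← fderiv_christoffel_comp hG hfd hU (hD v) (hP w),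
      ← fderiv_christoffel_comp hG hfd hU (hD w) (hP v)]
    have := (((hPP v w).hasFDerivAt.sub (hPP w v).hasFDerivAt).add
      ((hΓ v w).hasFDerivAt.sub (hΓ w v).hasFDerivAt)).fderiv
    exact congrArg (fun L : E →L[ℝ] F => L u) this
  -- In the cyclic sum the iterated derivatives of ∂f cancel by symmetry, and so do the terms in
  -- which `Γ` is applied to the second derivative of `f`. Only the curvature of `d + Γ` is left.
  have hsym := fun w u v => fderiv_fderiv_symm (contDiffAt_holPart hf w) u v
  rw [hT, hT, hT, key, key, key]
  simp only [localCurl, curvEnd, map_add, map_sub]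
  rw [hsym w u v, hsym u v w, hsym v w u, fderiv_fderiv_symm hf u v, fderiv_fderiv_symm hf v w,
    fderiv_fderiv_symm hf w u]
  abel

theorem curvEnd_add (w a b s t : F) :
    curvEnd G w a b (s + t) = curvEnd G w a b s + curvEnd G w a b t := by
  simp only [curvEnd, map_add]
  abel

/-- The first Bianchi identity. -/
theorem curvEnd_cyclic {w : F} (hG : IsLocalKaehler G U) (hw : w ∈ U) (a b c : F) :
    curvEnd G w a b c + curvEnd G w b c a + curvEnd G w c a b = 0 := by
  simp only [curvEnd]
  rw [hG.fderiv_christoffel_symm hw a b c, hG.fderiv_christoffel_symm hw b c a,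
    hG.fderiv_christoffel_symm hw c a b, hG.christoffel_symm hw b c, hG.christoffel_symm hw c a,
    hG.christoffel_symm hw a b]
  abel

/-- The exterior derivative of `⟨∂̄∂f, ∂̄f - ∂f⟩`. -/
theorem extDeriv_bracket (hG : IsLocalKaehler G U) (hf : ContDiffAt ℝ ∞ f z₀) (hU : f z₀ ∈ U)
    {β : E → E [⋀^Fin 3]→L[ℝ] ℂ} (ξ : E → E → F)
    (hξ : ∀ z v, ξ z v = antiPart (fderiv ℝ f z) v - holPart (fderiv ℝ f z) v)
    (hβ : ∀ᶠ z in 𝓝 z₀, ∀ a b c, β z ![a, b, c] =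
      herm (G (f z)) (localCurl G f z a b) (ξ z c) + herm (G (f z)) (localCurl G f z b c) (ξ z a) +
      herm (G (f z)) (localCurl G f z c a) (ξ z b))
    (S : E → E → E → F) (hS : ∀ u v w, S u v w =
      curvEnd G (f z₀) (fderiv ℝ f z₀ u) (fderiv ℝ f z₀ v) (holPart (fderiv ℝ f z₀) w) +
      curvEnd G (f z₀) (fderiv ℝ f z₀ v) (fderiv ℝ f z₀ w) (holPart (fderiv ℝ f z₀) u) +
      curvEnd G (f z₀) (fderiv ℝ f z₀ w) (fderiv ℝ f z₀ u) (holPart (fderiv ℝ f z₀) v))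
    (H : F →L[ℝ] F →L[ℝ] ℂ) (hH : H = herm (G (f z₀)))
    (σ : E → E → F) (hσ : σ = localCurl G f z₀) (a b c d : E) :
    DifferentiableAt ℝ β z₀ ∧
    extDeriv β z₀ ![a, b, c, d] =
      H (S a b c) (ξ z₀ d) - H (S a b d) (ξ z₀ c) + H (S a c d) (ξ z₀ b) - H (S b c d) (ξ z₀ a)
      - 2 * (H (σ a b) (σ c d) - H (σ a c) (σ b d) + H (σ a d) (σ b c) + H (σ b c) (σ a d)
        - H (σ b d) (σ a c) + H (σ c d) (σ a b)) := by
  subst hH hσ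
  have hfd := hf.differentiableAt (n := ∞) (by simp)
  have hξ' : ∀ v, (fun z => ξ z v) =
      fun z => fderiv ℝ f z v - (2 : ℝ) • holPart (fderiv ℝ f z) v := fun v => by
    funext z
    rw [hξ, antiPart_sub_holPart]
  have hξd : ∀ v, ContDiffAt ℝ ∞ (fun z => ξ z v) z₀ := fun v => by
    rw [hξ']
    exact (contDiffAt_fderiv_apply hf v).sub ((contDiffAt_holPart hf v).const_smul (2 : ℝ))
  have hσd := contDiffAt_localCurl hG hf hU
  have hHd : ∀ x y t, ContDiffAt ℝ ∞
      (fun z => herm (G (f z)) (localCurl G f z x y) (ξ z t)) z₀ := fun x y t =>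
    contDiffAt_bilin_apply ((hG.herm_contDiffAt hU).comp z₀ hf) (hσd x y) (hξd t)
  have hβ' : ∀ x y t, (fun z => β z ![x, y, t]) =ᶠ[𝓝 z₀] fun z =>
      herm (G (f z)) (localCurl G f z x y) (ξ z t) + herm (G (f z)) (localCurl G f z y t) (ξ z x) +
      herm (G (f z)) (localCurl G f z t x) (ξ z y) := fun x y t => hβ.mono fun z hz => hz x y t
  have hβd : DifferentiableAt ℝ β z₀ := by
    refine (contDiffAt_alternating (n := ∞) fun x => ?_).differentiableAt (by simp)
    have hx : x = ![x 0, x 1, x 2] := by ext i; fin_cases i <;> rfl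
    rw [hx]
    exact (((hHd _ _ _).add (hHd _ _ _)).add (hHd _ _ _)).congr_of_eventuallyEq (hβ' _ _ _)
  refine ⟨hβd, ?_⟩
  set H := herm (G (f z₀)) with hHdef
  set σ := localCurl G f z₀ with hσdef
  -- `T` and `N` are the covariant derivatives of σ and of ξ. Since the Hermitian metric is
  -- parallel, the derivative of the 3-form involves nothing else.
  let T : E → E → E → F := fun u v w => fderiv ℝ (fun z => localCurl G f z v w) z₀ u +
      christoffel G (f z₀) (fderiv ℝ f z₀ u) (localCurl G f z₀ v w)
  let N : E → E → F := fun u v => fderiv ℝ (fun z => ξ z v) z₀ u +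
      christoffel G (f z₀) (fderiv ℝ f z₀ u) (ξ z₀ v)
  have hd : ∀ {s : E → F}, ContDiffAt ℝ ∞ s z₀ → DifferentiableAt ℝ s z₀ := fun h =>
    h.differentiableAt (by simp)
  have hdc : ∀ {s : E → ℂ}, ContDiffAt ℝ ∞ s z₀ → DifferentiableAt ℝ s z₀ := fun h =>
    h.differentiableAt (by simp)
  have key : ∀ u x y t, fderiv ℝ (fun z => β z ![x, y, t]) z₀ u =
      (H (T u x y) (ξ z₀ t) + H (σ x y) (N u t)) + (H (T u y t) (ξ z₀ x) + H (σ y t) (N u x)) +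
      (H (T u t x) (ξ z₀ y) + H (σ t x) (N u y)) := fun u x y t => by
    rw [(hβ' x y t).fderiv_eq, fderiv_fun_add ((hdc (hHd _ _ _)).fun_add (hdc (hHd _ _ _)))
      (hdc (hHd _ _ _)), fderiv_fun_add (hdc (hHd _ _ _)) (hdc (hHd _ _ _)), add_apply, add_apply,
      fderiv_herm_comp hG hfd hU (hd (hσd _ _)) (hd (hξd _)),
      fderiv_herm_comp hG hfd hU (hd (hσd _ _)) (hd (hξd _)),
      fderiv_herm_comp hG hfd hU (hd (hσd _ _)) (hd (hξd _))]
  have hσs : ∀ z x y, localCurl G f z y x = - localCurl G f z x y := fun z x y => by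
    simp only [localCurl]
    abel
  have hσs' : ∀ x y, σ y x = - σ x y := hσs z₀
  have hTs : ∀ u x y, T u y x = - T u x y := fun u x y => by
    have h1 : (fun z => localCurl G f z y x) = fun z => - localCurl G f z x y := by
      funext z
      exact hσs z x y
    simp only [T]
    rw [h1, fderiv_fun_neg, hσs z₀ x y, map_neg, neg_apply, neg_add]
  -- This is d_∇ξ = -2σ: ξ is df - 2∂f, and the df part of `N` is symmetric because the connection
  -- is torsion free.
  have hN : ∀ u v, N v u = N u v + (2 : ℝ) • σ u v := fun u v => by
    have h1 : ∀ u v, fderiv ℝ (fun z => ξ z v) z₀ u = fderiv ℝ (fun z => fderiv ℝ f z v) z₀ u -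
        (2 : ℝ) • fderiv ℝ (fun z => holPart (fderiv ℝ f z) v) z₀ u := fun u v => by
      have h2 := hd (contDiffAt_fderiv_apply hf v)
      have h3 := hd (contDiffAt_holPart hf v)
      rw [hξ' v, fderiv_fun_sub h2 (h3.fun_const_smul (2 : ℝ)), fderiv_fun_const_smul h3]
      rfl
    have h4 : ∀ v, ξ z₀ v = fderiv ℝ f z₀ v - (2 : ℝ) • holPart (fderiv ℝ f z₀) v := fun v =>
      congrFun (hξ' v) z₀
    simp only [N, h1, h4, map_sub, map_smul, hσdef, localCurl]
    rw [fderiv_fderiv_symm hf v u, hG.christoffel_symm hU (fderiv ℝ f z₀ v) (fderiv ℝ f z₀ u)]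
    module
  have hS' : ∀ u v w, S u v w = T u v w + T v w u + T w u v := fun u v w => by
    rw [hS, localCurl_cyclic hG hf hU T fun _ _ _ => rfl]
  rw [extDeriv_apply hβd]
  have r0 : Fin.removeNth 0 ![a, b, c, d] = ![b, c, d] := by ext i; fin_cases i <;> rfl
  have r1 : Fin.removeNth 1 ![a, b, c, d] = ![a, c, d] := by ext i; fin_cases i <;> rfl
  have r2 : Fin.removeNth 2 ![a, b, c, d] = ![a, b, d] := by ext i; fin_cases i <;> rfl
  have r3 : Fin.removeNth 3 ![a, b, c, d] = ![a, b, c] := by ext i; fin_cases i <;> rfl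
  have h5 : ∑ i : Fin (3 + 1), (-1 : ℤ) ^ (i : ℕ) •
      fderiv ℝ (fun x => β x (i.removeNth ![a, b, c, d])) z₀ (![a, b, c, d] i) =
      fderiv ℝ (fun z => β z ![b, c, d]) z₀ a - fderiv ℝ (fun z => β z ![a, c, d]) z₀ b +
      fderiv ℝ (fun z => β z ![a, b, d]) z₀ c - fderiv ℝ (fun z => β z ![a, b, c]) z₀ d := by
    rw [← r0, ← r1, ← r2, ← r3]
    erw [Fin.sum_univ_four]
    simp
    ring
  refine h5.trans ?_
  rw [key, key, key, key, hS', hS', hS', hS']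
  rw [hN a b, hN a c, hN a d, hN b c, hN b d, hN c d, hTs a b d, hTs b a d, hTs c a d,
    hTs d a c, hTs b a c, hTs c b d, hσs' b d, hσs' a d, hσs' a c]
  simp only [map_add, map_neg, map_smul, neg_apply, add_apply, Complex.real_smul]
  push_cast
  ring

end Local

/-! ### The curvature term on a pair of complex lines. -/

section CurvatureTerm

set_option linter.unusedSectionVars false

variable {F : Type*} [NormedAddCommGroup F] [NormedSpace ℂ F] [FiniteDimensional ℂ F]
variable {G : F → F →L[ℝ] F →L[ℝ] ℝ} {U : Set F} {w : F}

/-- The pairing of `R ∧ P = - R ∧ Q` with `Q - P`. -/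
theorem herm_curvEnd_cyclic (hG : IsLocalKaehler G U) (hw : w ∈ U) (p q : Fin 4 → F)
    (a b c d : Fin 4) :
    herm (G w) (curvEnd G w (p a + q a) (p b + q b) (p c) +
      curvEnd G w (p b + q b) (p c + q c) (p a) + curvEnd G w (p c + q c) (p a + q a) (p b))
      (q d - p d) =
    ((curv G w (p c) (q d) (p a + q a) (p b + q b) - curv G w (p c) (q d) (p b + q b) (p a + q a)) +
     (curv G w (p a) (q d) (p b + q b) (p c + q c) - curv G w (p a) (q d) (p c + q c) (p b + q b)) +
     (curv G w (p b) (q d) (p c + q c) (p a + q a) - curv G w (p b) (q d) (p a + q a) (p c + q c))) +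
    ((curv G w (q c) (p d) (p a + q a) (p b + q b) - curv G w (q c) (p d) (p b + q b) (p a + q a)) +
     (curv G w (q a) (p d) (p b + q b) (p c + q c) - curv G w (q a) (p d) (p c + q c) (p b + q b)) +
     (curv G w (q b) (p d) (p c + q c) (p a + q a) - curv G w (q b) (p d) (p a + q a) (p c + q c)))
    := by
  have hc : ∀ s t a b, curv G w s t a b - curv G w s t b a = herm (G w) (curvEnd G w a b s) t :=
    fun s t a b => (hG.herm_curvature hw s t a b).symm
  simp only [hc]
  -- Against -`p d` the Bianchi identity replaces the cyclic sum with `p` by minus the one with `q`,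
  -- so that only pairings of a `p` with a `q` occur.
  have h := curvEnd_cyclic hG hw (p a + q a) (p b + q b) (p c + q c)
  rw [curvEnd_add, curvEnd_add, curvEnd_add] at h
  have h' := congrArg (fun x => herm (G w) x (p d)) h
  simp only [map_add, map_sub, add_apply, map_zero, zero_apply] at h' ⊢
  linear_combination -h'

/-- Here `p` and `q` are the (1,0)- and (0,1)-parts of df on vectors u, √-1 u, v, √-1 v, so
everything is determined by `p 0, p 2, q 0, q 2`. Expanding `curv` by its (conjugate) linearity and
ordering its arguments by its two symmetries reduces both sides to the same polynomial. -/
theorem sum_herm_curvEnd (hG : IsLocalKaehler G U) (hw : w ∈ U) (p q : Fin 4 → F)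
    (hp₁ : p 1 = Complex.I • p 0) (hp₃ : p 3 = Complex.I • p 2)
    (hq₁ : q 1 = -(Complex.I • q 0)) (hq₃ : q 3 = -(Complex.I • q 2)) (T : Fin 4 → Fin 4 → Fin 4 → Fin 4 → ℂ)
    (hT : ∀ a b c d, T a b c d =
      herm (G w) (curvEnd G w (p a + q a) (p b + q b) (p c) +
      curvEnd G w (p b + q b) (p c + q c) (p a) + curvEnd G w (p c + q c) (p a + q a) (p b))
      (q d - p d)) :
    T 0 1 2 3 - T 0 1 3 2 + T 0 2 3 1 - T 1 2 3 0 =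
      -2 * altSum (fun v : Fin 4 → Fin 4 => curv G w (q (v 0)) (q (v 1)) (p (v 2)) (p (v 3)))
        ![0, 1, 2, 3] := by
  have hneg1 : ∀ s t a b, curv G w (-s) t a b = - curv G w s t a b := fun s t a b => by
    have := hG.curv_smul_one hw (-1) s t a b
    simpa using this
  have hneg2 : ∀ s t a b, curv G w s (-t) a b = - curv G w s t a b := fun s t a b => by
    have := hG.curv_smul_two hw (-1) s t a b
    simpa using this
  have hneg3 : ∀ s t a b, curv G w s t (-a) b = - curv G w s t a b := fun s t a b => by
    have := hG.curv_smul_three hw (-1) s t a b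
    simpa using this
  have hneg4 : ∀ s t a b, curv G w s t a (-b) = - curv G w s t a b := fun s t a b => by
    have := hG.curv_smul_four hw (-1) s t a b
    simpa using this
  simp only [hT, herm_curvEnd_cyclic hG hw, altSum_four, altSum_three]
  simp only [Matrix.cons_val, hp₁, hp₃, hq₁, hq₃, hG.curv_add_three hw,
    hG.curv_add_four hw, hneg1, hneg2, hneg3, hneg4, hG.curv_I_one hw, hG.curv_I_two hw,
    hG.curv_I_three hw, hG.curv_I_four hw]
  -- Permutative rewriting puts the unbarred and the barred arguments in a fixed order, so that
  -- equal terms become syntactically equal for `ring_nf`.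
  simp only [hG.curv_symm hw, hG.curv_symm' hw]
  ring_nf

end CurvatureTerm

/-! ### The curvature 4-form as an alternating sum, independent of the basis. -/

section CurvatureForm

set_option linter.unusedSectionVars false

variable {V : Type*} [NormedAddCommGroup V] [NormedSpace ℝ V] {p : ℕ}

theorem cwedge_one_altSum {α : V [⋀^Fin p]→L[ℝ] ℂ} (β : V [⋀^Fin 1]→L[ℝ] ℂ)
    {T : (Fin p → V) → ℂ} (hT : ∀ u, α u = altSum T u) (v : Fin (p + 1) → V) :
    cwedge α β v = altSum (fun w => T (w ∘ Fin.castAdd 1) * β (w ∘ Fin.natAdd p)) v := by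
  have h := altSum_altSum_left (fun (u : Fin p → V) (t : Fin 1 → V) => T u * β t) v
  have h' : ∀ w : Fin (p + 1) → V, α (w ∘ Fin.castAdd 1) * β (w ∘ Fin.natAdd p) =
      altSum (fun u => T u * β (w ∘ Fin.natAdd p)) (w ∘ Fin.castAdd 1) := fun w => by
    rw [hT]
    exact map_altSum (AddMonoidHom.mulRight (β (w ∘ Fin.natAdd p))) T (w ∘ Fin.castAdd 1)
  rw [cwedge_apply']
  simp only [h', h]
  rw [Nat.factorial_one, ← Nat.cast_smul_eq_nsmul ℝ, smul_smul]
  have : ((p ! : ℕ) : ℝ) ≠ 0 := Nat.cast_ne_zero.2 p.factorial_ne_zero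
  rw [Nat.cast_one, mul_one, inv_mul_cancel₀ this, one_smul]

theorem cwedge_one_forms (α β γ δ : V [⋀^Fin 1]→L[ℝ] ℂ) (v : Fin (1 + 1 + 1 + 1) → V) :
    cwedge (cwedge (cwedge α β) γ) δ v = altSum (fun w : Fin 4 → V =>
      α ![w 0] * β ![w 1] * γ ![w 2] * δ ![w 3]) v := by
  have h0 : ∀ u, α u = altSum (fun w => α w) u := fun u => by simp [altSum]
  have h := cwedge_one_altSum δ (cwedge_one_altSum γ (cwedge_one_altSum β h0)) v
  rw [h]
  congr 1
  funext w
  have e : ∀ (u : Fin 1 → V), u = ![u 0] := fun u => by ext i; fin_cases i; rfl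
  rw [e (w ∘ Fin.natAdd (1 + 1 + 1)), e ((w ∘ Fin.castAdd 1) ∘ Fin.natAdd (1 + 1)),
    e (((w ∘ Fin.castAdd 1) ∘ Fin.castAdd 1) ∘ Fin.natAdd 1),
    e (((w ∘ Fin.castAdd 1) ∘ Fin.castAdd 1) ∘ Fin.castAdd 1)]
  rfl

variable {F : Type*} [NormedAddCommGroup F] [NormedSpace ℂ F] {m : ℕ}

/-- Additivity, real homogeneity and compatibility with √-1 together are complex linearity; the
rules for `curv` are available in this separated form. -/
theorem eq_sum_repr_mul (b : Module.Basis (Fin m) ℂ F) (f : F → ℂ)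
    (hadd : ∀ x y, f (x + y) = f x + f y) (hsmul : ∀ (r : ℝ) x, f (r • x) = r * f x)
    (hI : ∀ x, f (Complex.I • x) = Complex.I * f x) (x : F) :
    f x = ∑ i, b.repr x i * f (b i) := by
  let L : F →ₗ[ℂ] ℂ :=
    { toFun := f
      map_add' := hadd
      map_smul' := fun c u => by
        have h : c • u = c.re • u + c.im • Complex.I • u := by
          conv_lhs => rw [← Complex.re_add_im c]
          rw [add_smul, mul_smul, Complex.coe_smul, Complex.coe_smul]
        rw [h, hadd, hsmul, hsmul, hI, RingHom.id_apply, smul_eq_mul]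
        conv_rhs => rw [← Complex.re_add_im c]
        ring }
  have h := congrArg L (b.sum_repr x)
  simp only [map_sum, map_smul, smul_eq_mul] at h
  exact h.symm

theorem eq_sum_conj_repr_mul (b : Module.Basis (Fin m) ℂ F) (f : F → ℂ)
    (hadd : ∀ x y, f (x + y) = f x + f y) (hsmul : ∀ (r : ℝ) x, f (r • x) = r * f x)
    (hI : ∀ x, f (Complex.I • x) = -(Complex.I * f x)) (x : F) :
    f x = ∑ i, (starRingEnd ℂ) (b.repr x i) * f (b i) := by
  have h := eq_sum_repr_mul b (fun x => (starRingEnd ℂ) (f x)) (fun x y => by simp [hadd])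
    (fun r x => by simp [hsmul]) (fun x => by simp [hI]) x
  have h' := congrArg (starRingEnd ℂ) h
  simpa using h'

/-- The four arguments are expanded one after the other, the second and the fourth with conjugate
coordinates, matching the type of `curv`. -/
theorem sum_curvCoeff [FiniteDimensional ℂ F] {G : F → F →L[ℝ] F →L[ℝ] ℝ} {U : Set F} {w : F}
    (hG : IsLocalKaehler G U) (hw : w ∈ U) (b : Module.Basis (Fin m) ℂ F) (x y z u : F) :
    ∑ i, ∑ j, ∑ k, ∑ l, curvCoeff b G w i j k l * (b.repr x i * (starRingEnd ℂ) (b.repr y j) *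
      b.repr z k * (starRingEnd ℂ) (b.repr u l)) = curv G w x y z u := by
  rw [eq_sum_repr_mul b (fun x => curv G w x y z u) (hG.curv_add_one hw · · _ _ _)
    (hG.curv_smul_one hw · · _ _ _) (hG.curv_I_one hw · _ _ _) x]
  refine Finset.sum_congr rfl fun i _ => ?_
  rw [eq_sum_conj_repr_mul b (fun y => curv G w (b i) y z u) (hG.curv_add_two hw _ · · _ _)
    (hG.curv_smul_two hw · _ · _ _) (hG.curv_I_two hw _ · _ _) y, Finset.mul_sum]
  refine Finset.sum_congr rfl fun j _ => ?_
  rw [eq_sum_repr_mul b (fun z => curv G w (b i) (b j) z u) (hG.curv_add_three hw _ _ · · _)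
    (hG.curv_smul_three hw · _ _ · _) (hG.curv_I_three hw _ _ · _) z, Finset.mul_sum,
    Finset.mul_sum]
  refine Finset.sum_congr rfl fun k _ => ?_
  rw [eq_sum_conj_repr_mul b (fun u => curv G w (b i) (b j) (b k) u)
    (hG.curv_add_four hw _ _ _ · ·) (hG.curv_smul_four hw · _ _ _ ·)
    (hG.curv_I_four hw _ _ _ ·) u, Finset.mul_sum, Finset.mul_sum, Finset.mul_sum]
  refine Finset.sum_congr rfl fun l _ => ?_
  rw [hG.curvCoeff_eq hw]
  ring

end CurvatureForm

/-! ### The mixed second covariant derivative of the map. -/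

section MixedHessian

set_option linter.unusedSectionVars false
set_option maxSynthPendingDepth 3

variable {E F : Type*} [NormedAddCommGroup E] [NormedSpace ℂ E] [FiniteDimensional ℂ E]
  [NormedAddCommGroup F] [NormedSpace ℂ F] [FiniteDimensional ℂ F]

/-- The covariant derivative of `∂f` in the direction of the antiholomorphic part of `u`. -/
noncomputable def mixedHess (G : F → F →L[ℝ] F →L[ℝ] ℝ) (f : E → F) (z u v : E) : F :=
  (4 : ℝ)⁻¹ • (fderiv ℝ (fderiv ℝ f) z u v - Complex.I • fderiv ℝ (fderiv ℝ f) z u (Complex.I • v) +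
    Complex.I • fderiv ℝ (fderiv ℝ f) z (Complex.I • u) v +
    fderiv ℝ (fderiv ℝ f) z (Complex.I • u) (Complex.I • v)) +
  christoffel G (f z) (antiPart (fderiv ℝ f z) u) (holPart (fderiv ℝ f z) v)

variable {G : F → F →L[ℝ] F →L[ℝ] ℝ} {U : Set F} {f : E → F} {z₀ : E}

theorem fderiv_fderiv_apply (hf : ContDiffAt ℝ ∞ f z₀) (u v : E) :
    fderiv ℝ (fun y => fderiv ℝ f y v) z₀ u = fderiv ℝ (fderiv ℝ f) z₀ u v := by
  have hd : DifferentiableAt ℝ (fderiv ℝ f) z₀ :=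
    (hf.fderiv_right (m := ∞) (by simp)).differentiableAt (by simp)
  rw [(hd.hasFDerivAt.clm_apply (hasFDerivAt_const v z₀)).fderiv]
  simp

theorem fderiv_holPart (hf : ContDiffAt ℝ ∞ f z₀) (u v : E) :
    fderiv ℝ (fun y => holPart (fderiv ℝ f y) v) z₀ u = (2 : ℝ)⁻¹ • (fderiv ℝ (fderiv ℝ f) z₀ u v -
      Complex.I • fderiv ℝ (fderiv ℝ f) z₀ u (Complex.I • v)) := by
  have hd := fun v => (contDiffAt_fderiv_apply hf v).differentiableAt (n := ∞) (by simp)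
  simp only [holPart_apply]
  rw [fderiv_fun_const_smul ((hd v).fun_sub ((hd _).fun_const_smul Complex.I)),
    fderiv_fun_sub (hd v) ((hd _).fun_const_smul Complex.I),
    fderiv_fun_const_smul (hd (Complex.I • v))]
  simp only [smul_apply, sub_apply, fderiv_fderiv_apply hf]

/-- The part of d_∇∂f in which both directions are of type (1,0) vanishes, since the second
derivative and `Γ` are symmetric. Thus d_∇∂f = ∂̄_{E'}∂f. -/
theorem localCurl_eq (hG : IsLocalKaehler G U) (hf : ContDiffAt ℝ ∞ f z₀) (hU : f z₀ ∈ U)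
    (u v : E) : localCurl G f z₀ u v = mixedHess G f z₀ u v - mixedHess G f z₀ v u := by
  have hs : ∀ a b, fderiv ℝ (fderiv ℝ f) z₀ a b = fderiv ℝ (fderiv ℝ f) z₀ b a := fun a b => by
    rw [← fderiv_fderiv_apply hf, ← fderiv_fderiv_apply hf, fderiv_fderiv_symm hf]
  simp only [localCurl, mixedHess, fderiv_holPart hf]
  rw [← holPart_add_antiPart (fderiv ℝ f z₀) u, ← holPart_add_antiPart (fderiv ℝ f z₀) v]
  simp only [map_add, add_apply]
  rw [hG.christoffel_symm hU (holPart (fderiv ℝ f z₀) v) (holPart (fderiv ℝ f z₀) u), hs v u,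
    hs (Complex.I • v) u, hs v (Complex.I • u), hs (Complex.I • v) (Complex.I • u)]
  module

theorem mixedHess_I_left (hG : IsLocalKaehler G U) (hU : f z₀ ∈ U) (u v : E) :
    mixedHess G f z₀ (Complex.I • u) v = -(Complex.I • mixedHess G f z₀ u v) := by
  simp only [mixedHess, antiPart_I, map_neg, neg_apply, hG.christoffel_I_left hU, smul_add,
    smul_sub, smul_comm Complex.I (4 : ℝ)⁻¹, smul_smul, Complex.I_mul_I, neg_one_smul, smul_neg]
  module

theorem mixedHess_I_right (hG : IsLocalKaehler G U) (hU : f z₀ ∈ U) (u v : E) :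
    mixedHess G f z₀ u (Complex.I • v) = Complex.I • mixedHess G f z₀ u v := by
  simp only [mixedHess, holPart_I, map_neg, hG.christoffel_I_right hU, smul_add,
    smul_sub, smul_comm Complex.I (4 : ℝ)⁻¹, smul_smul, Complex.I_mul_I, neg_one_smul, smul_neg]
  module

/-- The exterior derivative of `⟨∂̄∂f, ∂̄f - ∂f⟩` on a pair of complex lines. -/
theorem extDeriv_bracket_lines (hG : IsLocalKaehler G U) (hf : ContDiffAt ℝ ∞ f z₀) (hU : f z₀ ∈ U)
    {β : E → E [⋀^Fin 3]→L[ℝ] ℂ} (ξ : E → E → F)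
    (hξ : ∀ z v, ξ z v = antiPart (fderiv ℝ f z) v - holPart (fderiv ℝ f z) v)
    (hβ : ∀ᶠ z in 𝓝 z₀, ∀ a b c, β z ![a, b, c] =
      herm (G (f z)) (localCurl G f z a b) (ξ z c) + herm (G (f z)) (localCurl G f z b c) (ξ z a) +
      herm (G (f z)) (localCurl G f z c a) (ξ z b)) (u v : E) :
    extDeriv β z₀ ![u, Complex.I • u, v, Complex.I • v] =
      -2 * altSum (fun w : Fin 4 → E => curv G (f z₀) (antiPart (fderiv ℝ f z₀) (w 0))
        (antiPart (fderiv ℝ f z₀) (w 1)) (holPart (fderiv ℝ f z₀) (w 2))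
        (holPart (fderiv ℝ f z₀) (w 3))) ![u, Complex.I • u, v, Complex.I • v] +
      8 * (herm (G (f z₀)) (mixedHess G f z₀ u v) (mixedHess G f z₀ u v) +
        herm (G (f z₀)) (mixedHess G f z₀ v u) (mixedHess G f z₀ v u) -
        herm (G (f z₀)) (mixedHess G f z₀ u u) (mixedHess G f z₀ v v) -
        herm (G (f z₀)) (mixedHess G f z₀ v v) (mixedHess G f z₀ u u)) := by
  rw [(extDeriv_bracket hG hf hU ξ hξ hβ _ (fun _ _ _ => rfl) _ rfl _ rfl _ _ _ _).2]
  let x : Fin 4 → E := ![u, Complex.I • u, v, Complex.I • v]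
  have h := sum_herm_curvEnd hG hU (fun i => holPart (fderiv ℝ f z₀) (x i))
    (fun i => antiPart (fderiv ℝ f z₀) (x i)) (holPart_I _ u) (holPart_I _ v) (antiPart_I _ u)
    (antiPart_I _ v) _ (fun _ _ _ _ => rfl)
  have h2 : altSum (fun w : Fin 4 → Fin 4 => curv G (f z₀) (antiPart (fderiv ℝ f z₀) (x (w 0)))
        (antiPart (fderiv ℝ f z₀) (x (w 1))) (holPart (fderiv ℝ f z₀) (x (w 2)))
        (holPart (fderiv ℝ f z₀) (x (w 3)))) ![0, 1, 2, 3] =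
      altSum (fun w : Fin 4 → E => curv G (f z₀) (antiPart (fderiv ℝ f z₀) (w 0))
        (antiPart (fderiv ℝ f z₀) (w 1)) (holPart (fderiv ℝ f z₀) (w 2))
        (holPart (fderiv ℝ f z₀) (w 3))) ![u, Complex.I • u, v, Complex.I • v] := by
    have h3 : (![0, 1, 2, 3] : Fin 4 → Fin 4) = id := by ext i; fin_cases i <;> rfl
    rw [h3]
    rfl
  rw [h2] at h
  simp only [holPart_add_antiPart, ← hξ] at h
  have h4 : ∀ a b c d : ℂ, a = b → c = d → a - 2 * c = b - 2 * d := fun a b c d h1 h2 => by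
    rw [h1, h2]
  refine (h4 _ _ _ _ h rfl).trans ?_
  -- By the type of A, σ(u, √-1 u) = 2√-1 A(u, u): the products of such terms for `u` and `v` are
  -- those that the trace will remove. The other products of σ give the squared norms.
  simp only [localCurl_eq hG hf hU, mixedHess_I_left hG hU, mixedHess_I_right hG hU, map_sub,
    map_neg, sub_apply, neg_apply, neg_neg, smul_smul, Complex.I_mul_I, neg_one_smul, hG.herm_I_left hU,
    hG.herm_I_right hU]
  ring_nf
  simp only [Complex.I_sq]
  ring

end MixedHessian

/-! ### Unitary bases and traces. -/

section UnitaryBasis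

set_option linter.unusedSectionVars false

/-- The space carries no norm here, so the norm of the inner product can be installed locally
without conflicting with the given norm of the model space. -/
theorem exists_basis_of_core {V : Type*} [AddCommGroup V] [Module ℂ V] [FiniteDimensional ℂ V]
    (c : InnerProductSpace.Core ℂ V) {n : ℕ} (hn : Module.finrank ℂ V = n) :
    ∃ e : Module.Basis (Fin n) ℂ V, ∀ a b, c.inner (e a) (e b) = if a = b then 1 else 0 := by
  let _ : NormedAddCommGroup V := c.toNormedAddCommGroup
  let _ : InnerProductSpace ℂ V := InnerProductSpace.ofCore c.toCore
  let e := (stdOrthonormalBasis ℂ V).reindex (finCongr hn)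
  refine ⟨e.toBasis, fun a b => ?_⟩
  have h := orthonormal_iff_ite.1 e.orthonormal a b
  simpa using h

theorem sum_pairs {V W : Type*} [NormedAddCommGroup V] [NormedSpace ℂ V] [AddCommMonoid W] {k : ℕ}
    (e : Fin k → V) (f : V → W) :
    ∑ i, f (pairs e i) = ∑ s, (f (e s) + f (Complex.I • e s)) := by
  rw [← (finProdFinEquiv.trans (finCongr (mul_comm k 2))).sum_comp, Fintype.sum_prod_type]
  refine Finset.sum_congr rfl fun s _ => ?_
  rw [Fin.sum_univ_two]
  have h1 : ∀ t : Fin 2, (((finProdFinEquiv.trans (finCongr (mul_comm k 2))) (s, t) :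
      Fin (2 * k)) : ℕ) = t + 2 * s := fun t => by simp
  congr 2
  · rw [pairs, if_pos (by rw [h1]; simp)]
    exact congrArg e (Fin.ext (by simp))
  · rw [pairs, if_neg (by rw [h1]; simp)]
    exact congrArg (Complex.I • e ·) (Fin.ext (by simp only [h1, Fin.val_one]; omega))

variable {V : Type*} [NormedAddCommGroup V] [NormedSpace ℂ V] [FiniteDimensional ℂ V]
  {G : V → V →L[ℝ] V →L[ℝ] ℝ} {U : Set V} {w : V} {n : ℕ}

namespace IsLocalKaehler

variable (hG : IsLocalKaehler G U) (hw : w ∈ U)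

include hG hw

theorem herm_smul_right (c : ℂ) (u v : V) :
    herm (G w) u (c • v) = (starRingEnd ℂ) c * herm (G w) u v := by
  rw [← hG.herm_conj hw, hG.herm_smul_left hw, map_mul, hG.herm_conj hw]

theorem metric_I_self (u : V) : G w u (Complex.I • u) = 0 := by
  have h1 := hG.metric_I_right hw u u
  have h2 := hG.symm w hw (Complex.I • u) u
  linarith

theorem herm_self (u : V) : herm (G w) u u = ((2⁻¹ * G w u u : ℝ) : ℂ) := by
  rw [herm_apply, hG.metric_I_self hw]
  simp

theorem exists_unitary_basis (hn : Module.finrank ℂ V = n) :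
    ∃ e : Module.Basis (Fin n) ℂ V, ∀ a b, herm (G w) (e a) (e b) = if a = b then 2⁻¹ else 0 := by
  let c : InnerProductSpace.Core ℂ V :=
    -- The arguments are exchanged because an inner product is conjugate linear in its first
    -- argument. The factor `2` makes `metricCoeff` the identity, that is, makes the vectors `e a`
    -- and √-1 `e a` orthonormal for `G w`.
    { inner := fun u v => 2 * herm (G w) v u
      conj_inner_symm := fun u v => by rw [map_mul, hG.herm_conj hw, map_ofNat]
      re_inner_nonneg := fun u => by
        rw [hG.herm_self hw, ← Complex.ofReal_ofNat, ← Complex.ofReal_mul]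
        change 0 ≤ 2 * (2⁻¹ * G w u u)
        rcases eq_or_ne u 0 with rfl | hu
        · simp
        · have := hG.pos w hw u hu
          positivity
      add_left := fun u v x => by rw [map_add, mul_add]
      smul_left := fun u v x => by rw [hG.herm_smul_right hw]; ring
      definite := fun u hu => by
        by_contra h
        exact hG.herm_self_pos hw h (by simpa using hu) }
  obtain ⟨e, he⟩ := exists_basis_of_core c hn
  refine ⟨e, fun a b => ?_⟩
  have h : 2 * herm (G w) (e a) (e b) = if b = a then 1 else 0 := he b a
  simp only [eq_comm (a := b)] at h
  split_ifs at h ⊢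
  · linear_combination (2⁻¹ : ℂ) * h
  · linear_combination (2⁻¹ : ℂ) * h

variable {e : Module.Basis (Fin n) ℂ V}
  (he : ∀ a b, herm (G w) (e a) (e b) = if a = b then 2⁻¹ else 0)

include he

theorem metric_unitary (a b : Fin n) : G w (e a) (e b) = if a = b then 1 else 0 := by
  have h := congrArg Complex.re (he a b)
  rw [herm_apply] at h
  split_ifs at h ⊢ <;> simp at h <;> linarith

theorem metric_unitary_I_right (a b : Fin n) : G w (e a) (Complex.I • e b) = 0 := by
  have h := congrArg Complex.im (he a b)
  rw [herm_apply] at h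
  split_ifs at h <;> simpa using h

theorem metric_unitary_I_left (a b : Fin n) : G w (Complex.I • e a) (e b) = 0 := by
  rw [hG.symm w hw, hG.metric_unitary_I_right hw he]

theorem isUnitaryFrame : IsUnitaryFrame (fundamentalForm (G w)) e where
  left s t := by
    rw [fundamentalForm_apply, hG.metric_unitary_I_left hw he, hG.metric_unitary_I_left hw he]
    simp
  mixed s t := by
    rw [fundamentalForm_apply, hG.inv w hw, smul_smul, Complex.I_mul_I, neg_one_smul, map_neg,
      neg_apply, hG.metric_unitary hw he, hG.metric_unitary hw he]
    simp only [eq_comm (a := t)]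
    split_ifs <;> norm_num
  mixed' s t := by
    rw [fundamentalForm_apply, hG.inv w hw, smul_smul, Complex.I_mul_I, neg_one_smul, map_neg,
      neg_apply, hG.metric_unitary hw he, hG.metric_unitary hw he]
    simp only [eq_comm (a := t)]
    split_ifs <;> norm_num
  right s t := by
    rw [fundamentalForm_apply, smul_smul, smul_smul, Complex.I_mul_I, neg_one_smul, neg_one_smul,
      map_neg, map_neg, neg_apply, neg_apply, hG.metric_unitary_I_right hw he,
      hG.metric_unitary_I_right hw he]
    simp

theorem metric_pairs (i j : Fin (2 * n)) :
    G w (pairs e i) (pairs e j) = if i = j then 1 else 0 := by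
  have h : i = j ↔ (i : ℕ) % 2 = j % 2 ∧ (⟨i / 2, half_lt i⟩ : Fin n) = ⟨j / 2, half_lt j⟩ := by
    rw [Fin.ext_iff, Fin.ext_iff]
    simp only
    omega
  simp only [pairs]
  split_ifs <;> simp_all [hG.inv w hw, hG.metric_unitary hw he, hG.metric_unitary_I_left hw he,
    hG.metric_unitary_I_right hw he]

theorem finrank_real : Fintype.card (Fin (2 * n)) = Module.finrank ℝ V := by
  rw [Fintype.card_fin, finrank_real_of_complex, Module.finrank_eq_card_basis e, Fintype.card_fin]

theorem linearIndependent_pairs : LinearIndependent ℝ (pairs e) := by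
  rw [Fintype.linearIndependent_iff]
  intro c hc i
  have h := congrArg (fun x => G w x (pairs e i)) hc
  simpa [hG.metric_pairs hw he, sum_apply] using h

/-- The real orthonormal basis of a unitary basis. -/
theorem exists_basis_pairs : ∃ x : Module.Basis (Fin (2 * n)) ℝ V, ⇑x = pairs e := by
  rcases Nat.eq_zero_or_pos n with rfl | h0
  · have h1 := hG.linearIndependent_pairs hw he
    have : Module.finrank ℝ V = 0 := by
      rw [← hG.finrank_real hw he]; simp
    have hs : Subsingleton V := Module.finrank_zero_iff.1 this
    have : IsEmpty (Fin (2 * 0)) := Fin.isEmpty'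
    exact ⟨Module.Basis.empty V, by ext i; exact i.elim0⟩
  · have : Nonempty (Fin (2 * n)) := ⟨⟨0, by omega⟩⟩
    exact ⟨basisOfLinearIndependentOfCardEqFinrank (hG.linearIndependent_pairs hw he)
      (hG.finrank_real hw he), coe_basisOfLinearIndependentOfCardEqFinrank _ _⟩

/-- A form of top degree is determined by its value on one basis, here the real basis `pairs e`.
Every identity of top-degree forms thereby becomes an identity of numbers. -/
theorem topForm_ext {W : Type*} [NormedAddCommGroup W] [NormedSpace ℝ W]
    {α β : V [⋀^Fin (2 * n)]→L[ℝ] W} (h : α (pairs e) = β (pairs e)) : α = β := by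
  obtain ⟨x, hx⟩ := hG.exists_basis_pairs hw he
  apply ContinuousAlternatingMap.toAlternatingMap_injective
  refine x.ext_alternating fun v hv => ?_
  let σ : Equiv.Perm (Fin (2 * n)) := Equiv.ofBijective v (Finite.injective_iff_bijective.1 hv)
  have h1 : ∀ γ : V [⋀^Fin (2 * n)]→L[ℝ] W, γ.toAlternatingMap (fun i => x (v i)) =
      Equiv.Perm.sign σ • γ (pairs e) := fun γ => by
    rw [← hx]
    exact γ.toAlternatingMap.map_perm x σ
  rw [h1, h1, h]

theorem sum_metric_pairs (u : V) : u = ∑ i, G w u (pairs e i) • pairs e i := by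
  obtain ⟨x, hx⟩ := hG.exists_basis_pairs hw he
  have h : ∀ i, G w u (pairs e i) = x.repr u i := fun i => by
    conv_lhs => rw [← x.sum_repr u]
    simp [hx, hG.metric_pairs hw he, sum_apply]
  simp only [h]
  rw [← hx, x.sum_repr]

/-- The trace does not depend on the basis: ∑ gᵃᵇ G(x_a, u) x_b = u for any basis x, which is
applied to the vectors `u` of the orthonormal basis `pairs e`. -/
theorem trace_gram {W : Type*} [AddCommGroup W] [Module ℝ W] (T : V →ₗ[ℝ] V →ₗ[ℝ] W) :
    ∑ a, ∑ b, (gram (G w))⁻¹ a b • T (Module.finBasis ℝ V a) (Module.finBasis ℝ V b) =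
      ∑ s, (T (e s) (e s) + T (Complex.I • e s) (Complex.I • e s)) := by
  have h1 : ∀ u, ∑ a, ∑ b, ((gram (G w))⁻¹ a b * G w (Module.finBasis ℝ V a) u) •
      Module.finBasis ℝ V b = u := fun u => by
    conv_rhs => rw [← (Module.finBasis ℝ V).sum_repr u]
    rw [Finset.sum_comm]
    refine Finset.sum_congr rfl fun b _ => ?_
    rw [← Finset.sum_smul]
    congr 1
    have hs : (gram (G w)).transpose = gram (G w) := by
      ext a b
      exact hG.symm w hw _ _
    have h2 : ∀ a, G w (Module.finBasis ℝ V a) u =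
        ∑ c, (Module.finBasis ℝ V).repr u c * gram (G w) c a := fun a => by
      conv_lhs => rw [← (Module.finBasis ℝ V).sum_repr u]
      rw [map_sum]
      refine Finset.sum_congr rfl fun c _ => ?_
      rw [map_smul, smul_eq_mul, hG.symm w hw]
      rfl
    have h3 : ∀ c, ∑ a, (gram (G w))⁻¹ a b * ((Module.finBasis ℝ V).repr u c * gram (G w) c a) =
        (Module.finBasis ℝ V).repr u c * (gram (G w) * (gram (G w))⁻¹) c b := fun c => by
      rw [Matrix.mul_apply, Finset.mul_sum]
      exact Finset.sum_congr rfl fun _ _ => by ring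
    simp only [h2, Finset.mul_sum]
    rw [Finset.sum_comm]
    simp only [h3, Matrix.mul_nonsing_inv _ (gram_isUnit (hG.pos w hw))]
    simp [Matrix.one_apply]
  have h2 : ∀ a b, (gram (G w))⁻¹ a b • T (Module.finBasis ℝ V a) (Module.finBasis ℝ V b) =
      ∑ i, T (pairs e i) (((gram (G w))⁻¹ a b * G w (Module.finBasis ℝ V a) (pairs e i)) •
        Module.finBasis ℝ V b) := fun a b => by
    conv_lhs => rw [hG.sum_metric_pairs hw he (Module.finBasis ℝ V a)]
    simp only [map_sum, LinearMap.sum_apply, Finset.smul_sum, map_smul, LinearMap.smul_apply,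
      smul_smul]
  have h3 : ∑ a, ∑ b, (gram (G w))⁻¹ a b • T (Module.finBasis ℝ V a) (Module.finBasis ℝ V b) =
      ∑ i, T (pairs e i) (pairs e i) := by
    simp only [h2]
    conv_rhs => enter [2, i, 2]; rw [← h1 (pairs e i)]
    simp only [map_sum]
    rw [Finset.sum_congr rfl fun a _ => Finset.sum_comm, Finset.sum_comm]
  rw [h3, sum_pairs e (fun u => T u u)]

/-- If `C` expresses `b` in the unitary basis, then `metricCoeff` is C C*, and C* (C C*)⁻¹ C = 1
turns the contraction into a diagonal sum. -/
theorem trace_hermitian (b : Module.Basis (Fin n) ℂ V) (Φ : V → V → ℂ)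
    (hadd : ∀ x y z, Φ (x + y) z = Φ x z + Φ y z) (hsmul : ∀ (r : ℝ) x z, Φ (r • x) z = r * Φ x z)
    (hI : ∀ x z, Φ (Complex.I • x) z = Complex.I * Φ x z)
    (hadd' : ∀ z x y, Φ z (x + y) = Φ z x + Φ z y)
    (hsmul' : ∀ (r : ℝ) z x, Φ z (r • x) = r * Φ z x)
    (hI' : ∀ z x, Φ z (Complex.I • x) = -(Complex.I * Φ z x)) :
    ∑ i, ∑ j, (metricCoeff b (G w))⁻¹ j i * Φ (b i) (b j) = ∑ a, Φ (e a) (e a) := by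
  let C : Matrix (Fin n) (Fin n) ℂ := fun i a => e.repr (b i) a
  have hC : IsUnit C.det := by
    have h1 : (e.toMatrix b).transpose = C := rfl
    rw [← h1, Matrix.det_transpose]
    exact (Matrix.isUnit_iff_isUnit_det _).1
      (IsUnit.of_mul_eq_one _ (e.toMatrix_mul_toMatrix_flip b))
  have hm : metricCoeff b (G w) = C * C.conjTranspose := by
    ext i j
    rw [metricCoeff, Matrix.mul_apply,
      eq_sum_repr_mul e (fun x => herm (G w) x (b j)) (by simp) (by simp)
        (fun x => hG.herm_I_left hw x _), Finset.mul_sum]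
    refine Finset.sum_congr rfl fun a _ => ?_
    rw [eq_sum_conj_repr_mul e (fun y => herm (G w) (e a) y) (by simp) (by simp)
        (fun x => hG.herm_I_right hw _ x)]
    simp only [he, mul_ite, mul_zero, Finset.sum_ite_eq, Finset.mem_univ, if_true]
    change _ = C i a * (starRingEnd ℂ) (C j a)
    simp only [C]
    ring
  have hinv : C.conjTranspose * (metricCoeff b (G w))⁻¹ * C = 1 := by
    have hC' : IsUnit C.conjTranspose.det := by
      rw [Matrix.det_conjTranspose]
      exact hC.star
    rw [hm, Matrix.mul_inv_rev, ← mul_assoc, Matrix.mul_nonsing_inv _ hC', one_mul,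
      Matrix.nonsing_inv_mul _ hC]
  have hΦ : ∀ i j, Φ (b i) (b j) = ∑ a, ∑ c, C i a * (starRingEnd ℂ) (C j c) * Φ (e a) (e c) := fun i j => by
    rw [eq_sum_repr_mul e (fun x => Φ x (b j)) (fun x y => hadd x y _) (fun r x => hsmul r x _)
      (fun x => hI x _)]
    refine Finset.sum_congr rfl fun a _ => ?_
    rw [eq_sum_conj_repr_mul e (fun y => Φ (e a) y) (hadd' _) (fun r x => hsmul' r _ x) (hI' _),
      Finset.mul_sum]
    exact Finset.sum_congr rfl fun c _ => (mul_assoc _ _ _).symm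
  have hK : ∀ a c, ∑ i, ∑ j, (metricCoeff b (G w))⁻¹ j i * (C i a * (starRingEnd ℂ) (C j c)) =
      if c = a then 1 else 0 := fun a c => by
    rw [← Matrix.one_apply, ← hinv, Matrix.mul_apply]
    refine Finset.sum_congr rfl fun i _ => ?_
    rw [Matrix.mul_apply, Finset.sum_mul]
    exact Finset.sum_congr rfl fun j _ => by
      rw [Matrix.conjTranspose_apply, ← starRingEnd_apply]
      ring
  calc ∑ i, ∑ j, (metricCoeff b (G w))⁻¹ j i * Φ (b i) (b j)
      = ∑ i, ∑ j, ∑ a, ∑ c, (metricCoeff b (G w))⁻¹ j i * (C i a * (starRingEnd ℂ) (C j c)) *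
          Φ (e a) (e c) := by
        simp only [hΦ, Finset.mul_sum, mul_assoc]
    _ = ∑ a, ∑ c, (∑ i, ∑ j, (metricCoeff b (G w))⁻¹ j i * (C i a * (starRingEnd ℂ) (C j c))) *
          Φ (e a) (e c) := by
        simp only [Finset.sum_mul]
        rw [Finset.sum_congr rfl fun i _ => Finset.sum_comm, Finset.sum_comm]
        refine Finset.sum_congr rfl fun a _ => ?_
        rw [Finset.sum_congr rfl fun i _ => Finset.sum_comm, Finset.sum_comm]
    _ = ∑ a, Φ (e a) (e a) := by
        simp only [hK]
        simp

end IsLocalKaehler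

end UnitaryBasis

/-! ### Tension field and squared norm in terms of the mixed second derivative. -/

section Traces

set_option linter.unusedSectionVars false
set_option maxSynthPendingDepth 3

variable {E F : Type*} [NormedAddCommGroup E] [NormedSpace ℂ E] [FiniteDimensional ℂ E]
  [NormedAddCommGroup F] [NormedSpace ℂ F] [FiniteDimensional ℂ F]
  {g : E → E →L[ℝ] E →L[ℝ] ℝ} {W : Set E} {G : F → F →L[ℝ] F →L[ℝ] ℝ} {U : Set F}
  {f : E → F} {z₀ : E} {n : ℕ} {e : Module.Basis (Fin n) ℂ E}

/-- In T(e, e) + T(√-1 e, √-1 e) complex bilinear contributions cancel: the Christoffel symbols of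
`g`, because `g` is Kähler, and those parts of the Christoffel term of `G` that pair equal types.
Four times the mixed part remains. -/
theorem trace_hessian (hg : IsLocalKaehler g W) (hW : z₀ ∈ W) (hG : IsLocalKaehler G U)
    (hf : ContDiffAt ℝ ∞ f z₀) (hU : f z₀ ∈ U)
    (he : ∀ a b, herm (g z₀) (e a) (e b) = if a = b then 2⁻¹ else 0) :
    ∑ a, ∑ b, (gram (g z₀))⁻¹ a b •
      (fderiv ℝ (fderiv ℝ f) z₀ (Module.finBasis ℝ E a) (Module.finBasis ℝ E b) -
        fderiv ℝ f z₀ (christoffel g z₀ (Module.finBasis ℝ E a) (Module.finBasis ℝ E b)) +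
        christoffel G (f z₀) (fderiv ℝ f z₀ (Module.finBasis ℝ E a))
          (fderiv ℝ f z₀ (Module.finBasis ℝ E b))) =
      (4 : ℝ) • ∑ s, mixedHess G f z₀ (e s) (e s) := by
  let T : E →ₗ[ℝ] E →ₗ[ℝ] F := LinearMap.mk₂ ℝ (fun u v => fderiv ℝ (fderiv ℝ f) z₀ u v -
    fderiv ℝ f z₀ (christoffel g z₀ u v) + christoffel G (f z₀) (fderiv ℝ f z₀ u)
      (fderiv ℝ f z₀ v))
    (fun _ _ _ => by simp only [map_add, add_apply]; abel)
    (fun _ _ _ => by simp only [map_smul, smul_apply]; module)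
    (fun _ _ _ => by simp only [map_add]; abel)
    (fun _ _ _ => by simp only [map_smul]; module)
  refine (hg.trace_gram hW he T).trans ?_
  rw [Finset.smul_sum]
  refine Finset.sum_congr rfl fun s _ => ?_
  have hs : ∀ a b, fderiv ℝ (fderiv ℝ f) z₀ a b = fderiv ℝ (fderiv ℝ f) z₀ b a := fun a b => by
    rw [← fderiv_fderiv_apply hf, ← fderiv_fderiv_apply hf, fderiv_fderiv_symm hf]
  simp only [T, LinearMap.mk₂_apply, mixedHess]
  rw [hs (Complex.I • e s) (e s), hg.christoffel_I_left hW, hg.christoffel_I_right hW,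
    ← holPart_add_antiPart (fderiv ℝ f z₀) (e s),
    ← holPart_add_antiPart (fderiv ℝ f z₀) (Complex.I • e s), holPart_I, antiPart_I]
  simp only [map_add, map_neg, add_apply, neg_apply, hG.christoffel_I_left hU,
    hG.christoffel_I_right hU, smul_smul, Complex.I_mul_I, neg_one_smul]
  rw [hG.christoffel_symm hU (antiPart (fderiv ℝ f z₀) (e s)) (holPart (fderiv ℝ f z₀) (e s))]
  module

/-- The coefficient keeps what is complex linear in the first argument and conjugate linear in the
second. Of the two terms of `η ![u, v]`, only the one with exchanged arguments has this type. -/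
theorem formCoeff_eq_mixedHess (hG : IsLocalKaehler G U) (hU : f z₀ ∈ U)
    {η : E [⋀^Fin 2]→L[ℝ] F} (hη : ∀ u v, η ![u, v] =
      mixedHess G f z₀ v u - mixedHess G f z₀ u v) (b : Module.Basis (Fin n) ℂ E) (i j : Fin n) :
    formCoeff b η i j = mixedHess G f z₀ (b j) (b i) := by
  rw [formCoeff]
  simp only [hη, mixedHess_I_left hG hU, mixedHess_I_right hG hU, smul_sub, smul_add, smul_neg,
    smul_smul, Complex.I_mul_I, neg_one_smul, neg_neg]
  module

theorem mixedHess_add_left (u u' v : E) : mixedHess G f z₀ (u + u') v =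
    mixedHess G f z₀ u v + mixedHess G f z₀ u' v := by
  simp only [mixedHess, map_add, add_apply, smul_add]
  module

theorem mixedHess_add_right (u v v' : E) : mixedHess G f z₀ u (v + v') =
    mixedHess G f z₀ u v + mixedHess G f z₀ u v' := by
  simp only [mixedHess, map_add, smul_add]
  module

theorem mixedHess_smul_left (r : ℝ) (u v : E) : mixedHess G f z₀ (r • u) v =
    r • mixedHess G f z₀ u v := by
  simp only [mixedHess, map_smul, smul_apply, smul_comm Complex.I r]
  module

theorem mixedHess_smul_right (r : ℝ) (u v : E) : mixedHess G f z₀ u (r • v) =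
    r • mixedHess G f z₀ u v := by
  simp only [mixedHess, map_smul, smul_comm Complex.I r]
  module

/-- `trace_hermitian` is applied once in each argument of A. As A is conjugate linear in its first
argument, the two factors of the Hermitian product change roles there. -/
theorem sum_norm_mixedHess (hg : IsLocalKaehler g W) (hW : z₀ ∈ W) (hG : IsLocalKaehler G U)
    (hU : f z₀ ∈ U) (he : ∀ a b, herm (g z₀) (e a) (e b) = if a = b then 2⁻¹ else 0)
    (b : Module.Basis (Fin n) ℂ E) :
    ∑ i, ∑ j, ∑ k, ∑ l, (metricCoeff b (g z₀))⁻¹ l i * (metricCoeff b (g z₀))⁻¹ j k *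
      herm (G (f z₀)) (mixedHess G f z₀ (b j) (b i)) (mixedHess G f z₀ (b k) (b l)) =
    ∑ a, ∑ c, herm (G (f z₀)) (mixedHess G f z₀ (e a) (e c)) (mixedHess G f z₀ (e a) (e c)) := by
  have h1 : ∀ j k, ∑ i, ∑ l, (metricCoeff b (g z₀))⁻¹ l i *
      herm (G (f z₀)) (mixedHess G f z₀ (b j) (b i)) (mixedHess G f z₀ (b k) (b l)) =
      ∑ c, herm (G (f z₀)) (mixedHess G f z₀ (b j) (e c)) (mixedHess G f z₀ (b k) (e c)) :=
    fun j k => hg.trace_hermitian hW he b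
      (fun x y => herm (G (f z₀)) (mixedHess G f z₀ (b j) x) (mixedHess G f z₀ (b k) y))
      (by simp [mixedHess_add_right]) (by simp [mixedHess_smul_right])
      (by simp [mixedHess_I_right hG hU, hG.herm_I_left hU])
      (by simp [mixedHess_add_right]) (by simp [mixedHess_smul_right])
      (by simp [mixedHess_I_right hG hU, hG.herm_I_right hU])
  have h2 : ∀ c, ∑ k, ∑ j, (metricCoeff b (g z₀))⁻¹ j k *
      herm (G (f z₀)) (mixedHess G f z₀ (b j) (e c)) (mixedHess G f z₀ (b k) (e c)) =
      ∑ a, herm (G (f z₀)) (mixedHess G f z₀ (e a) (e c)) (mixedHess G f z₀ (e a) (e c)) :=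
    fun c => hg.trace_hermitian hW he b
      (fun x y => herm (G (f z₀)) (mixedHess G f z₀ y (e c)) (mixedHess G f z₀ x (e c)))
      (by simp [mixedHess_add_left]) (by simp [mixedHess_smul_left])
      (by simp [mixedHess_I_left hG hU, hG.herm_I_right hU])
      (by simp [mixedHess_add_left]) (by simp [mixedHess_smul_left])
      (by simp [mixedHess_I_left hG hU, hG.herm_I_left hU])
  calc _ = ∑ j, ∑ k, (metricCoeff b (g z₀))⁻¹ j k * ∑ i, ∑ l, (metricCoeff b (g z₀))⁻¹ l i *
      herm (G (f z₀)) (mixedHess G f z₀ (b j) (b i)) (mixedHess G f z₀ (b k) (b l)) := by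
        simp only [Finset.mul_sum]
        rw [Finset.sum_comm]
        refine Finset.sum_congr rfl fun j _ => ?_
        rw [Finset.sum_comm]
        refine Finset.sum_congr rfl fun k _ => ?_
        exact Finset.sum_congr rfl fun i _ => Finset.sum_congr rfl fun l _ => by ring
    _ = ∑ c, ∑ k, ∑ j, (metricCoeff b (g z₀))⁻¹ j k *
      herm (G (f z₀)) (mixedHess G f z₀ (b j) (e c)) (mixedHess G f z₀ (b k) (e c)) := by
        simp only [h1, Finset.mul_sum]
        rw [Finset.sum_comm, Finset.sum_congr rfl fun k _ => Finset.sum_comm, Finset.sum_comm]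
    _ = _ := by
        simp only [h2]
        exact Finset.sum_comm

end Traces

/-! ### Holomorphic transition maps and local expressions. -/

section Transition

set_option linter.unusedSectionVars false

variable {E : Type*} [NormedAddCommGroup E] [NormedSpace ℂ E]
  {M : Type*} [TopologicalSpace M] [ChartedSpace E M]

variable (E) in
/-- The transition map from the chart centred at `x` to the chart centred at `y`. -/
def transition (x y : M) (z : E) : E := chartAt E y ((chartAt E x).symm z)

variable (E) in
/-- The domain of the transition map from the chart centred at `x` to the chart centred at `y`. -/
def transitionDomain (x y : M) : Set E :=
  (chartAt E x).target ∩ (chartAt E x).symm ⁻¹' (chartAt E y).source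

variable {x y w : M} {z : E}

theorem isOpen_transitionDomain : IsOpen (transitionDomain E x y) :=
  (chartAt E x).isOpen_inter_preimage_symm (chartAt E y).open_source

theorem mem_transitionDomain_self (hz : z ∈ (chartAt E x).target) : z ∈ transitionDomain E x x :=
  ⟨hz, (chartAt E x).map_target hz⟩

theorem mem_transitionDomain_chart (hx : x ∈ (chartAt E y).source) :
    chartAt E x x ∈ transitionDomain E x y :=
  ⟨mem_chart_target E x, by
    rw [Set.mem_preimage, (chartAt E x).left_inv (mem_chart_source E x)]
    exact hx⟩

theorem mem_transitionDomain_symm (hz : z ∈ (chartAt E x).target) :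
    z ∈ transitionDomain E x ((chartAt E x).symm z) :=
  ⟨hz, mem_chart_source E _⟩

theorem symm_transition (hz : z ∈ transitionDomain E x y) :
    (chartAt E y).symm (transition E x y z) = (chartAt E x).symm z :=
  (chartAt E y).left_inv hz.2

theorem transition_mem (hz : z ∈ transitionDomain E x y) (hw : z ∈ transitionDomain E x w) :
    transition E x y z ∈ transitionDomain E y w :=
  ⟨(chartAt E y).map_source hz.2, by
    rw [Set.mem_preimage, symm_transition hz]
    exact hw.2⟩

theorem transition_transition (hz : z ∈ transitionDomain E x y) :
    transition E y w (transition E x y z) = transition E x w z :=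
  congrArg (chartAt E w) (symm_transition hz)

theorem transition_self (hz : z ∈ (chartAt E x).target) : transition E x x z = z :=
  (chartAt E x).right_inv hz

theorem fderiv_transition_self (hz : z ∈ (chartAt E x).target) :
    fderiv ℝ (transition E x x) z = ContinuousLinearMap.id ℝ E := by
  have h : transition E x x =ᶠ[𝓝 z] id :=
    Filter.eventually_of_mem ((chartAt E x).open_target.mem_nhds hz) fun _ h => transition_self h
  rw [h.fderiv_eq, fderiv_id]

section Smooth

variable [IsManifold 𝓘(ℂ, E) ∞ M]

theorem contDiffAt_transition_complex (hz : z ∈ transitionDomain E x y) :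
    ContDiffAt ℂ ∞ (transition E x y) z := by
  have h := StructureGroupoid.compatible (contDiffGroupoid ∞ 𝓘(ℂ, E)) (chart_mem_atlas E x)
    (chart_mem_atlas E y)
  rw [contDiffGroupoid, mem_groupoid_of_pregroupoid] at h
  have h1 : ContDiffOn ℂ ∞ (transition E x y) (transitionDomain E x y) := by
    refine ContDiffOn.congr (f := ((chartAt E x).symm.trans (chartAt E y))) ?_ fun _ _ => rfl
    have := h.1
    simpa [contDiffPregroupoid, transitionDomain] using this
  exact h1.contDiffAt (isOpen_transitionDomain.mem_nhds hz)

theorem contDiffAt_transition (hz : z ∈ transitionDomain E x y) :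
    ContDiffAt ℝ ∞ (transition E x y) z :=
  (contDiffAt_transition_complex hz).restrict_scalars ℝ

theorem differentiableAt_transition (hz : z ∈ transitionDomain E x y) :
    DifferentiableAt ℝ (transition E x y) z :=
  (contDiffAt_transition hz).differentiableAt (by simp)

theorem fderiv_transition_I (hz : z ∈ transitionDomain E x y) (v : E) :
    fderiv ℝ (transition E x y) z (Complex.I • v) =
      Complex.I • fderiv ℝ (transition E x y) z v := by
  have h := (contDiffAt_transition_complex hz).differentiableAt (by simp)
  rw [h.fderiv_restrictScalars ℝ]
  simp

theorem fderiv_transition_comp (hz : z ∈ transitionDomain E x y) (hw : z ∈ transitionDomain E x w) :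
    fderiv ℝ (transition E y w) (transition E x y z) ∘L fderiv ℝ (transition E x y) z =
      fderiv ℝ (transition E x w) z := by
  have h : transition E x w =ᶠ[𝓝 z] transition E y w ∘ transition E x y :=
    Filter.eventually_of_mem (isOpen_transitionDomain.mem_nhds hz) fun _ h =>
      (transition_transition h).symm
  rw [h.fderiv_eq, fderiv_comp z (differentiableAt_transition (transition_mem hz hw))
    (differentiableAt_transition hz)]

/-- The tangent space at a point is identified with `E` by the chart centred at that point. The
derivative of an inverse chart is therefore that of a transition map whose target chart depends on
`z`. -/
theorem chartSymmDeriv_eq (hz : z ∈ (chartAt E x).target) :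
    chartSymmDeriv x z = fderiv ℝ (transition E x ((chartAt E x).symm z)) z := by
  have h : MDifferentiableAt 𝓘(ℝ, E) 𝓘(ℝ, E) (chartAt E x).symm z :=
    (contMDiffOn_chart_symm (n := ∞) (I := 𝓘(ℝ, E)) (x := x)).mdifferentiableOn (by simp) z hz
      |>.mdifferentiableAt ((chartAt E x).open_target.mem_nhds hz)
  rw [chartSymmDeriv, mfderiv]
  refine (if_pos h).trans ?_
  simp only [writtenInExtChartAt, mfld_simps, fderivWithin_univ]
  rfl

theorem chartDeriv_eq (hx : x ∈ (chartAt E y).source) :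
    chartDeriv y x = fderiv ℝ (transition E x y) (chartAt E x x) := by
  have h : MDifferentiableAt 𝓘(ℝ, E) 𝓘(ℝ, E) (chartAt E y) x :=
    (contMDiffOn_chart (n := ∞) (I := 𝓘(ℝ, E)) (x := y)).mdifferentiableOn (by simp) x hx
      |>.mdifferentiableAt ((chartAt E y).open_source.mem_nhds hx)
  rw [chartDeriv, mfderiv]
  refine (if_pos h).trans ?_
  simp only [writtenInExtChartAt, mfld_simps, fderivWithin_univ]
  rfl

theorem chartSymmDeriv_I (hz : z ∈ (chartAt E x).target) (v : E) :
    chartSymmDeriv x z (Complex.I • v) = Complex.I • chartSymmDeriv x z v := by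
  rw [chartSymmDeriv_eq hz, fderiv_transition_I (mem_transitionDomain_symm hz)]

theorem chartSymmDeriv_self : chartSymmDeriv x (chartAt E x x) = ContinuousLinearMap.id ℝ E := by
  have hz := mem_chart_target E x
  rw [chartSymmDeriv_eq hz, (chartAt E x).left_inv (mem_chart_source E x),
    fderiv_transition_self hz]

/-- The identification of tangent spaces is compatible with transition maps. -/
theorem chartSymmDeriv_transition (hz : z ∈ transitionDomain E x y) :
    chartSymmDeriv y (transition E x y z) ∘L fderiv ℝ (transition E x y) z =
      chartSymmDeriv x z := by
  rw [chartSymmDeriv_eq hz.1, chartSymmDeriv_eq (transition_mem hz hz).1,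
    symm_transition hz, fderiv_transition_comp hz (mem_transitionDomain_symm hz.1)]

theorem chartDeriv_chartSymmDeriv (hz : z ∈ transitionDomain E x y) :
    chartDeriv y ((chartAt E x).symm z) ∘L chartSymmDeriv x z = fderiv ℝ (transition E x y) z := by
  rw [chartDeriv_eq hz.2, chartSymmDeriv_eq hz.1]
  exact fderiv_transition_comp (mem_transitionDomain_symm hz.1) hz

theorem chartSymmDeriv_chartDeriv (hx : x ∈ (chartAt E y).source) :
    chartSymmDeriv y (chartAt E y x) ∘L chartDeriv y x = ContinuousLinearMap.id ℝ E := by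
  rw [chartDeriv_eq hx]
  have h1 : transition E x y (chartAt E x x) = chartAt E y x := by
    rw [transition, (chartAt E x).left_inv (mem_chart_source E x)]
  have h := chartSymmDeriv_transition (mem_transitionDomain_chart hx)
  rw [h1] at h
  rw [h, chartSymmDeriv_self]

theorem localForm_transition {k : ℕ} (α : M → E [⋀^Fin k]→L[ℝ] ℂ) (hz : z ∈ transitionDomain E x y) :
    localForm α x z = (localForm α y (transition E x y z)).compContinuousLinearMap
      (fderiv ℝ (transition E x y) z) := by
  rw [localForm, localForm, symm_transition hz, ← chartSymmDeriv_transition hz]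
  rfl

theorem localMetric_transition (B : M → E →L[ℝ] E →L[ℝ] ℝ) (hz : z ∈ transitionDomain E x y)
    (u v : E) : localMetric B x z u v = localMetric B y (transition E x y z)
      (fderiv ℝ (transition E x y) z u) (fderiv ℝ (transition E x y) z v) := by
  simp only [localMetric, symm_transition hz, ← chartSymmDeriv_transition hz]
  rfl

theorem localForm_self {k : ℕ} (α : M → E [⋀^Fin k]→L[ℝ] ℂ) :
    localForm α x (chartAt E x x) = α x := by
  rw [localForm, chartSymmDeriv_self, (chartAt E x).left_inv (mem_chart_source E x)]
  rfl

theorem localMetric_self (B : M → E →L[ℝ] E →L[ℝ] ℝ) :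
    localMetric B x (chartAt E x x) = B x := by
  rw [localMetric, chartSymmDeriv_self, (chartAt E x).left_inv (mem_chart_source E x)]
  rfl

end Smooth

end Transition

/-! ### A Kähler metric in a chart. -/

section KaehlerChart

set_option linter.unusedSectionVars false

variable {E : Type*} [NormedAddCommGroup E] [NormedSpace ℂ E] [FiniteDimensional ℂ E]
  {M : Type*} [TopologicalSpace M] [ChartedSpace E M] [IsManifold 𝓘(ℂ, E) ∞ M]
  {x y : M} {z : E}

/-- The reference chart at the moving point may jump, so smoothness has to be stated in the tangent
bundle. In the trivialisation at a fixed point the vector becomes the derivative of a fixed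
transition map. -/
theorem contMDiffAt_chartSymmDeriv (hz : z ∈ (chartAt E x).target) (u : E) :
    ContMDiffAt 𝓘(ℝ, E) (𝓘(ℝ, E).prod 𝓘(ℝ, E)) ∞
      (fun z : E => (⟨(chartAt E x).symm z, chartSymmDeriv x z u⟩ :
        TangentBundle 𝓘(ℝ, E) M)) z := by
  rw [Bundle.contMDiffAt_totalSpace]
  refine ⟨(contMDiffOn_chart_symm (n := ∞) (I := 𝓘(ℝ, E)) (x := x)).contMDiffAt
    ((chartAt E x).open_target.mem_nhds hz), ?_⟩
  rw [contMDiffAt_iff_contDiffAt]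
  set y := (chartAt E x).symm z with hy
  have hzy : z ∈ transitionDomain E x y := mem_transitionDomain_symm hz
  have h1 : ContDiffAt ℝ ∞ (fun z => fderiv ℝ (transition E x y) z u) z :=
    contDiffAt_fderiv_apply (contDiffAt_transition hzy) u
  refine h1.congr_of_eventuallyEq (Filter.eventually_of_mem
    (isOpen_transitionDomain.mem_nhds hzy) fun t ht => ?_)
  have h2 := congrArg (fun L : E →L[ℝ] E => L u) (chartDeriv_chartSymmDeriv ht)
  rw [chartDeriv_eq ht.2] at h2
  refine Eq.trans ?_ h2
  simp only [TangentBundle.trivializationAt_apply, mfld_simps, fderivWithin_univ]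
  rfl

theorem KaehlerMetric.contDiffAt_localMetric (g : KaehlerMetric E M)
    (hz : z ∈ (chartAt E x).target) : ContDiffAt ℝ ∞ (localMetric g.metric x) z := by
  refine contDiffAt_bilin fun u v => ?_
  have h1 : ContMDiffAt 𝓘(ℝ, E) 𝓘(ℝ, E) ∞ (chartAt E x).symm z :=
    (contMDiffOn_chart_symm (n := ∞) (I := 𝓘(ℝ, E)) (x := x)).contMDiffAt
      ((chartAt E x).open_target.mem_nhds hz)
  have h2 := (g.contMDiff ((chartAt E x).symm z)).comp z h1
  have h3 := ContMDiffAt.clm_bundle_apply₂ (F₁ := E) (F₂ := E) (F₃ := ℝ)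
    (E₁ := fun x : M => TangentSpace 𝓘(ℝ, E) x) (E₂ := fun x : M => TangentSpace 𝓘(ℝ, E) x)
    (E₃ := fun _ : M => ℝ) h2
    (contMDiffAt_chartSymmDeriv hz u) (contMDiffAt_chartSymmDeriv hz v)
  rw [Bundle.contMDiffAt_totalSpace, contMDiffAt_iff_contDiffAt] at h3
  exact h3.2

theorem fundamentalForm_comp (B : E →L[ℝ] E →L[ℝ] ℝ) (L : E →L[ℝ] E)
    (hL : ∀ v, L (Complex.I • v) = Complex.I • L v) :
    fundamentalForm (B.bilinearComp L L) = (fundamentalForm B).compContinuousLinearMap L := by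
  ext v
  have hv : v = ![v 0, v 1] := by ext i; fin_cases i <;> rfl
  have hv' : L ∘ v = ![L (v 0), L (v 1)] := by ext i; fin_cases i <;> rfl
  rw [hv, fundamentalForm_apply, ← hv, ContinuousAlternatingMap.compContinuousLinearMap_apply, hv',
    fundamentalForm_apply, ← hL, ← hL]
  rfl

theorem KaehlerMetric.localForm_form (g : KaehlerMetric E M) (hz : z ∈ (chartAt E x).target) :
    localForm g.form x z = fundamentalForm (localMetric g.metric x z) :=
  (fundamentalForm_comp _ _ (chartSymmDeriv_I hz)).symm

theorem KaehlerMetric.contDiffAt_localForm_form (g : KaehlerMetric E M)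
    (hz : z ∈ (chartAt E x).target) : ContDiffAt ℝ ∞ (localForm g.form x) z := by
  have h1 : localForm g.form x =ᶠ[𝓝 z] fun z => fundamentalForm (localMetric g.metric x z) :=
    Filter.eventually_of_mem ((chartAt E x).open_target.mem_nhds hz) fun _ h => g.localForm_form h
  refine ContDiffAt.congr_of_eventuallyEq (contDiffAt_alternating fun v => ?_) h1
  have hv : v = ![v 0, v 1] := by ext i; fin_cases i <;> rfl
  rw [hv]
  simp only [fundamentalForm_apply]
  have h : ∀ u v : E, ContDiffAt ℝ ∞ (fun z => localMetric g.metric x z u v) z := fun u v =>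
    contDiffAt_bilin_apply (g.contDiffAt_localMetric hz) contDiffAt_const contDiffAt_const
  exact Complex.ofRealCLM.contDiff.contDiffAt.comp z
    (contDiffAt_const.mul ((h _ _).sub (h _ _)))

/-- The field `closed` speaks only of the centre of each chart. At another point `z` the local form
is the pullback of the one in the chart centred there, and exterior derivatives commute with
pullback. -/
theorem KaehlerMetric.extDeriv_localForm_form (g : KaehlerMetric E M)
    (hz : z ∈ (chartAt E x).target) : extDeriv (localForm g.form x) z = 0 := by
  set y := (chartAt E x).symm z with hy
  have hzy : z ∈ transitionDomain E x y := mem_transitionDomain_symm hz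
  have h1 : localForm g.form x =ᶠ[𝓝 z] fun z => (localForm g.form y
      (transition E x y z)).compContinuousLinearMap (fderiv ℝ (transition E x y) z) :=
    Filter.eventually_of_mem (isOpen_transitionDomain.mem_nhds hzy) fun _ h =>
      localForm_transition _ h
  have h2 : transition E x y z = chartAt E y y := rfl
  have h3 : DifferentiableAt ℝ (localForm g.form y) (transition E x y z) :=
    (g.contDiffAt_localForm_form (mem_chart_target E y)).differentiableAt (by simp)
  have h4 : extDeriv (localForm g.form y) (transition E x y z) = 0 := g.closed y
  rw [h1.extDeriv_eq, extDeriv_pullback (r := ∞) h3 (contDiffAt_transition hzy)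
    (by simpa using WithTop.coe_le_coe.2 (le_top : (2 : ℕ∞) ≤ ⊤)), h4]
  rfl

theorem KaehlerMetric.metric_symm (g : KaehlerMetric E M) (x : M) (u v : E) :
    g.metric x u v = g.metric x v u :=
  g.symm x u v

theorem KaehlerMetric.metric_I (g : KaehlerMetric E M) (x : M) (u v : E) :
    g.metric x (Complex.I • u) (Complex.I • v) = g.metric x u v :=
  g.inner_J x u v

theorem KaehlerMetric.metric_pos (g : KaehlerMetric E M) (x : M) {u : E} (hu : u ≠ 0) :
    0 < g.metric x u u :=
  g.pos x u hu

theorem localMetric_apply (B : M → E →L[ℝ] E →L[ℝ] ℝ) (x : M) (z u v : E) :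
    localMetric B x z u v =
      B ((chartAt E x).symm z) (chartSymmDeriv x z u) (chartSymmDeriv x z v) := rfl

theorem chartSymmDeriv_ne_zero (hz : z ∈ (chartAt E x).target) {u : E} (hu : u ≠ 0) :
    chartSymmDeriv x z u ≠ 0 := fun h0 => hu (by
  have h1 := chartDeriv_chartSymmDeriv (mem_transitionDomain_self hz)
  rw [fderiv_transition_self hz] at h1
  have h2 := congrArg (fun L : E →L[ℝ] E => L u) h1
  simpa [h0] using h2.symm)

/-- The local expression of a Kähler metric. -/
theorem KaehlerMetric.isLocalKaehler (g : KaehlerMetric E M) (x : M) :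
    IsLocalKaehler (localMetric g.metric x) (chartAt E x).target where
  isOpen := (chartAt E x).open_target
  smooth z hz := (g.contDiffAt_localMetric hz).contDiffWithinAt
  symm z hz u v := by rw [localMetric_apply, localMetric_apply, g.metric_symm]
  inv z hz u v := by
    rw [localMetric_apply, localMetric_apply, chartSymmDeriv_I hz, chartSymmDeriv_I hz, g.metric_I]
  pos z hz u hu := by
    rw [localMetric_apply]
    exact g.metric_pos _ (chartSymmDeriv_ne_zero hz hu)
  closed z hz := by
    have h1 : (fun z => fundamentalForm (localMetric g.metric x z)) =ᶠ[𝓝 z]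
        localForm g.form x :=
      Filter.eventually_of_mem ((chartAt E x).open_target.mem_nhds hz) fun _ h =>
        (g.localForm_form h).symm
    rw [h1.extDeriv_eq, g.extDeriv_localForm_form hz]

end KaehlerChart

/-! ### Behaviour under holomorphic changes of coordinates. -/

section Naturality

set_option linter.unusedSectionVars false
set_option maxSynthPendingDepth 3

variable {E F : Type*} [NormedAddCommGroup E] [NormedSpace ℂ E] [FiniteDimensional ℂ E]
  [NormedAddCommGroup F] [NormedSpace ℂ F] [FiniteDimensional ℂ F]
  {G G' : F → F →L[ℝ] F →L[ℝ] ℝ} {U U' : Set F}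

theorem differentiableAt_fderiv {f : E → F} {z : E} (hf : ContDiffAt ℝ ∞ f z) :
    DifferentiableAt ℝ (fderiv ℝ f) z :=
  (hf.fderiv_right (m := ∞) (by simp)).differentiableAt (by simp)

theorem eventually_differentiableAt {f : E → F} {z : E} (hf : ContDiffAt ℝ ∞ f z) :
    ∀ᶠ y in 𝓝 z, DifferentiableAt ℝ f y :=
  ((hf.of_le (m := 1) (by simp)).eventually (by simp)).mono fun _ h =>
    h.differentiableAt (by simp)

/-- The transformation law of the Christoffel symbols. -/
theorem christoffel_pullback (hG : IsLocalKaehler G U) (hG' : IsLocalKaehler G' U') {τ : F → F}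
    {w : F} (hw' : w ∈ U') (hw : τ w ∈ U) (hτ : ContDiffAt ℝ ∞ τ w)
    (hsurj : Function.Surjective (fderiv ℝ τ w))
    (h : ∀ᶠ z in 𝓝 w, ∀ u v, G' z u v = G (τ z) (fderiv ℝ τ z u) (fderiv ℝ τ z v)) (a b : F) :
    fderiv ℝ (fderiv ℝ τ) w a b + christoffel G (τ w) (fderiv ℝ τ w a) (fderiv ℝ τ w b) =
      fderiv ℝ τ w (christoffel G' w a b) := by
  have hd := differentiableAt_fderiv hτ
  have hτd := hτ.differentiableAt (n := ∞) (by simp)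
  have hG1 := hG.differentiableAt hw
  have hG2 := hG'.differentiableAt hw'
  have key : ∀ c u v, fderiv ℝ G' w c u v =
      fderiv ℝ G (τ w) (fderiv ℝ τ w c) (fderiv ℝ τ w u) (fderiv ℝ τ w v) +
      G (τ w) (fderiv ℝ (fderiv ℝ τ) w c u) (fderiv ℝ τ w v) +
      G (τ w) (fderiv ℝ τ w u) (fderiv ℝ (fderiv ℝ τ) w c v) := fun c u v => by
    rw [← fderiv_bilin_apply hG2]
    have h1 : (fun z => G' z u v) =ᶠ[𝓝 w] fun z => G (τ z) (fderiv ℝ τ z u) (fderiv ℝ τ z v) :=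
      h.mono fun z hz => hz u v
    rw [h1.fderiv_eq]
    have h2 := ((hG1.hasFDerivAt.comp w hτd.hasFDerivAt).clm_apply
      (hd.hasFDerivAt.clm_apply (hasFDerivAt_const u w))).clm_apply
      (hd.hasFDerivAt.clm_apply (hasFDerivAt_const v w))
    refine (congrArg (fun L : F →L[ℝ] ℝ => L c) h2.fderiv).trans ?_
    simp only [add_apply, ContinuousLinearMap.comp_apply, ContinuousLinearMap.flip_apply,
      Function.comp_apply, zero_apply, map_zero, zero_add]
    ring
  have hs : ∀ a b, fderiv ℝ (fderiv ℝ τ) w a b = fderiv ℝ (fderiv ℝ τ) w b a := fun a b => by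
    rw [← fderiv_fderiv_apply hτ, ← fderiv_fderiv_apply hτ, fderiv_fderiv_symm hτ]
  -- By surjectivity it suffices to test against vectors Dτ t. The Koszul formula for `G'` then
  -- produces the terms in D²τ, of which all but one cancel by symmetry.
  refine metric_nondegenerate (hG.pos _ hw) fun t => ?_
  obtain ⟨t, rfl⟩ := hsurj t
  have h3 := hG'.metric_christoffel hw' a b t
  rw [h.self_of_nhds, key, key, key] at h3
  rw [h3, map_add, add_apply, hG.metric_christoffel hw, hs t a, hs t b, hs b a,
    hG.symm _ hw (fderiv ℝ τ w b) (fderiv ℝ (fderiv ℝ τ) w a t)]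
  ring

variable {f f' : E → F} {z : E}

theorem localCurl_congr (h : f =ᶠ[𝓝 z] f') (v w : E) : localCurl G f z v w = localCurl G f' z v w := by
  have h1 : ∀ v, (fun y => holPart (fderiv ℝ f y) v) =ᶠ[𝓝 z] fun y => holPart (fderiv ℝ f' y) v :=
    fun v => h.fderiv.mono fun y hy => by
      beta_reduce
      rw [hy]
  simp only [localCurl]
  rw [(h1 v).fderiv_eq, (h1 w).fderiv_eq, h.fderiv_eq, h.self_of_nhds]

theorem differentiableAt_holPart (hf : ContDiffAt ℝ ∞ f z) :
    DifferentiableAt ℝ (fun y => holPart (fderiv ℝ f y)) z := by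
  have hd := differentiableAt_fderiv hf
  unfold holPart
  exact (hd.fun_sub ((hd.clm_comp (differentiableAt_const (mulI E))).fun_const_smul
    Complex.I)).fun_const_smul (2 : ℝ)⁻¹

/-- Holomorphy of `τ` makes ∂(f ∘ τ) = ∂f ∘ Dτ. Differentiating it adds ∂f(D²τ(v, w)), which is
symmetric and disappears in the curl. -/
theorem localCurl_comp_right {τ : E → E} (hτ : ContDiffAt ℝ ∞ τ z)
    (hI : ∀ᶠ y in 𝓝 z, ∀ v, fderiv ℝ τ y (Complex.I • v) = Complex.I • fderiv ℝ τ y v)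
    (hf : ContDiffAt ℝ ∞ f (τ z)) (v w : E) :
    localCurl G (f ∘ τ) z v w = localCurl G f (τ z) (fderiv ℝ τ z v) (fderiv ℝ τ z w) := by
  have hτd := hτ.differentiableAt (n := ∞) (by simp)
  have hfd := hf.differentiableAt (n := ∞) (by simp)
  have h0 : ∀ᶠ y in 𝓝 z, fderiv ℝ (f ∘ τ) y = fderiv ℝ f (τ y) ∘L fderiv ℝ τ y := by
    filter_upwards [eventually_differentiableAt hτ,
      hτd.continuousAt.eventually (eventually_differentiableAt hf)] with y h1 h2
    exact fderiv_comp y h2 h1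
  have h1 : ∀ w, (fun y => holPart (fderiv ℝ (f ∘ τ) y) w) =ᶠ[𝓝 z]
      fun y => holPart (fderiv ℝ f (τ y)) (fderiv ℝ τ y w) := fun w => by
    filter_upwards [h0, hI] with y h1 h2
    rw [h1, holPart_apply, holPart_apply, ContinuousLinearMap.comp_apply,
      ContinuousLinearMap.comp_apply, h2]
  have hP := differentiableAt_holPart hf
  have hd := differentiableAt_fderiv hτ
  have h2 : ∀ v w, fderiv ℝ (fun y => holPart (fderiv ℝ (f ∘ τ) y) w) z v =
      fderiv ℝ (fun y => holPart (fderiv ℝ f y) (fderiv ℝ τ z w)) (τ z) (fderiv ℝ τ z v) +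
      holPart (fderiv ℝ f (τ z)) (fderiv ℝ (fderiv ℝ τ) z v w) := fun v w => by
    rw [(h1 w).fderiv_eq]
    have h3 := (hP.hasFDerivAt.comp z hτd.hasFDerivAt).clm_apply
      (hd.hasFDerivAt.clm_apply (hasFDerivAt_const w z))
    have h4 := hP.hasFDerivAt.clm_apply (hasFDerivAt_const (fderiv ℝ τ z w) (τ z))
    rw [h4.fderiv]
    refine (congrArg (fun L : E →L[ℝ] F => L v) h3.fderiv).trans ?_
    simp [add_comm]
  have hs : fderiv ℝ (fderiv ℝ τ) z v w = fderiv ℝ (fderiv ℝ τ) z w v := by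
    rw [← fderiv_fderiv_apply hτ, ← fderiv_fderiv_apply hτ, fderiv_fderiv_symm hτ]
  have h5 : ∀ w, holPart (fderiv ℝ (f ∘ τ) z) w = holPart (fderiv ℝ f (τ z)) (fderiv ℝ τ z w) :=
    fun w => (h1 w).self_of_nhds
  rw [localCurl, localCurl, h2, h2, hs, h5, h5,
    h0.self_of_nhds]
  simp only [Function.comp_apply, ContinuousLinearMap.comp_apply]
  abel

/-- Differentiating ∂(τ ∘ f) = Dτ(∂f) adds terms in D²τ, which are precisely what
`christoffel_pullback` absorbs into the connection. -/
theorem localCurl_comp_left (hG : IsLocalKaehler G U) (hG' : IsLocalKaehler G' U') {τ : F → F}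
    (hw' : f z ∈ U') (hw : τ (f z) ∈ U) (hτ : ContDiffAt ℝ ∞ τ (f z))
    (hI : ∀ᶠ y in 𝓝 (f z), ∀ v, fderiv ℝ τ y (Complex.I • v) = Complex.I • fderiv ℝ τ y v)
    (hsurj : Function.Surjective (fderiv ℝ τ (f z)))
    (h : ∀ᶠ y in 𝓝 (f z), ∀ u v, G' y u v = G (τ y) (fderiv ℝ τ y u) (fderiv ℝ τ y v))
    (hf : ContDiffAt ℝ ∞ f z) (v w : E) :
    localCurl G (τ ∘ f) z v w = fderiv ℝ τ (f z) (localCurl G' f z v w) := by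
  have hτd := hτ.differentiableAt (n := ∞) (by simp)
  have hfd := hf.differentiableAt (n := ∞) (by simp)
  have h0 : ∀ᶠ y in 𝓝 z, fderiv ℝ (τ ∘ f) y = fderiv ℝ τ (f y) ∘L fderiv ℝ f y := by
    filter_upwards [eventually_differentiableAt hf,
      hfd.continuousAt.eventually (eventually_differentiableAt hτ)] with y h1 h2
    exact fderiv_comp y h2 h1
  have h1 : ∀ w, (fun y => holPart (fderiv ℝ (τ ∘ f) y) w) =ᶠ[𝓝 z]
      fun y => fderiv ℝ τ (f y) (holPart (fderiv ℝ f y) w) := fun w => by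
    filter_upwards [h0, hfd.continuousAt.eventually hI] with y h1 h2
    rw [h1, holPart_apply, holPart_apply, ContinuousLinearMap.comp_apply,
      ContinuousLinearMap.comp_apply, map_smul (fderiv ℝ τ (f y)) (2 : ℝ)⁻¹, map_sub, h2]
  have hP := fun w => (contDiffAt_holPart hf w).differentiableAt (n := ∞) (by simp)
  have hd := differentiableAt_fderiv hτ
  have h2 : ∀ v w, fderiv ℝ (fun y => holPart (fderiv ℝ (τ ∘ f) y) w) z v =
      fderiv ℝ τ (f z) (fderiv ℝ (fun y => holPart (fderiv ℝ f y) w) z v) +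
      fderiv ℝ (fderiv ℝ τ) (f z) (fderiv ℝ f z v) (holPart (fderiv ℝ f z) w) := fun v w => by
    rw [(h1 w).fderiv_eq]
    have h3 := (hd.hasFDerivAt.comp z hfd.hasFDerivAt).clm_apply (hP w).hasFDerivAt
    refine (congrArg (fun L : E →L[ℝ] F => L v) h3.fderiv).trans ?_
    simp
  have h3 := christoffel_pullback hG hG' hw' hw hτ hsurj h
  have h5 : ∀ w, holPart (fderiv ℝ (τ ∘ f) z) w = fderiv ℝ τ (f z) (holPart (fderiv ℝ f z) w) :=
    fun w => (h1 w).self_of_nhds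
  rw [localCurl, localCurl, h2, h2, h5, h5,
    h0.self_of_nhds]
  simp only [Function.comp_apply, ContinuousLinearMap.comp_apply, map_add, map_sub, ← h3]
  abel

end Naturality

/-! ### Maps and sections in charts. -/

section LocalMap

set_option linter.unusedSectionVars false

variable {E : Type*} [NormedAddCommGroup E] [NormedSpace ℂ E] [FiniteDimensional ℂ E]
  {F : Type*} [NormedAddCommGroup F] [NormedSpace ℂ F] [FiniteDimensional ℂ F]
  {M : Type*} [TopologicalSpace M] [ChartedSpace E M] [IsManifold 𝓘(ℂ, E) ∞ M]
  {N : Type*} [TopologicalSpace N] [ChartedSpace F N] [IsManifold 𝓘(ℂ, F) ∞ N]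
  {f : M → N} {x : M} {z : E}

variable (E F) in
/-- The domain of the local expression of `f` at `x`. -/
def localDomain (f : M → N) (x : M) : Set E :=
  (chartAt E x).target ∩ (chartAt E x).symm ⁻¹' (f ⁻¹' (chartAt F (f x)).source)

theorem isOpen_localDomain (hf : Continuous f) : IsOpen (localDomain E F f x) :=
  (chartAt E x).isOpen_inter_preimage_symm ((chartAt F (f x)).open_source.preimage hf)

theorem mem_localDomain : chartAt E x x ∈ localDomain E F f x :=
  ⟨mem_chart_target E x, by
    rw [Set.mem_preimage, (chartAt E x).left_inv (mem_chart_source E x)]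
    exact mem_chart_source F (f x)⟩

theorem localMap_self : localMap (E := E) (F := F) f x (chartAt E x x) = chartAt F (f x) (f x) := by
  rw [localMap, (chartAt E x).left_inv (mem_chart_source E x)]

theorem localMap_mem (hz : z ∈ localDomain E F f x) :
    localMap (F := F) f x z ∈ (chartAt F (f x)).target :=
  (chartAt F (f x)).map_source hz.2

theorem contDiffAt_localMap (hf : ContMDiff 𝓘(ℝ, E) 𝓘(ℝ, F) ∞ f) (hz : z ∈ localDomain E F f x) :
    ContDiffAt ℝ ∞ (localMap (F := F) f x) z := by
  rw [← contMDiffAt_iff_contDiffAt]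
  have h1 : ContMDiffAt 𝓘(ℝ, E) 𝓘(ℝ, E) ∞ (chartAt E x).symm z :=
    (contMDiffOn_chart_symm (n := ∞) (I := 𝓘(ℝ, E)) (x := x)).contMDiffAt
      ((chartAt E x).open_target.mem_nhds hz.1)
  have h2 : ContMDiffAt 𝓘(ℝ, F) 𝓘(ℝ, F) ∞ (chartAt F (f x)) (f ((chartAt E x).symm z)) :=
    (contMDiffOn_chart (n := ∞) (I := 𝓘(ℝ, F)) (x := f x)).contMDiffAt
      ((chartAt F (f x)).open_source.mem_nhds hz.2)
  exact h2.comp z ((hf _).comp z h1)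

theorem mapDeriv_eq (hf : ContMDiff 𝓘(ℝ, E) 𝓘(ℝ, F) ∞ f) (x : M) :
    mapDeriv (E := E) (F := F) f x = fderiv ℝ (localMap f x) (chartAt E x x) := by
  have h : MDifferentiableAt 𝓘(ℝ, E) 𝓘(ℝ, F) f x := (hf x).mdifferentiableAt (by simp)
  rw [mapDeriv, mfderiv]
  refine (if_pos h).trans ?_
  simp only [writtenInExtChartAt, mfld_simps, fderivWithin_univ]
  rfl

/-- The change of charts for the local expression of a map. -/
theorem localMap_eventuallyEq (hf : Continuous f) (hz : z ∈ localDomain E F f x) :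
    localMap (F := F) f x =ᶠ[𝓝 z] (transition F (f ((chartAt E x).symm z)) (f x) ∘
      localMap (F := F) f ((chartAt E x).symm z)) ∘ transition E x ((chartAt E x).symm z) := by
  have h1 := mem_transitionDomain_symm hz.1
  have h2 : IsOpen ((chartAt E x).target ∩ (chartAt E x).symm ⁻¹'
      (f ⁻¹' (chartAt F (f ((chartAt E x).symm z))).source)) :=
    (chartAt E x).isOpen_inter_preimage_symm ((chartAt F _).open_source.preimage hf)
  filter_upwards [isOpen_transitionDomain.mem_nhds h1,
    h2.mem_nhds ⟨hz.1, mem_chart_source F _⟩] with t ht ht'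
  simp only [Function.comp_apply, localMap, symm_transition ht]
  rw [transition, (chartAt F (f ((chartAt E x).symm z))).left_inv ht'.2]

theorem fderiv_localMap (hf : ContMDiff 𝓘(ℝ, E) 𝓘(ℝ, F) ∞ f) (hz : z ∈ localDomain E F f x) :
    fderiv ℝ (localMap f x) z = chartDeriv (E := F) (f x) (f ((chartAt E x).symm z)) ∘L
      mapDeriv f ((chartAt E x).symm z) ∘L chartSymmDeriv x z := by
  have h1 := mem_transitionDomain_symm hz.1
  have hy : transition E x ((chartAt E x).symm z) z = chartAt E _ ((chartAt E x).symm z) := rfl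
  have h3 := (contDiffAt_localMap (F := F) hf (x := (chartAt E x).symm z)
    mem_localDomain).differentiableAt (by simp)
  have h4 : f ((chartAt E x).symm z) ∈ (chartAt F (f x)).source := hz.2
  rw [(localMap_eventuallyEq hf.continuous hz).fderiv_eq, chartDeriv_eq h4, chartSymmDeriv_eq hz.1,
    mapDeriv_eq hf]
  rw [← hy] at h3 ⊢
  have h5 : localMap f ((chartAt E x).symm z) (transition E x ((chartAt E x).symm z) z) =
    chartAt F (f ((chartAt E x).symm z)) (f ((chartAt E x).symm z)) := localMap_self
  have h6 := differentiableAt_transition (mem_transitionDomain_chart h4)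
  rw [← h5] at h6 ⊢
  rw [fderiv_comp z (h6.comp _ h3) (differentiableAt_transition h1), fderiv_comp _ h6 h3]
  rfl

theorem chartDeriv_I {y x : N} (h : y ∈ (chartAt F x).source) (v : F) :
    chartDeriv x y (Complex.I • v) = Complex.I • chartDeriv x y v := by
  rw [chartDeriv_eq h, fderiv_transition_I (mem_transitionDomain_chart h)]

theorem oneForm_apply {V W : Type*} [NormedAddCommGroup V] [NormedSpace ℝ V] [NormedAddCommGroup W]
    [NormedSpace ℝ W] (L : V →L[ℝ] W) (v : Fin 1 → V) : oneForm L v = L (v 0) := rfl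

theorem localSection_apply {k : ℕ} (α : M → E [⋀^Fin k]→L[ℝ] F) (v : Fin k → E) :
    localSection f α x z v = chartDeriv (f x) (f ((chartAt E x).symm z))
      (α ((chartAt E x).symm z) fun i => chartSymmDeriv x z (v i)) := rfl

theorem localSection_del (hf : ContMDiff 𝓘(ℝ, E) 𝓘(ℝ, F) ∞ f) (hz : z ∈ localDomain E F f x) :
    localSection f (del (F := F) f) x z = oneForm (holPart (fderiv ℝ (localMap f x) z)) := by
  ext v
  rw [localSection_apply, del, oneForm_apply, oneForm_apply, fderiv_localMap hf hz, holPart_apply,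
    holPart_apply]
  simp only [ContinuousLinearMap.comp_apply, chartSymmDeriv_I hz.1, map_smul, map_sub,
    chartDeriv_I hz.2]

theorem localSection_delbar (hf : ContMDiff 𝓘(ℝ, E) 𝓘(ℝ, F) ∞ f) (hz : z ∈ localDomain E F f x) :
    localSection f (delbar (F := F) f) x z = oneForm (antiPart (fderiv ℝ (localMap f x) z)) := by
  ext v
  rw [localSection_apply, delbar, oneForm_apply, oneForm_apply, fderiv_localMap hf hz,
    antiPart_apply, antiPart_apply]
  simp only [ContinuousLinearMap.comp_apply, chartSymmDeriv_I hz.1, map_smul, map_add,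
    chartDeriv_I hz.2]

theorem herm_bilinearComp (B : F →L[ℝ] F →L[ℝ] ℝ) (L : F →L[ℝ] F)
    (hL : ∀ v, L (Complex.I • v) = Complex.I • L v) (u v : F) :
    herm (B.bilinearComp L L) u v = herm B (L u) (L v) := by
  simp only [herm_apply, ContinuousLinearMap.bilinearComp_apply, hL]

/-- `chartSymmDeriv` is complex linear and inverts `chartDeriv`, so transporting both sections and
the metric to a fixed chart of `N` leaves the Hermitian pairing unchanged. -/
theorem localForm_bracket {p q : ℕ} (h : KaehlerMetric F N) (ψ : M → E [⋀^Fin p]→L[ℝ] F)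
    (ξ : M → E [⋀^Fin q]→L[ℝ] F) (hz : z ∈ localDomain E F f x) :
    localForm (bracket h f ψ ξ) x z = wedge (herm (localMetric h.metric (f x) (localMap f x z)))
      (localSection f ψ x z) (localSection f ξ x z) := by
  have h1 := chartSymmDeriv_chartDeriv (E := F) hz.2
  have h2 : ∀ s t, herm (localMetric h.metric (f x) (localMap f x z))
      (chartDeriv (f x) (f ((chartAt E x).symm z)) s)
      (chartDeriv (f x) (f ((chartAt E x).symm z)) t) =
      herm (h.metric (f ((chartAt E x).symm z))) s t := fun s t => by
    have h3 : ∀ s, chartSymmDeriv (f x) (localMap f x z)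
        (chartDeriv (f x) (f ((chartAt E x).symm z)) s) = s := fun s =>
      congrArg (fun L : F →L[ℝ] F => L s) h1
    rw [localMetric, herm_bilinearComp _ _ (chartSymmDeriv_I (localMap_mem hz)), h3, h3]
    congr 2
    exact congrArg (fun y => herm (h.metric y)) ((chartAt F (f x)).left_inv hz.2)
  ext v
  rw [localForm, ContinuousAlternatingMap.compContinuousLinearMap_apply, bracket, wedge_apply,
    wedge_apply]
  simp only [localSection_apply, h2]
  rfl

end LocalMap

/-! ### The operators ∂_{E'} and ∂̄_{E'} and the bracket in charts. -/

section CovariantDerivative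

set_option linter.unusedSectionVars false
set_option maxSynthPendingDepth 3

variable {E : Type*} [NormedAddCommGroup E] [NormedSpace ℂ E] [FiniteDimensional ℂ E]
  {F : Type*} [NormedAddCommGroup F] [NormedSpace ℂ F] [FiniteDimensional ℂ F]
  {M : Type*} [TopologicalSpace M] [ChartedSpace E M] [IsManifold 𝓘(ℂ, E) ∞ M]
  {N : Type*} [TopologicalSpace N] [ChartedSpace F N] [IsManifold 𝓘(ℂ, F) ∞ N]
  {f : M → N} {x : M} {z : E}

theorem alternatizeUncurryFin_two {V W : Type*} [NormedAddCommGroup V] [NormedSpace ℝ V]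
    [NormedAddCommGroup W] [NormedSpace ℝ W] (L : V →L[ℝ] V [⋀^Fin 1]→L[ℝ] W) (u v : V) :
    ContinuousAlternatingMap.alternatizeUncurryFin L ![u, v] = L u ![v] - L v ![u] := by
  have h := alternatizeUncurryFin_eq_altSum L ![u, v]
  rw [h]
  erw [altSum_two]
  have e : ∀ a b : V, ![a, b] ∘ Fin.succ = ![b] := fun a b => by ext i; fin_cases i; rfl
  rw [e, e]
  simp

theorem covDeriv_apply (h : KaehlerMetric F N) {α : M → E [⋀^Fin 1]→L[ℝ] F} {A : E → E →L[ℝ] F}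
    (hα : localSection f α x =ᶠ[𝓝 (chartAt E x x)] fun z => oneForm (A z))
    (hA : ∀ v, ContDiffAt ℝ ∞ (fun z => A z v) (chartAt E x x)) (u v : E) :
    covDeriv h f α x u ![v] = fderiv ℝ (fun z => A z v) (chartAt E x x) u +
      christoffel (localMetric h.metric (f x)) (chartAt F (f x) (f x)) (mapDeriv f x u)
        (α x ![v]) := by
  have h1 : DifferentiableAt ℝ (fun z => oneForm (A z)) (chartAt E x x) :=
    (contDiffAt_alternating (n := ∞) fun t => hA (t 0)).differentiableAt (by simp)
  rw [covDeriv, hα.fderiv_eq, add_apply, ContinuousAlternatingMap.add_apply,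
    ← fderiv_alternating_apply h1]
  rfl

variable (h : KaehlerMetric F N) (hf : ContMDiff 𝓘(ℝ, E) 𝓘(ℝ, F) ∞ f)

include hf

theorem covDeriv_del (u v : E) :
    covDeriv h f (del f) x u ![v] = (2 : ℝ)⁻¹ •
      (fderiv ℝ (fderiv ℝ (localMap f x)) (chartAt E x x) u v -
        Complex.I • fderiv ℝ (fderiv ℝ (localMap f x)) (chartAt E x x) u (Complex.I • v)) +
      christoffel (localMetric h.metric (f x)) (localMap f x (chartAt E x x))
        (fderiv ℝ (localMap f x) (chartAt E x x) u)
        (holPart (fderiv ℝ (localMap f x) (chartAt E x x)) v) := by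
  have hz := mem_localDomain (E := E) (F := F) (f := f) (x := x)
  have h1 : localSection f (del (F := F) f) x =ᶠ[𝓝 (chartAt E x x)]
      fun z => oneForm (holPart (fderiv ℝ (localMap f x) z)) :=
    Filter.eventually_of_mem ((isOpen_localDomain hf.continuous).mem_nhds hz)
      fun _ ht => localSection_del hf ht
  have hc := contDiffAt_localMap hf hz
  rw [covDeriv_apply h h1 (contDiffAt_holPart hc), fderiv_holPart hc, mapDeriv_eq hf, localMap_self,
    del, mapDeriv_eq hf]
  rfl

theorem covDeriv_delbar (u v : E) :
    covDeriv h f (delbar f) x u ![v] = (2 : ℝ)⁻¹ •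
      (fderiv ℝ (fderiv ℝ (localMap f x)) (chartAt E x x) u v +
        Complex.I • fderiv ℝ (fderiv ℝ (localMap f x)) (chartAt E x x) u (Complex.I • v)) +
      christoffel (localMetric h.metric (f x)) (localMap f x (chartAt E x x))
        (fderiv ℝ (localMap f x) (chartAt E x x) u)
        (antiPart (fderiv ℝ (localMap f x) (chartAt E x x)) v) := by
  have hz := mem_localDomain (E := E) (F := F) (f := f) (x := x)
  have h1 : localSection f (delbar (F := F) f) x =ᶠ[𝓝 (chartAt E x x)]
      fun z => oneForm (antiPart (fderiv ℝ (localMap f x) z)) :=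
    Filter.eventually_of_mem ((isOpen_localDomain hf.continuous).mem_nhds hz)
      fun _ ht => localSection_delbar hf ht
  have hc := contDiffAt_localMap hf hz
  have h2 : ∀ v, (fun z : E => antiPart (fderiv ℝ (localMap (F := F) f x) z) v) =
      fun z => fderiv ℝ (localMap f x) z v - holPart (fderiv ℝ (localMap f x) z) v := fun v => by
    funext z
    rw [← holPart_add_antiPart (fderiv ℝ (localMap f x) z) v, add_sub_cancel_left]
  have h3 := fun v => contDiffAt_fderiv_apply hc v
  have h4 := fun v => contDiffAt_holPart hc v
  rw [covDeriv_apply h h1 (fun v => by rw [h2]; exact (h3 v).sub (h4 v)), h2,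
    fderiv_fun_sub ((h3 v).differentiableAt (by simp)) ((h4 v).differentiableAt (by simp)),
    sub_apply, fderiv_holPart hc, fderiv_fderiv_apply hc, mapDeriv_eq hf, localMap_self, delbar,
    mapDeriv_eq hf, oneForm_apply]
  congr 1
  module

theorem delbarE_del (u v : E) : delbarE h f (del f) x ![u, v] =
    mixedHess (localMetric h.metric (f x)) (localMap f x) (chartAt E x x) u v -
      mixedHess (localMetric h.metric (f x)) (localMap f x) (chartAt E x x) v u := by
  have hG := h.isLocalKaehler (f x)
  have hU := localMap_mem (mem_localDomain (E := E) (F := F) (f := f) (x := x))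
  have key : ∀ u v, antiPart (covDeriv h f (del f) x) u ![v] =
      mixedHess (localMetric h.metric (f x)) (localMap f x) (chartAt E x x) u v := fun u v => by
    have h1 : antiPart (covDeriv h f (del f) x) u ![v] = (2 : ℝ)⁻¹ •
        (covDeriv h f (del f) x u ![v] +
          Complex.I • covDeriv h f (del f) x (Complex.I • u) ![v]) := rfl
    rw [h1, covDeriv_del h hf, covDeriv_del h hf, mixedHess]
    rw [← holPart_add_antiPart (fderiv ℝ (localMap f x) (chartAt E x x)) u,
      ← holPart_add_antiPart (fderiv ℝ (localMap f x) (chartAt E x x)) (Complex.I • u), holPart_I,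
      antiPart_I]
    simp only [map_add, map_neg, add_apply, neg_apply, hG.christoffel_I_left hU, smul_add, smul_sub,
      smul_neg, smul_comm Complex.I (2 : ℝ)⁻¹, smul_smul, Complex.I_mul_I, neg_one_smul]
    module
  rw [delbarE, alternatizeUncurryFin_two, key, key]

/-- By symmetry of the second covariant derivative, differentiating ∂̄f(v) along the (1,0)-part of
`u` is the same as differentiating ∂f(u) along the (0,1)-part of `v`. Comparison with `delbarE_del`
gives ∂_{E'}∂̄f = -∂̄_{E'}∂f. -/
theorem delE_delbar (u v : E) : delE h f (delbar f) x ![u, v] =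
    mixedHess (localMetric h.metric (f x)) (localMap f x) (chartAt E x x) v u -
      mixedHess (localMetric h.metric (f x)) (localMap f x) (chartAt E x x) u v := by
  have hG := h.isLocalKaehler (f x)
  have hU := localMap_mem (mem_localDomain (E := E) (F := F) (f := f) (x := x))
  have hc := contDiffAt_localMap hf (mem_localDomain (E := E) (F := F) (f := f) (x := x))
  have hs : ∀ a b, fderiv ℝ (fderiv ℝ (localMap (F := F) f x)) (chartAt E x x) a b =
      fderiv ℝ (fderiv ℝ (localMap f x)) (chartAt E x x) b a := fun a b => by
    rw [← fderiv_fderiv_apply hc, ← fderiv_fderiv_apply hc, fderiv_fderiv_symm hc]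
  have key : ∀ u v, holPart (covDeriv h f (delbar f) x) u ![v] =
      mixedHess (localMetric h.metric (f x)) (localMap f x) (chartAt E x x) v u := fun u v => by
    have h1 : holPart (covDeriv h f (delbar f) x) u ![v] = (2 : ℝ)⁻¹ •
        (covDeriv h f (delbar f) x u ![v] -
          Complex.I • covDeriv h f (delbar f) x (Complex.I • u) ![v]) := rfl
    rw [h1, covDeriv_delbar h hf, covDeriv_delbar h hf, mixedHess, hG.christoffel_symm hU
      (antiPart (fderiv ℝ (localMap f x) (chartAt E x x)) v), hs v u, hs v (Complex.I • u),
      hs (Complex.I • v) u, hs (Complex.I • v) (Complex.I • u)]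
    rw [← holPart_add_antiPart (fderiv ℝ (localMap f x) (chartAt E x x)) u,
      ← holPart_add_antiPart (fderiv ℝ (localMap f x) (chartAt E x x)) (Complex.I • u), holPart_I,
      antiPart_I]
    simp only [map_add, map_neg, add_apply, neg_apply, hG.christoffel_I_left hU, smul_add, smul_sub,
      smul_neg, smul_comm Complex.I (2 : ℝ)⁻¹, smul_smul, Complex.I_mul_I, neg_one_smul]
    module
  rw [delE, alternatizeUncurryFin_two, key, key]

/-- The value of ∂̄_{E'}∂f at a nearby point is computed in the charts centred there; the naturality
of `localCurl` in source and target brings it to the charts at `x`. This yields an expression on a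
whole neighbourhood, which can be differentiated. -/
theorem localSection_delbarE_del (hz : z ∈ localDomain E F f x) (u v : E) :
    localSection f (delbarE h f (del f)) x z ![u, v] =
      localCurl (localMetric h.metric (f x)) (localMap f x) z u v := by
  set y := (chartAt E x).symm z with hy
  have hM := mem_transitionDomain_symm hz.1
  have hG := h.isLocalKaehler (f x)
  have hG' := h.isLocalKaehler (f y)
  have hzy := mem_localDomain (E := E) (F := F) (f := f) (x := y)
  have hN : chartAt F (f y) (f y) ∈ transitionDomain F (f y) (f x) :=
    mem_transitionDomain_chart hz.2
  have e1 : transition E x y z = chartAt E y y := rfl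
  have e2 : localMap f y (chartAt E y y) = chartAt F (f y) (f y) := localMap_self
  have hc := contDiffAt_localMap hf hzy
  have hN' : localMap f y (transition E x y z) ∈ transitionDomain F (f y) (f x) := by
    rw [e1, e2]
    exact hN
  have hτ := contDiffAt_transition hN'
  have hcd : ContDiffAt ℝ ∞ (localMap (F := F) f y) (transition E x y z) := by
    rw [e1]
    exact hc
  have hsurj : Function.Surjective (fderiv ℝ (transition F (f y) (f x))
      (localMap f y (transition E x y z))) := by
    rw [e1, e2, ← chartDeriv_eq hz.2]
    intro t
    have h1 := chartDeriv_chartSymmDeriv (mem_transitionDomain_self (localMap_mem hz))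
    rw [fderiv_transition_self (localMap_mem hz)] at h1
    have h2 : (chartAt F (f x)).symm (localMap f x z) = f y := (chartAt F (f x)).left_inv hz.2
    rw [h2] at h1
    exact ⟨chartSymmDeriv (f x) (localMap f x z) t, congrArg (fun L : F →L[ℝ] F => L t) h1⟩
  have h1 : localCurl (localMetric h.metric (f x)) (localMap f x) z u v =
      fderiv ℝ (transition F (f y) (f x)) (localMap f y (transition E x y z))
        (localCurl (localMetric h.metric (f y)) (localMap f y) (transition E x y z)
          (fderiv ℝ (transition E x y) z u) (fderiv ℝ (transition E x y) z v)) := by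
    rw [localCurl_congr (localMap_eventuallyEq hf.continuous hz),
      localCurl_comp_right (contDiffAt_transition hM)
        (Filter.eventually_of_mem (isOpen_transitionDomain.mem_nhds hM) fun t ht w =>
          fderiv_transition_I ht w) (hτ.comp _ hcd)]
    exact localCurl_comp_left hG hG' (localMap_mem hzy) (transition_mem hN' hN').1 hτ
      (Filter.eventually_of_mem (isOpen_transitionDomain.mem_nhds hN') fun t ht w =>
        fderiv_transition_I ht w) hsurj
      (Filter.eventually_of_mem (isOpen_transitionDomain.mem_nhds hN') fun t ht u v =>
        localMetric_transition _ ht u v) hcd _ _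
  have h2 : (fun i => chartSymmDeriv x z (![u, v] i)) =
      ![chartSymmDeriv x z u, chartSymmDeriv x z v] := by ext i; fin_cases i <;> rfl
  rw [h1, localSection_apply, ← hy, h2, delbarE_del h hf, e1, e2, chartDeriv_eq hz.2,
    chartSymmDeriv_eq hz.1, localCurl_eq hG' hc (localMap_mem hzy)]

theorem localForm_bracket_eventually : ∀ᶠ z in 𝓝 (chartAt E x x), ∀ a b c,
    localForm (bracket h f (delbarE h f (del f)) (delbar f - del f)) x z ![a, b, c] =
      herm (localMetric h.metric (f x) (localMap f x z))
        (localCurl (localMetric h.metric (f x)) (localMap f x) z a b)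
        (antiPart (fderiv ℝ (localMap f x) z) c - holPart (fderiv ℝ (localMap f x) z) c) +
      herm (localMetric h.metric (f x) (localMap f x z))
        (localCurl (localMetric h.metric (f x)) (localMap f x) z b c)
        (antiPart (fderiv ℝ (localMap f x) z) a - holPart (fderiv ℝ (localMap f x) z) a) +
      herm (localMetric h.metric (f x) (localMap f x z))
        (localCurl (localMetric h.metric (f x)) (localMap f x) z c a)
        (antiPart (fderiv ℝ (localMap f x) z) b - holPart (fderiv ℝ (localMap f x) z) b) := by
  refine Filter.eventually_of_mem ((isOpen_localDomain hf.continuous).mem_nhds (mem_localDomain (E := E) (F := F)))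
    fun z hz a b c => ?_
  have h1 : ∀ v, localSection f (delbar (F := F) f - del f) x z ![v] =
      antiPart (fderiv ℝ (localMap f x) z) v - holPart (fderiv ℝ (localMap f x) z) v := fun v => by
    have h2 := congrArg (fun L : E [⋀^Fin 1]→L[ℝ] F => L ![v]) (localSection_delbar hf hz)
    have h3 := congrArg (fun L : E [⋀^Fin 1]→L[ℝ] F => L ![v]) (localSection_del hf hz)
    have h4 : localSection f (delbar (F := F) f - del f) x z ![v] =
        localSection f (delbar (F := F) f) x z ![v] - localSection f (del f) x z ![v] :=
      map_sub (chartDeriv (f x) (f ((chartAt E x).symm z))) _ _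
    rw [h4]
    exact congrArg₂ (· - ·) h2 h3
  rw [localForm_bracket h _ _ hz]
  erw [wedge_two_one]
  rw [h1, h1, h1]
  simp only [← localSection_delbarE_del h hf hz]

/-- The local expression of the bracket is differentiable, and its exterior derivative on a pair of
complex lines is given by the curvature and the mixed second derivatives. -/
theorem extD_bracket_lines (u v : E) :
    DifferentiableAt ℝ (localForm (bracket h f (delbarE h f (del f)) (delbar f - del f)) x)
      (chartAt E x x) ∧
    extD (bracket h f (delbarE h f (del f)) (delbar f - del f)) x
      ![u, Complex.I • u, v, Complex.I • v] =
      -2 * altSum (fun w : Fin 4 → E => curv (localMetric h.metric (f x)) (chartAt F (f x) (f x))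
        (antiPart (mapDeriv f x) (w 0)) (antiPart (mapDeriv f x) (w 1))
        (holPart (mapDeriv f x) (w 2)) (holPart (mapDeriv f x) (w 3)))
          ![u, Complex.I • u, v, Complex.I • v] +
      8 * (herm (h.metric (f x))
          (mixedHess (localMetric h.metric (f x)) (localMap f x) (chartAt E x x) u v)
          (mixedHess (localMetric h.metric (f x)) (localMap f x) (chartAt E x x) u v) +
        herm (h.metric (f x))
          (mixedHess (localMetric h.metric (f x)) (localMap f x) (chartAt E x x) v u)
          (mixedHess (localMetric h.metric (f x)) (localMap f x) (chartAt E x x) v u) -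
        herm (h.metric (f x))
          (mixedHess (localMetric h.metric (f x)) (localMap f x) (chartAt E x x) u u)
          (mixedHess (localMetric h.metric (f x)) (localMap f x) (chartAt E x x) v v) -
        herm (h.metric (f x))
          (mixedHess (localMetric h.metric (f x)) (localMap f x) (chartAt E x x) v v)
          (mixedHess (localMetric h.metric (f x)) (localMap f x) (chartAt E x x) u u)) := by
  have hz := mem_localDomain (E := E) (F := F) (f := f) (x := x)
  have hc := contDiffAt_localMap hf hz
  have hG := h.isLocalKaehler (f x)
  have hU := localMap_mem hz
  have h1 := localForm_bracket_eventually (x := x) h hf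
  refine ⟨(extDeriv_bracket hG hc hU (fun z v => antiPart (fderiv ℝ (localMap f x) z) v -
    holPart (fderiv ℝ (localMap f x) z) v) (fun _ _ => rfl) h1 _ (fun _ _ _ => rfl) _ rfl _ rfl
    u u u u).1, ?_⟩
  have h2 := extDeriv_bracket_lines hG hc hU (fun z v => antiPart (fderiv ℝ (localMap f x) z) v -
    holPart (fderiv ℝ (localMap f x) z) v) (fun _ _ => rfl) h1 u v
  rw [← mapDeriv_eq hf, localMap_self, localMetric_self] at h2
  exact h2

/-- The coordinate sum collapses by `sum_curvCoeff`, leaving the alternating sum that occurs in the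
derivative of the bracket. -/
theorem curvatureForm_apply {m : ℕ} (b : Module.Basis (Fin m) ℂ F) (v : Fin (1 + 1 + 1 + 1) → E) :
    curvatureForm h f b x v =
      altSum (fun w : Fin 4 → E => curv (localMetric h.metric (f x)) (chartAt F (f x) (f x))
        (antiPart (mapDeriv f x) (w 0)) (antiPart (mapDeriv f x) (w 1))
        (holPart (mapDeriv f x) (w 2)) (holPart (mapDeriv f x) (w 3))) v := by
  have hG := h.isLocalKaehler (f x)
  simp only [← sum_curvCoeff hG (mem_chart_target F (f x)) b, altSum_sum]
  simp only [curvatureForm, ContinuousAlternatingMap.sum_apply, ContinuousAlternatingMap.smul_apply]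
  refine Finset.sum_congr rfl fun i _ => Finset.sum_congr rfl fun j _ =>
    Finset.sum_congr rfl fun k _ => Finset.sum_congr rfl fun l _ => ?_
  rw [cwedge_one_forms]
  exact map_altSum (AddMonoidHom.mulLeft
    (curvCoeff b (localMetric h.metric (f x)) (chartAt F (f x) (f x)) i j k l)) _ _

end CovariantDerivative

/-! ### The Leibniz rule with a closed factor. -/

section Leibniz

set_option linter.unusedSectionVars false
set_option maxSynthPendingDepth 3

variable {V : Type*} [NormedAddCommGroup V] [NormedSpace ℝ V] [FiniteDimensional ℝ V] {p q k : ℕ}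

variable (V p q) in
/-- The wedge product as a continuous bilinear map. -/
noncomputable def cwedgeL :
    (V [⋀^Fin p]→L[ℝ] ℂ) →L[ℝ] (V [⋀^Fin q]→L[ℝ] ℂ) →L[ℝ] (V [⋀^Fin (p + q)]→L[ℝ] ℂ) :=
  LinearMap.toContinuousLinearMap (LinearMap.toContinuousLinearMap.toLinearMap ∘ₗ
    LinearMap.mk₂ ℝ (cwedge (V := V) (p := p) (q := q))
      (fun α α' β => by
        ext v
        simp only [cwedge, wedge_apply, ContinuousAlternatingMap.add_apply, map_add, add_apply,
          smul_add, Finset.sum_add_distrib])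
      (fun c α β => by
        ext v
        simp only [cwedge, wedge_apply, ContinuousAlternatingMap.smul_apply, map_smul, smul_apply,
          Finset.smul_sum, smul_comm c])
      (fun α β β' => by
        ext v
        simp only [cwedge, wedge_apply, ContinuousAlternatingMap.add_apply, map_add,
          smul_add, Finset.sum_add_distrib])
      (fun c α β => by
        ext v
        simp only [cwedge, wedge_apply, ContinuousAlternatingMap.smul_apply, map_smul,
          Finset.smul_sum, smul_comm c]))

variable {a : V → V [⋀^Fin p]→L[ℝ] ℂ} {b : V → V [⋀^Fin q]→L[ℝ] ℂ} {z : V}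

theorem differentiableAt_cwedge (ha : DifferentiableAt ℝ a z) (hb : DifferentiableAt ℝ b z) :
    DifferentiableAt ℝ (fun z => cwedge (a z) (b z)) z :=
  (((cwedgeL V p q).differentiableAt.comp z ha).clm_apply hb)

/-- The Leibniz rule for the wedge product with a closed form. -/
theorem extDeriv_cwedge (ha : DifferentiableAt ℝ a z) (hb : DifferentiableAt ℝ b z)
    (hc : extDeriv b z = 0) : extDeriv (fun z => cwedge (a z) (b z)) z =
      castDeg (add_one_add p q) (cwedge (extDeriv a z) (b z)) := by
  have h1 := (((cwedgeL V p q).hasFDerivAt.comp z ha.hasFDerivAt).clm_apply hb.hasFDerivAt).fderiv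
  have h2 : fderiv ℝ (fun z => cwedge (a z) (b z)) z =
      (cwedgeL V p q).flip (b z) ∘L fderiv ℝ a z + cwedgeL V p q (a z) ∘L fderiv ℝ b z := by
    refine h1.trans ?_
    ext u : 1
    simp [add_comm]
  rw [extDeriv, h2, ContinuousAlternatingMap.alternatizeUncurryFin_add,
    alternatizeUncurryFin_cwedge_left (fderiv ℝ a z) (b z) _ fun _ => rfl,
    alternatizeUncurryFin_cwedge_right (fderiv ℝ b z) (a z) _ (fun _ => rfl) hc, add_zero]
  rfl

theorem wedgePow_closed {η : V → V [⋀^Fin 2]→L[ℝ] ℂ} (hη : DifferentiableAt ℝ η z)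
    (hc : extDeriv η z = 0) : ∀ k : ℕ, DifferentiableAt ℝ (fun z => wedgePow (η z) k) z ∧
      extDeriv (fun z => wedgePow (η z) k) z = 0
  | 0 => ⟨differentiableAt_const _, by
      rw [extDeriv]
      simp only [wedgePow, fderiv_fun_const]
      ext v
      simp [ContinuousAlternatingMap.alternatizeUncurryFin_apply]⟩
  | k + 1 => by
    obtain ⟨h1, h2⟩ := wedgePow_closed hη hc k
    refine ⟨differentiableAt_cwedge h1 hη, ?_⟩
    refine (extDeriv_cwedge h1 hη hc).trans ?_
    rw [h2]
    ext v
    rw [castDeg_apply, cwedge, wedge_apply]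
    simp

theorem dividedPow_closed {η : V → V [⋀^Fin 2]→L[ℝ] ℂ} (hη : DifferentiableAt ℝ η z)
    (hc : extDeriv η z = 0) (k : ℕ) : DifferentiableAt ℝ (fun z => dividedPow (η z) k) z ∧
      extDeriv (fun z => dividedPow (η z) k) z = 0 := by
  obtain ⟨h1, h2⟩ := wedgePow_closed hη hc k
  refine ⟨h1.fun_const_smul _, ?_⟩
  exact (extDeriv_smul _ _).trans (by rw [h2, smul_zero])

end Leibniz

/-! ### Pullback of wedge products and the exterior derivative on the manifold. -/

section Forms

variable {E : Type*} [NormedAddCommGroup E] [NormedSpace ℂ E]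
  {M : Type*} [TopologicalSpace M] [ChartedSpace E M] {p q : ℕ}

theorem cwedge_comp (α : E [⋀^Fin p]→L[ℝ] ℂ) (β : E [⋀^Fin q]→L[ℝ] ℂ) (L : E →L[ℝ] E) :
    (cwedge α β).compContinuousLinearMap L =
      cwedge (α.compContinuousLinearMap L) (β.compContinuousLinearMap L) := by
  ext v
  rw [ContinuousAlternatingMap.compContinuousLinearMap_apply, cwedge, cwedge, wedge_apply,
    wedge_apply]
  rfl

theorem wedgePow_comp (η : E [⋀^Fin 2]→L[ℝ] ℂ) (L : E →L[ℝ] E) : ∀ k : ℕ,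
    (wedgePow η k).compContinuousLinearMap L = wedgePow (η.compContinuousLinearMap L) k
  | 0 => by
    ext v
    rfl
  | k + 1 => by rw [wedgePow, wedgePow, cwedge_comp, wedgePow_comp η L k]

theorem dividedPow_comp (η : E [⋀^Fin 2]→L[ℝ] ℂ) (L : E →L[ℝ] E) (k : ℕ) :
    (dividedPow η k).compContinuousLinearMap L = dividedPow (η.compContinuousLinearMap L) k := by
  rw [dividedPow, dividedPow, ← wedgePow_comp]
  rfl

theorem localForm_cwedge_dividedPow (α : M → E [⋀^Fin p]→L[ℝ] ℂ) (η : M → E [⋀^Fin 2]→L[ℝ] ℂ)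
    (k : ℕ) (x : M) : localForm (fun y => cwedge (α y) (dividedPow (η y) k)) x =
      fun z => cwedge (localForm α x z) (dividedPow (localForm η x z) k) := by
  funext z
  rw [localForm, cwedge_comp, dividedPow_comp]
  rfl

variable [IsManifold 𝓘(ℂ, E) ∞ M] [FiniteDimensional ℂ E]

theorem KaehlerMetric.extD_cwedge_dividedPow (g : KaehlerMetric E M) (α : M → E [⋀^Fin p]→L[ℝ] ℂ)
    (x : M) (hα : DifferentiableAt ℝ (localForm α x) (chartAt E x x)) (k : ℕ) :
    extD (fun y => cwedge (α y) (dividedPow (g.form y) k)) x =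
      castDeg (add_one_add p (2 * k)) (cwedge (extD α x) (dividedPow (g.form x) k)) := by
  have hz := mem_chart_target E x
  obtain ⟨h1, h2⟩ := dividedPow_closed
    ((g.contDiffAt_localForm_form hz).differentiableAt (by simp)) (g.extDeriv_localForm_form hz) k
  rw [extD, localForm_cwedge_dividedPow, extDeriv_cwedge hα h1 h2, localForm_self]
  rfl

end Forms

/-! ### Comparison of top-degree forms and reality of the curvature form. -/

section Main

set_option linter.unusedSectionVars false

variable {V : Type*} [NormedAddCommGroup V] [NormedSpace ℂ V] [FiniteDimensional ℂ V]
  {G : V → V →L[ℝ] V →L[ℝ] ℝ} {U : Set V} {w : V} {n : ℕ}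

theorem IsLocalKaehler.castDeg_eq (hG : IsLocalKaehler G U) (hw : w ∈ U)
    {e : Module.Basis (Fin n) ℂ V} (he : ∀ a b, herm (G w) (e a) (e b) = if a = b then 2⁻¹ else 0)
    {q : ℕ} (h : 2 * n = q) {α : V [⋀^Fin (2 * n)]→L[ℝ] ℂ} {β : V [⋀^Fin q]→L[ℝ] ℂ}
    (hα : α (pairs e) = β (pairs e ∘ Fin.cast h.symm)) : castDeg h α = β := by
  subst h
  exact hG.topForm_ext hw he hα

/-- The curvature 4-form is real. -/
theorem IsLocalKaehler.conj_altSum_curv (hG : IsLocalKaehler G U) (hw : w ∈ U) {X : Type*}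
    [NormedAddCommGroup X] [NormedSpace ℝ X] (P Q : X → V) (v : Fin 4 → X) :
    (starRingEnd ℂ) (altSum (fun t => curv G w (Q (t 0)) (Q (t 1)) (P (t 2)) (P (t 3))) v) =
      altSum (fun t => curv G w (Q (t 0)) (Q (t 1)) (P (t 2)) (P (t 3))) v := by
  have h1 := map_altSum (starRingEnd ℂ).toAddMonoidHom
    (fun t : Fin 4 → X => curv G w (Q (t 0)) (Q (t 1)) (P (t 2)) (P (t 3))) v
  refine h1.trans ?_
  -- Conjugation exchanges the arguments of `curv` in the pairs 0, 1 and 2, 3, which is an even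
  -- permutation.
  have h2 := altSum_comp_perm
    (fun t : Fin 4 → X => curv G w (Q (t 0)) (Q (t 1)) (P (t 2)) (P (t 3)))
    (Equiv.swap 0 1 * Equiv.swap 2 3) v
  have h3 : Equiv.Perm.sign (Equiv.swap (0 : Fin 4) 1 * Equiv.swap 2 3) = 1 := by decide
  rw [h3, one_smul] at h2
  rw [← h2]
  congr 1
  funext t
  exact hG.curv_conj hw _ _ _ _

end Main

/-! ### The Bochner identity at a point. -/

section Bochner

set_option linter.unusedSectionVars false

variable {E : Type*} [NormedAddCommGroup E] [NormedSpace ℂ E] [FiniteDimensional ℂ E]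
  {F : Type*} [NormedAddCommGroup F] [NormedSpace ℂ F] [FiniteDimensional ℂ F]
  {M : Type*} [TopologicalSpace M] [ChartedSpace E M] [IsManifold 𝓘(ℂ, E) ∞ M]
  {N : Type*} [TopologicalSpace N] [ChartedSpace F N] [IsManifold 𝓘(ℂ, F) ∞ N]
  {n m : ℕ} {f : M → N} (g : KaehlerMetric E M) (h : KaehlerMetric F N) (x : M)

theorem KaehlerMetric.exists_unitary_basis (bE : Module.Basis (Fin n) ℂ E) :
    ∃ e : Module.Basis (Fin n) ℂ E,
      ∀ a b, herm (localMetric g.metric x (chartAt E x x)) (e a) (e b) =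
        if a = b then 2⁻¹ else 0 :=
  (g.isLocalKaehler x).exists_unitary_basis (mem_chart_target E x)
    (by rw [Module.finrank_eq_card_basis bE, Fintype.card_fin])

variable {g x} {e : Module.Basis (Fin n) ℂ E}
  (he : ∀ a b, herm (localMetric g.metric x (chartAt E x x)) (e a) (e b) =
    if a = b then 2⁻¹ else 0)

include he

theorem KaehlerMetric.isUnitaryFrame : IsUnitaryFrame (g.form x) e := by
  have h1 := (g.isLocalKaehler x).isUnitaryFrame (mem_chart_target E x) he
  rwa [localMetric_self] at h1

/-- The curvature term, as a real number. -/
theorem exists_curvatureTerm (hf : ContMDiff 𝓘(ℝ, E) 𝓘(ℝ, F) ∞ f) (bF : Module.Basis (Fin m) ℂ F) :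
    ∃ r : ℝ, (r : ℂ) =
      -(2⁻¹ * ∑ a, ∑ b, curvatureForm h f bF x ![e a, Complex.I • e a, e b, Complex.I • e b]) := by
  refine ⟨_, Complex.conj_eq_iff_re.1 ?_⟩
  simp only [map_neg, map_mul, map_inv₀, map_ofNat, map_sum]
  congr 2
  refine Finset.sum_congr rfl fun a _ => Finset.sum_congr rfl fun b _ => ?_
  rw [curvatureForm_apply h hf]
  exact (h.isLocalKaehler (f x)).conj_altSum_curv (mem_chart_target F (f x)) _ _ _

/-- On the frame ωⁿ/n! has value 1, so the equation of forms is one equation of numbers. This gives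
existence and uniqueness of `Q` at once. -/
theorem isCurvatureTerm_iff (bF : Module.Basis (Fin m) ℂ F) (hn : 2 ≤ n) (r : ℝ) :
    castDeg (degree_eq hn) (r • dividedPow (g.form x) n) =
      - cwedge (curvatureForm h f bF x) (dividedPow (g.form x) (n - 2)) ↔ (r : ℂ) =
      -(2⁻¹ * ∑ a, ∑ b, curvatureForm h f bF x ![e a, Complex.I • e a, e b, Complex.I • e b]) := by
  have hu := KaehlerMetric.isUnitaryFrame he
  have h1 : (r • dividedPow (g.form x) n) (pairs e) = r := by
    rw [ContinuousAlternatingMap.smul_apply, hu.dividedPow_pairs]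
    simp
  have h2 := hu.cwedge_dividedPow_pairs hn (curvatureForm h f bF x)
  rw [← h2, ← h1]
  constructor
  · intro h3
    have h4 := congrArg (fun α => α (pairs e ∘ Fin.cast (degree_eq hn).symm)) h3
    rw [castDeg_apply] at h4
    exact h4
  · exact fun h3 => (g.isLocalKaehler x).castDeg_eq (mem_chart_target E x) he _ h3

theorem sum_mixedHess_eq_zero (hf : IsHarmonicMap g h f) :
    ∑ s, mixedHess (localMetric h.metric (f x)) (localMap f x) (chartAt E x x) (e s) (e s) = 0 := by
  have hz := mem_localDomain (E := E) (F := F) (f := f) (x := x)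
  have h1 := trace_hessian (g.isLocalKaehler x) (mem_chart_target E x) (h.isLocalKaehler (f x))
    (contDiffAt_localMap hf.1 hz) (localMap_mem hz) he
  have h2 := hf.2 x
  simp only [tension, hessian] at h2
  rw [localMetric_self, localMap_self, ← mapDeriv_eq hf.1, h2] at h1
  exact (smul_eq_zero.1 h1.symm).resolve_left (by norm_num)

/-- Taking the real part in `normSq` loses nothing, since in a unitary basis the contraction is a
sum of numbers ⟨A, A⟩, each equal to its conjugate. -/
theorem normSq_delE_delbar (hf : IsHarmonicMap g h f) (bE : Module.Basis (Fin n) ℂ E) :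
    ((normSq g h f bE (delE h f (delbar f)) x : ℝ) : ℂ) = ∑ a, ∑ c, herm (h.metric (f x))
      (mixedHess (localMetric h.metric (f x)) (localMap f x) (chartAt E x x) (e a) (e c))
      (mixedHess (localMetric h.metric (f x)) (localMap f x) (chartAt E x x) (e a) (e c)) := by
  have hz := mem_localDomain (E := E) (F := F) (f := f) (x := x)
  have hG := h.isLocalKaehler (f x)
  have h1 := sum_norm_mixedHess (g.isLocalKaehler x) (mem_chart_target E x) hG (localMap_mem hz) he
    bE
  have h3 := formCoeff_eq_mixedHess hG (localMap_mem hz) (delE_delbar (x := x) h hf.1) bE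
  rw [localMetric_self, localMap_self, localMetric_self] at h1
  rw [normSq]
  simp only [h3]
  rw [h1]
  refine Complex.conj_eq_iff_re.1 ?_
  simp only [map_sum]
  refine Finset.sum_congr rfl fun a _ => Finset.sum_congr rfl fun c _ => ?_
  have h4 := hG.herm_conj (localMap_mem hz)
    (mixedHess (localMetric h.metric (f x)) (localMap f x) (chartAt E x x) (e a) (e c))
    (mixedHess (localMetric h.metric (f x)) (localMap f x) (chartAt E x x) (e a) (e c))
  rwa [localMap_self, localMetric_self] at h4

theorem sum_extD_bracket (hf : IsHarmonicMap g h f) (bE : Module.Basis (Fin n) ℂ E)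
    (bF : Module.Basis (Fin m) ℂ F) :
    2⁻¹ * ∑ a, ∑ b, extD (bracket h f (delbarE h f (del f)) (delbar f - del f)) x
      ![e a, Complex.I • e a, e b, Complex.I • e b] =
    8 * ((normSq g h f bE (delE h f (delbar f)) x : ℝ) : ℂ) - 2 * (2⁻¹ * ∑ a, ∑ b,
      curvatureForm h f bF x ![e a, Complex.I • e a, e b, Complex.I • e b]) := by
  have h0 := sum_mixedHess_eq_zero h he hf
  rw [normSq_delE_delbar h he hf bE]
  simp only [fun u v => (extD_bracket_lines (x := x) h hf.1 u v).2, ← curvatureForm_apply h hf.1 bF]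
  set A : Fin n → Fin n → F := fun a b =>
    mixedHess (localMetric h.metric (f x)) (localMap f x) (chartAt E x x) (e a) (e b) with hA
  have h1 : ∀ a b, mixedHess (localMetric h.metric (f x)) (localMap f x) (chartAt E x x) (e a)
    (e b) = A a b := fun _ _ => rfl
  simp only [h1] at h0 ⊢
  -- The double sum is the square of the trace of A, which harmonicity makes zero.
  have h2 : ∑ a, ∑ b, herm (h.metric (f x)) (A a a) (A b b) = 0 := by
    simp only [← map_sum]
    simp [h0]
  have h3 : ∑ a, ∑ b, herm (h.metric (f x)) (A b b) (A a a) = 0 := by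
    rw [Finset.sum_comm]
    exact h2
  have h4 : ∑ a, ∑ b, herm (h.metric (f x)) (A b a) (A b a) =
      ∑ a, ∑ b, herm (h.metric (f x)) (A a b) (A a b) := Finset.sum_comm
  -- The two squared norms have the same double sum, so the constant is 2⁻¹ · 8 · 2 = 8; for the
  -- curvature, 2⁻¹ · (-2) keeps -2 times the half sum that defines -Q.
  simp only [Finset.sum_add_distrib, ← Finset.mul_sum, Finset.sum_sub_distrib, h2, h3, h4]
  ring

theorem extD_bracket_wedge (hf : IsHarmonicMap g h f) (bE : Module.Basis (Fin n) ℂ E)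
    (bF : Module.Basis (Fin m) ℂ F) (hn : 2 ≤ n) {r : ℝ} (hr : (r : ℂ) =
      -(2⁻¹ * ∑ a, ∑ b, curvatureForm h f bF x ![e a, Complex.I • e a, e b, Complex.I • e b])) :
    cwedge (extD (bracket h f (delbarE h f (del f)) (delbar f - del f)) x)
        (dividedPow (g.form x) (n - 2)) =
      castDeg (degree_eq hn)
        ((8 * normSq g h f bE (delE h f (delbar f)) x + 2 * r) • dividedPow (g.form x) n) := by
  have hu := KaehlerMetric.isUnitaryFrame he
  refine ((g.isLocalKaehler x).castDeg_eq (mem_chart_target E x) he _ ?_).symm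
  rw [hu.cwedge_dividedPow_pairs hn, sum_extD_bracket h he hf bE bF,
    ContinuousAlternatingMap.smul_apply, hu.dividedPow_pairs]
  rw [Complex.real_smul, mul_one]
  push_cast
  rw [hr]
  ring

end Bochner

end KaehlerBochner

theorem mainTheorem8 {n m : ℕ} (hn : 2 ≤ n)
    {E : Type*} [NormedAddCommGroup E] [NormedSpace ℂ E] [FiniteDimensional ℂ E]
    {F : Type*} [NormedAddCommGroup F] [NormedSpace ℂ F] [FiniteDimensional ℂ F]
    (bE : Module.Basis (Fin n) ℂ E) (bF : Module.Basis (Fin m) ℂ F)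
    {M : Type*} [TopologicalSpace M] [ChartedSpace E M] [IsManifold 𝓘(ℂ, E) ∞ M]
    {N : Type*} [TopologicalSpace N] [ChartedSpace F N] [IsManifold 𝓘(ℂ, F) ∞ N]
    (g : KaehlerMetric E M) (h : KaehlerMetric F N) (f : M → N) (hf : IsHarmonicMap g h f) :
    (∃! Q : M → ℝ, IsCurvatureTerm g h f bF hn Q) ∧
    ∀ Q : M → ℝ, IsCurvatureTerm g h f bF hn Q → ∀ x : M,
      cwedge (extD (bracket h f (delbarE h f (del f)) (delbar f - del f)) x)
          (dividedPow (g.form x) (n - 2)) =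
        castDeg (degree_eq hn)
          ((8 * normSq g h f bE (delE h f (delbar f)) x + 2 * Q x) • dividedPow (g.form x) n) ∧
      extD (fun y => cwedge (bracket h f (delbarE h f (del f)) (delbar f - del f) y)
          (dividedPow (g.form y) (n - 2))) x =
        castDeg (degree_eq' hn)
          ((8 * normSq g h f bE (delE h f (delbar f)) x + 2 * Q x) • dividedPow (g.form x) n) := by
  refine ⟨?_, fun Q hQ x => ?_⟩
  · have key : ∀ x, ∃ r : ℝ, castDeg (degree_eq hn) (r • dividedPow (g.form x) n) =
        - cwedge (curvatureForm h f bF x) (dividedPow (g.form x) (n - 2)) ∧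
        ∀ r' : ℝ, castDeg (degree_eq hn) (r' • dividedPow (g.form x) n) =
          - cwedge (curvatureForm h f bF x) (dividedPow (g.form x) (n - 2)) → r' = r := fun x => by
      obtain ⟨e, he⟩ := g.exists_unitary_basis x bE
      obtain ⟨r, hr⟩ := exists_curvatureTerm h he hf.1 bF
      refine ⟨r, (isCurvatureTerm_iff h he bF hn r).2 hr, fun r' hr' => ?_⟩
      exact_mod_cast ((isCurvatureTerm_iff h he bF hn r').1 hr').trans hr.symm
    choose Q hQ hu using key
    exact ⟨Q, hQ, fun Q' hQ' => funext fun x => hu x (Q' x) (hQ' x)⟩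
  · obtain ⟨e, he⟩ := g.exists_unitary_basis x bE
    have h1 := extD_bracket_wedge h he hf bE bF hn ((isCurvatureTerm_iff h he bF hn (Q x)).1 (hQ x))
    refine ⟨h1, ?_⟩
    have h2 := (extD_bracket_lines (x := x) h hf.1 (0 : E) 0).1
    -- As ω is closed, the derivative falls on the bracket alone, and the first identity applies.
    rw [g.extD_cwedge_dividedPow _ x h2, h1, castDeg_castDeg]
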